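/- **Setting.** Let $D=\{(x,y)\in\mathbb R^2: f(x,y)\ge 0\}$ be the disc with three holes given by $f=(144-x^2-y^2)\,(x^2+y^2-1)\,((x-4)^2+y^2-1)\,((x+4)^2+y^2-1)$, and let $M=\#3(S^2\times S^1)$ be realized as the closed smooth hypersurface $M=\{z^2+w^2=f(x,y)\}\subset\mathbb R^4$ (the domain $D$ spun about its boundary; equivalently the double of the handlebody $D\times[0,1]$), oriented as the boundary of $\{z^2+w^2\le f(x,y)\}$. Let $\phi_0:S^1\to M$ be the curve $u\mapsto(\operatorname{Re}\zeta,\operatorname{Im}\zeta,\sqrt{f(\zeta)},0)$, $\zeta=6u-4u^3$, $|u|=1$: it lies in the copy $\{w=0,\ z\ge 0\}$ of $D$, goes around all three holes, and makes one more small loop around each of the two outer holes, with the two self-intersection points on the outer sides of these holes. **Definitions.** An $[i]$-configuration is a collection of $2i$ distinct points of $S^1$ partitioned into $i$ pairs (chords); a map $\phi:S^1\to M$ respects it if it sends both points of each pair to one point. An $[i]_M$-route is a path component of the space of pairs ($[i]$-configuration, continuous map $S^1\to M$ respecting it); for an $[i]_M$-route $I$, $\{I\}$ denotes this component. A realization of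 a $[2]_M$-route is *generic* if its map is a smooth immersion having no self-intersections but the two given ones, both transverse. An arc of $S^1$ bounded by the points of one pair and containing no other points of the configuration is *suspicious*, and its image in $M$ is a suspicious loop. A $[2]_M$-route is *marginal* if one of its suspicious loops is contractible in $M$. Let $\phi$ be a smooth immersion with a triple point $\phi(P)=\phi(Q)=\phi(R)$ at which the three tangent vectors are linearly independent, and with no other self-intersections. A small perturbation can split any one of the three points $P,Q,R$, say $P$, into two points $P',P''$, with chords joining $P'$ to $Q$ and $P''$ to $R$, so that the perturbed map respects a $[2]$-configuration; up to homotopy there are two such perturbations for each of $P,Q,R$, one with crossing and one with non-crossing chords. Two $[2]_M$-routes are *neighbors* if they contain two of the three perturbations with non-crossing chords of one such $\phi$. Two routes are *related* (are *relatives*) if they are joined by a finite chain of routes in which consecutive ones are neighbors. For a curve $\phi$ let $A(\phi)\subset H_1(M;\mathbb Z)$ be the subgroup generated by the cycles lying in $\phi(S^1)$, i.e. the image of $H_1(\phi(S^1);\mathbb Z)\to H_1(M;\mathbb Z)$. The group $E_1^{-2,2}$ (integer coefficients) consists of all $\mathbb Z$-valued functions $\gamma$ on the set of $[2]_M$-routes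 such that (i) $\gamma=0$ on all marginal routes; (ii) (four-term relation) for every $\phi$ with a triple point as above, the three differences (value of $\gamma$ at the crossing perturbation splitting a point) $-$ (value at the non-crossing one splitting the same point), for the points $P,Q,R$, coincide. The differential $d^1:E_1^{-2,2}\to E_1^{-1,2}$ has the component $\breve d^1:E_1^{-2,2}\to\prod_J H^1(\{J\};\mathbb Z)$ (product over all $[1]_M$-routes $J$), where $\langle\breve d^1(\gamma),l\rangle$ for a generic loop $l$ in $\{J\}$ is the sum of the values of $\gamma$ at the $[2]_M$-routes of the points of $l$ where an additional transverse self-intersection appears, each taken with the sign $\pm1$ of the corresponding crossing change (determined by the orientation of $M$). **Lemma.** The curve $\phi_0$ is an immersion with exactly two self-intersections, both transverse, and its two chords do not cross; let $I_0$ be its $[2]_M$-route. Then: 1. No relative of $I_0$ is marginal. 2. If $\phi,\psi$ are the maps of generic realizations of two related (in particular, of two neighboring) $[2]_M$-routes, then $A(\phi)=A(\psi)$; $\operatorname{rank}A(\phi_0)=3$; and $\operatorname{rank}A(\phi)\le 2$ for the map $\phi$ of any generic realization of a marginal $[2]_M$-route. 3. The function $\gamma$ equal to $1$ on all relatives of $I_0$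 and to $0$ on all other $[2]_M$-routes belongs to $E_1^{-2,2}$, and $\breve d^1(\gamma)\ne0$: there is a generic loop $l$ with $\langle\breve d^1(\gamma),l\rangle\neq 0$. Hence $d^1(\gamma)\neq0$, and the spectral sequence does not degenerate at $E_1$. -/

import Mathlib

open scoped ContDiff unitInterval

noncomputable section

namespace KnotSS

/-! ### The manifold -/

/-- The ambient space `ℝ⁴` with coordinates `(x, y, z, w)`. -/
abbrev E4 : Type := EuclideanSpace ℝ (Fin 4)

/-- The planar domain with three holes is `{(x, y) : 0 ≤ outline x y}`: the disc of radius `12`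
about the origin minus the open unit discs about `(0, 0)`, `(4, 0)`, `(-4, 0)`. -/
def outline (x y : ℝ) : ℝ :=
  (144 - (x ^ 2 + y ^ 2)) * (x ^ 2 + y ^ 2 - 1) *
    ((x - 4) ^ 2 + y ^ 2 - 1) * ((x + 4) ^ 2 + y ^ 2 - 1)

/-- The defining function of `M`; `0` is a regular value of it. -/
def defFun (p : E4) : ℝ := p 2 ^ 2 + p 3 ^ 2 - outline (p 0) (p 1)

/-- The closed 3-manifold `M = #3 (S² × S¹)`, as the smooth hypersurface
`z² + w² = outline x y` in `ℝ⁴`. It is obtained from the planar domain with three holes `D` by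
spinning it about its boundary, i.e. it is the boundary of the thickening
`{z² + w² ≤ outline x y}` of `D`, a 4-dimensional handlebody with three 1-handles; equivalently it
is the double of the 3-dimensional handlebody `D × [0, 1]`.
(An annulus spun about its boundary is `S² × S¹`; cutting `D` between its holes by arcs
amounts to cutting `M` along 2-spheres.) The outline `D` lies in `M` as `{w = 0, 0 ≤ z}`. -/
abbrev M : Type := {p : E4 // defFun p = 0}

/-- The orientation of `M`, as the boundary of `{defFun ≤ 0}`: three tangent vectors `v₁ v₂ v₃` at
`p` form a positive (negative) frame iff this determinant is positive (negative). -/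
def frameDet (p : M) (v₁ v₂ v₃ : E4) : ℝ :=
  Matrix.det (Matrix.of fun i j : Fin 4 =>
    (![gradient defFun (p : E4), v₁, v₂, v₃] i : E4) j)

/-! ### Curves -/

/-- A map `S¹ → M` in the angular coordinate of `S¹`. -/
def lift (φ : C(Circle, M)) (t : ℝ) : E4 := (φ (Circle.exp t) : E4)

/-- `φ` is a smooth immersion. -/
def IsImmersion (φ : C(Circle, M)) : Prop :=
  ContDiff ℝ ∞ (lift φ) ∧ ∀ t, deriv (lift φ) t ≠ 0

/-! ### Configurations, realizations, routes -/

/-- `i` (labelled) pairs of points of the circle, and a map `S¹ → M`. -/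
abbrev Pre (i : ℕ) : Type := (Fin i → Circle × Circle) × C(Circle, M)

/-- The `2 i` points are distinct, i.e. they form an `[i]`-configuration, and the map sends both
points of every pair to one point. -/
def Respects {i : ℕ} (x : Pre i) : Prop :=
  Function.Injective (Sum.elim (fun k => (x.1 k).1) (fun k => (x.1 k).2)) ∧
    ∀ k, x.2 (x.1 k).1 = x.2 (x.1 k).2

/-- Pairs of a labelled `[i]`-configuration and a map `S¹ → M` respecting it. -/
abbrev Realization (i : ℕ) : Type := {x : Pre i // Respects x}

/-- The same map with the same `[i]`-configuration, labelled differently. -/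
def Relabelled {i : ℕ} (x y : Realization i) : Prop :=
  x.1.2 = y.1.2 ∧ ∃ e : Equiv.Perm (Fin i),
    ∀ k, x.1.1 k = y.1.1 (e k) ∨ x.1.1 k = (y.1.1 (e k)).swap

/-- The set of `[i]_M`-routes: path components of the space of pairs
(unlabelled `[i]`-configuration, map respecting it). -/
def Route (i : ℕ) : Type :=
  Quot fun x y : Realization i => Joined x y ∨ Relabelled x y

/-- The route represented by a realization. -/
def route {i : ℕ} (x : Realization i) : Route i := Quot.mk _ x

/-- `x` is an immersion whose only self-intersections are the `i` given ones, all transverse. -/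
def IsGeneric {i : ℕ} (x : Realization i) : Prop :=
  IsImmersion x.1.2 ∧
    (∀ s t : Circle, x.1.2 s = x.1.2 t →
      s = t ∨ ∃ k, s(s, t) = s((x.1.1 k).1, (x.1.1 k).2)) ∧
    ∀ k, ∀ u v : ℝ, Circle.exp u = (x.1.1 k).1 → Circle.exp v = (x.1.1 k).2 →
      LinearIndependent ℝ ![deriv (lift x.1.2) u, deriv (lift x.1.2) v]

/-- The two chords cross: their endpoints alternate on the circle. -/
def Crossing (x : Realization 2) : Prop :=
  ∃ t₀ t₁ t₂ t₃ : ℝ, t₀ < t₁ ∧ t₁ < t₂ ∧ t₂ < t₃ ∧ t₃ < t₀ + 2 * Real.pi ∧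
    x.1.1 0 = (Circle.exp t₀, Circle.exp t₂) ∧
    (x.1.1 1 = (Circle.exp t₁, Circle.exp t₃) ∨ x.1.1 1 = (Circle.exp t₃, Circle.exp t₁))

/-! ### Suspicious loops and marginal routes -/

/-- The arc from angle `s` to angle `e` is suspicious: it is bounded by the points of one pair,
and it has no point of the configuration inside. -/
def SuspiciousArc {i : ℕ} (x : Realization i) (s e : ℝ) : Prop :=
  s < e ∧ e < s + 2 * Real.pi ∧
    (∃ k, s(Circle.exp s, Circle.exp e) = s((x.1.1 k).1, (x.1.1 k).2)) ∧
    ∀ u ∈ Set.Ioo s e, ∀ k, Circle.exp u ≠ (x.1.1 k).1 ∧ Circle.exp u ≠ (x.1.1 k).2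

/-- The loop in `M` that is the image of the arc from `s` to `e` is contractible:
there is a homotopy `H τ u` through loops (in the variable `u`) to a constant one. -/
def ArcContractible (φ : C(Circle, M)) (s e : ℝ) : Prop :=
  ∃ H : C(I × I, M), (∀ u : I, H (0, u) = φ (Circle.exp (s + u * (e - s)))) ∧
    (∀ τ : I, H (τ, 0) = H (τ, 1)) ∧ ∃ p : M, ∀ u : I, H (1, u) = p

/-- One of the suspicious loops of the route is contractible. -/
def Marginal {i : ℕ} (r : Route i) : Prop :=
  ∃ x : Realization i, route x = r ∧
    ∃ s e : ℝ, SuspiciousArc x s e ∧ ArcContractible x.1.2 s e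

/-! ### Triple points, neighbors, relatives -/

/-- `φ` is an immersion with the generic triple point `φ P = φ Q = φ R` and no other
self-intersections. -/
def IsGenericTriple (φ : C(Circle, M)) (P Q R : Circle) : Prop :=
  IsImmersion φ ∧ P ≠ Q ∧ Q ≠ R ∧ P ≠ R ∧ φ P = φ Q ∧ φ Q = φ R ∧
    (∀ s t : Circle, φ s = φ t → s = t ∨ (s ∈ ({P, Q, R} : Set Circle) ∧
      t ∈ ({P, Q, R} : Set Circle))) ∧
    ∀ u v w : ℝ, Circle.exp u = P → Circle.exp v = Q → Circle.exp w = R →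
      LinearIndependent ℝ ![deriv (lift φ) u, deriv (lift φ) v, deriv (lift φ) w]

/-- `x` is obtained from `φ` by a perturbation moving the branch at `P` so that it meets the
branches at `Q` and `R` in two different points: the point `P` splits into two points, one of them
paired with (a point close to) `Q`, the other one with (a point close to) `R`.
The two splittings of `P`, up to homotopy, are told apart by the crossing of the two chords;
together with those of `Q` and `R` there are six. -/
def Splits (φ : C(Circle, M)) (P Q R : Circle) (x : Realization 2) : Prop :=
  ∃ p : C(I, Pre 2), p 0 = (![(P, Q), (P, R)], φ) ∧
    (∀ s : I, s ≠ 0 → Respects (p s)) ∧ p 1 = x.1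

/-- Neighboring `[2]_M`-routes (with non-crossing chords): two of the three perturbations with
non-crossing chords of an immersion with a unique generic triple point belong to them. -/
def Neighbor (r r' : Route 2) : Prop :=
  ∃ (φ : C(Circle, M)) (P Q R : Circle) (x y : Realization 2),
    IsGenericTriple φ P Q R ∧ Splits φ P Q R x ∧ Splits φ Q R P y ∧
    ¬ Crossing x ∧ ¬ Crossing y ∧ route x = r ∧ route y = r'

/-- Joined by a finite chain of routes in which consecutive members are neighbors. -/
def Related : Route 2 → Route 2 → Prop := Relation.ReflTransGen Neighbor

/-! ### Homology -/

/-- First singular homology with integer coefficients. -/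
def H1 : CategoryTheory.Functor TopCat.{0} (ModuleCat.{0} ℤ) :=
  (AlgebraicTopology.singularHomologyFunctor (ModuleCat.{0} ℤ) 1).obj (ModuleCat.of ℤ ℤ)

/-- The subgroup of `H₁(M)` generated by the cycles lying in the curve `φ(S¹)`. -/
def cycleSubgroup (φ : C(Circle, M)) : Submodule ℤ (H1.obj (TopCat.of M)) :=
  LinearMap.range (H1.map (TopCat.ofHom
    (⟨Subtype.val, continuous_subtype_val⟩ : C(Set.range φ, M)))).hom

/-! ### The group `E₁^{-2,2}` -/

/-- `E₁^{-2,2}` with integer coefficients: functions on the set of `[2]_M`-routes that vanish on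
the routes with a contractible suspicious loop (trivial condition), and such that at every generic
triple point the differences of the values at the crossing and the non-crossing splitting of the
three branches coincide (four-term relation). -/
def E1 : AddSubgroup (Route 2 → ℤ) where
  carrier := {γ | (∀ r, Marginal r → γ r = 0) ∧
    ∀ (φ : C(Circle, M)) (P Q R : Circle), IsGenericTriple φ P Q R →
      ∀ x x' y y' : Realization 2,
        Splits φ P Q R x → Splits φ P Q R x' → Splits φ Q R P y → Splits φ Q R P y' →
        Crossing x → ¬ Crossing x' → Crossing y → ¬ Crossing y' →
        γ (route x) - γ (route x') = γ (route y) - γ (route y')}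
  zero_mem' := ⟨fun _ _ => rfl, by intros; rfl⟩
  add_mem' := by
    rintro a b ⟨ha, ha'⟩ ⟨hb, hb'⟩
    refine ⟨fun r hr => by simp [ha r hr, hb r hr], ?_⟩
    intro φ P Q R h x x' y y' h1 h2 h3 h4 h5 h6 h7 h8
    have e1 := ha' φ P Q R h x x' y y' h1 h2 h3 h4 h5 h6 h7 h8
    have e2 := hb' φ P Q R h x x' y y' h1 h2 h3 h4 h5 h6 h7 h8
    simp only [Pi.add_apply]
    linarith
  neg_mem' := by
    rintro a ⟨ha, ha'⟩
    refine ⟨fun r hr => by simp [ha r hr], ?_⟩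
    intro φ P Q R h x x' y y' h1 h2 h3 h4 h5 h6 h7 h8
    have e1 := ha' φ P Q R h x x' y y' h1 h2 h3 h4 h5 h6 h7 h8
    simp only [Pi.neg_apply]
    linarith

/-! ### The differential `d¹` -/

/-- A smooth family `curve τ` of maps `S¹ → M`, periodic in `τ`, with a chord: the points of the
circle with angles `a τ` and `b τ`, which have the same image. This is a loop in the space `{J}` of
realizations of a `[1]_M`-route `J` (the two points may be exchanged along the loop). -/
structure OneLoop where
  curve : ℝ → C(Circle, M)
  a : ℝ → ℝ
  b : ℝ → ℝ
  smooth_curve : ContDiff ℝ ∞ fun p : ℝ × ℝ => (curve p.1 (Circle.exp p.2) : E4)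
  smooth_a : ContDiff ℝ ∞ a
  smooth_b : ContDiff ℝ ∞ b
  periodic_curve : ∀ τ, curve (τ + 1) = curve τ
  periodic_chord : ∀ τ, s(Circle.exp (a (τ + 1)), Circle.exp (b (τ + 1))) =
    s(Circle.exp (a τ), Circle.exp (b τ))
  distinct : ∀ τ, Circle.exp (a τ) ≠ Circle.exp (b τ)
  respects : ∀ τ, curve τ (Circle.exp (a τ)) = curve τ (Circle.exp (b τ))

/-- The additional self-intersections along one period of the loop: triples `(τ, s, t)` such that
`curve τ` takes the same value at the angles `s < t`, which do not both belong to the chord. -/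
def OneLoop.extra (L : OneLoop) : Set (ℝ × ℝ × ℝ) :=
  {q | q.1 ∈ Set.Ico 0 1 ∧ 0 ≤ q.2.1 ∧ q.2.1 < q.2.2 ∧ q.2.2 < 2 * Real.pi ∧
    L.curve q.1 (Circle.exp q.2.1) = L.curve q.1 (Circle.exp q.2.2) ∧
    s(Circle.exp q.2.1, Circle.exp q.2.2) ≠ s(Circle.exp (L.a q.1), Circle.exp (L.b q.1))}

/-- At an additional self-intersection at time `τ`, of the branches at the angles `s` and `t`:
the determinant of the two velocities and of the velocity (with respect to `τ`) of the displacement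
from the `t`-branch to the `s`-branch. It does not change when `s` and `t` are exchanged. When it
is positive, the negative resolution of the self-intersection is replaced by the positive one as
`τ` grows; when it is negative, the other way round. -/
def OneLoop.jumpDet (L : OneLoop) (q : ℝ × ℝ × ℝ) : ℝ :=
  frameDet (L.curve q.1 (Circle.exp q.2.1))
    (deriv (lift (L.curve q.1)) q.2.1) (deriv (lift (L.curve q.1)) q.2.2)
    (deriv (fun τ => (L.curve τ (Circle.exp q.2.1) : E4)) q.1 -
      deriv (fun τ => (L.curve τ (Circle.exp q.2.2) : E4)) q.1)

/-- A generic loop: all its points are immersions whose given self-intersection is transverse;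
finitely many of them, passed transversally, have one more self-intersection point
(which is a double point, and transverse, as `jumpDet` does not vanish). -/
structure GenericLoop extends OneLoop where
  immersion : ∀ τ, IsImmersion (curve τ)
  transverse : ∀ τ,
    LinearIndependent ℝ ![deriv (lift (curve τ)) (a τ), deriv (lift (curve τ)) (b τ)]
  finite_extra : toOneLoop.extra.Finite
  one_at_a_time : Set.InjOn Prod.fst toOneLoop.extra
  jump_ne_zero : ∀ q ∈ toOneLoop.extra, toOneLoop.jumpDet q ≠ 0
  double : ∀ q : toOneLoop.extra, Respects
    (![(Circle.exp (a q.1.1), Circle.exp (b q.1.1)),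
      (Circle.exp q.1.2.1, Circle.exp q.1.2.2)], curve q.1.1)

/-- The curve with two self-intersections at the moment of an additional self-intersection. -/
def GenericLoop.realization (L : GenericLoop) (q : L.toOneLoop.extra) : Realization 2 :=
  ⟨_, L.double q⟩

instance (L : GenericLoop) : Finite L.toOneLoop.extra := L.finite_extra

/-- The component `E₁^{-2,2} → ∏_J H¹({J}; ℤ)` of `d¹ : E₁^{-2,2} → E₁^{-1,2}`. The cohomology class
is given by its values on generic 1-cycles `L` in the spaces `{J}`: the sum of the values of `γ` at
the `[2]_M`-routes met by `L`, with the signs of the corresponding local surgeries. (A class in `H¹`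
of a space vanishes iff its values on all loops vanish, and every loop is homotopic to a generic
one.) -/
def breveD1 : E1 →+ (GenericLoop → ℤ) where
  toFun γ L := ∑ᶠ q : L.toOneLoop.extra,
    (SignType.sign (L.toOneLoop.jumpDet q.1) : ℤ) * γ.1 (route (L.realization q))
  map_zero' := by
    funext L
    simp
  map_add' γ γ' := by
    funext L
    simp only [Pi.add_apply, AddSubgroup.coe_add, mul_add]
    exact finsum_add_distrib (Set.toFinite _) (Set.toFinite _)

/-! ### The curve -/

/-- The planar curve `u ↦ 6 u - 4 u³`, `|u| = 1`: it winds once around the middle hole and twice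
around each of the two other holes, making a small loop around each of the latter; the
self-intersection points of these loops lie on the outer sides of the holes. -/
def planeCurve (u : Circle) : ℂ := 6 * (u : ℂ) - 4 * (u : ℂ) ^ 3

lemma circle_sq (u : Circle) : (u : ℂ).re ^ 2 + (u : ℂ).im ^ 2 = 1 := by
  have h := Circle.normSq_coe u
  rw [Complex.normSq_apply] at h
  linarith

lemma planeCurve_re (u : Circle) :
    (planeCurve u).re = 18 * (u : ℂ).re - 16 * (u : ℂ).re ^ 3 := by
  have h := circle_sq u
  simp [planeCurve, pow_succ]
  linear_combination (12 * (u : ℂ).re) * h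

lemma planeCurve_im (u : Circle) :
    (planeCurve u).im = 16 * (u : ℂ).im ^ 3 - 6 * (u : ℂ).im := by
  have h := circle_sq u
  simp [planeCurve, pow_succ]
  linear_combination (-12 * (u : ℂ).im) * h

lemma outline_planeCurve_nonneg (u : Circle) :
    0 ≤ outline (planeCurve u).re (planeCurve u).im := by
  have h := circle_sq u
  rw [planeCurve_re, planeCurve_im]
  generalize (u : ℂ).re = c at *
  generalize (u : ℂ).im = s at *
  have hs : s ^ 2 = 1 - c ^ 2 := by linarith
  have hy : (16 * s ^ 3 - 6 * s) ^ 2 = (1 - c ^ 2) * (10 - 16 * c ^ 2) ^ 2 := by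
    have : (16 * s ^ 3 - 6 * s) ^ 2 = s ^ 2 * (16 * s ^ 2 - 6) ^ 2 := by ring
    rw [this, hs]; ring
  have hc1 : c ≤ 1 := by nlinarith [sq_nonneg s]
  have hc2 : -1 ≤ c := by nlinarith [sq_nonneg s]
  have hc3 : c ^ 2 ≤ 1 := by nlinarith [sq_nonneg s]
  unfold outline
  rw [hy]
  have key : ∀ d : ℝ, -1 ≤ d → d ≤ 1 → 0 ≤ 128 * d ^ 3 - 96 * d ^ 2 - 144 * d + 115 := by
    intro d h1 h2
    nlinarith [mul_nonneg (by linarith : (0 : ℝ) ≤ d + 1) (sq_nonneg (d - 0.9115))]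
  have k1 := key c hc2 hc1
  have k2 := key (-c) (by linarith) (by linarith)
  refine mul_nonneg (mul_nonneg (mul_nonneg ?_ ?_) ?_) ?_
  · nlinarith [sq_nonneg c]
  · nlinarith
  · linarith
  · linarith

/-- The curve `planeCurve`, placed in the copy `{w = 0, 0 ≤ z}` of the planar domain in `M`. -/
def figCurve : C(Circle, M) where
  toFun u := ⟨!₂[(planeCurve u).re, (planeCurve u).im,
    Real.sqrt (outline (planeCurve u).re (planeCurve u).im), 0], by
      simp [defFun, Real.sq_sqrt (outline_planeCurve_nonneg u)]⟩
  continuous_toFun := by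
    refine Continuous.subtype_mk ?_ _
    refine (PiLp.continuous_toLp 2 _).comp (continuous_pi fun i => ?_)
    have h : Continuous planeCurve := by unfold planeCurve; fun_prop
    have hr : Continuous fun u => (planeCurve u).re := Complex.continuous_re.comp h
    have hi : Continuous fun u => (planeCurve u).im := Complex.continuous_im.comp h
    fin_cases i
    · exact hr
    · exact hi
    · show Continuous fun u => Real.sqrt (outline (planeCurve u).re (planeCurve u).im)
      unfold outline; fun_prop
    · exact continuous_const

/-- A point of the circle, given by its coordinates. -/
def circlePoint (p q : ℝ) (h : p ^ 2 + q ^ 2 = 1) : Circle :=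
  ⟨⟨p, q⟩, by
    rw [Submonoid.unitSphere, Submonoid.mem_mk, Subsemigroup.mem_mk, mem_sphere_zero_iff_norm, ← sq_eq_sq₀ (norm_nonneg _) zero_le_one, Complex.sq_norm,
      Complex.normSq_apply]
    linarith⟩

lemma sq_add_sq_58 : Real.sqrt (5 / 8) ^ 2 + Real.sqrt (3 / 8) ^ 2 = 1 := by
  rw [Real.sq_sqrt (by norm_num), Real.sq_sqrt (by norm_num)]; norm_num

/-- The two chords: the pairs of parameters of the right and of the left self-intersection. -/
def figChords : Fin 2 → Circle × Circle :=
  ![(circlePoint (Real.sqrt (5 / 8)) (-Real.sqrt (3 / 8)) (by simpa using sq_add_sq_58),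
      circlePoint (Real.sqrt (5 / 8)) (Real.sqrt (3 / 8)) sq_add_sq_58),
    (circlePoint (-Real.sqrt (5 / 8)) (Real.sqrt (3 / 8)) (by simpa using sq_add_sq_58),
      circlePoint (-Real.sqrt (5 / 8)) (-Real.sqrt (3 / 8)) (by simpa using sq_add_sq_58))]

lemma respects_fig : Respects (figChords, figCurve) := by
  have h5 : 0 < Real.sqrt 5 / Real.sqrt 8 := by positivity
  have h3 : 0 < Real.sqrt 3 / Real.sqrt 8 := by positivity
  have q3 : Real.sqrt (3 / 8) ^ 2 = 3 / 8 := Real.sq_sqrt (by norm_num)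
  have hre : ∀ p q h, ((circlePoint p q h : Circle) : ℂ).re = p := fun _ _ _ => rfl
  have him : ∀ p q h, ((circlePoint p q h : Circle) : ℂ).im = q := fun _ _ _ => rfl
  constructor
  · rintro (i | i) (j | j) hij <;>
      have e1 := congrArg (fun z : Circle => (z : ℂ).re) hij <;>
      have e2 := congrArg (fun z : Circle => (z : ℂ).im) hij <;>
      fin_cases i <;> fin_cases j <;>
      first
      | rfl
      | (exfalso
         simp [figChords, hre, him] at e1 e2; linarith)
  · have hz : ∀ p q h p' q' h', p = p' → q ^ 2 = 3 / 8 → q' ^ 2 = 3 / 8 →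
        figCurve (circlePoint p q h) = figCurve (circlePoint p' q' h') := by
      intro p q h p' q' h' hp hq hq'
      have r : (planeCurve (circlePoint p q h)).re = (planeCurve (circlePoint p' q' h')).re := by
        rw [planeCurve_re, planeCurve_re, hre, hre, hp]
      have i1 : (planeCurve (circlePoint p q h)).im = 0 := by
        rw [planeCurve_im, him]; linear_combination 16 * q * hq
      have i2 : (planeCurve (circlePoint p' q' h')).im = 0 := by
        rw [planeCurve_im, him]; linear_combination 16 * q' * hq'
      apply Subtype.ext
      simp only [figCurve, ContinuousMap.coe_mk, r, i1, i2]
    intro k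
    fin_cases k
    · exact hz _ _ (by simpa using sq_add_sq_58) _ _ sq_add_sq_58 rfl (by rw [neg_sq, q3]) q3
    · exact hz _ _ (by simpa using sq_add_sq_58) _ _ (by simpa using sq_add_sq_58) rfl q3
        (by rw [neg_sq, q3])

/-- The curve with its two self-intersections. -/
def fig : Realization 2 := ⟨(figChords, figCurve), respects_fig⟩

open Classical in
/-- The function with value `1` at all relatives of the route of the curve and `0` elsewhere. -/
def gammaFig (r : Route 2) : ℤ := if Related (route fig) r then 1 else 0

end KnotSS

end

noncomputable section

namespace KnotSS

/-! ### Chains modulo boundaries -/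

section Chains

open CategoryTheory AlgebraicTopology Simplicial

/-! The proof attaches a subgroup to every `[2]_M`-route. In `Chains1 M`, the 1-chains modulo
boundaries, every path has a class, closed or not, and H₁(M) is the kernel of the boundary map. The
span of a curve with chords is generated by the whole curve and by its arcs between the two points
of each chord. These are loops, so their classes do not change along a path of realizations, and the
span is a function `routeSpan` of the route. Distinctness of the chord points plays no role here, so
the argument passes to a triple point: splitting P gives the arcs PQ and PR, splitting Q gives QR
and QP, and together with the whole curve both pairs generate the same subgroup. Hence relatives
have equal spans (`routeSpan_related`).

A contractible suspicious loop kills one of the three generators, so marginal routes have span of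
rank at most 2 (`rank_routeSpan_marginal`). For the given curve, winding numbers about the three
holes show that the generators are independent (`linearIndependent_arcs`). So no relative is
marginal. For generic realizations the span is the image of A(φ) (`map_cycleSubgroup`), which
transfers these facts to homology.

Crossing of chords is an invariant of routes, and relatives of the given route have non-crossing
chords. So γ vanishes on crossing splittings, and the four-term relation only asks that γ agree on
neighbors (`gammaFig_mem_E1`).

For the differential, the loop `famLoop` keeps the right chord and moves one branch at the left
self-intersection. Over an arc of D joining the left hole to the outer boundary, M contains a
2-sphere; a piece of the branch is stretched along such an arc and turned once in the (z, w)-plane.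
The turning has to fade out at both ends of the piece. There the complex multiplier of z + iw passes
through 0 for some τ, which is possible only over the boundary of D; hence the dents `dentL` and
`dentR`. The moving branch meets the other branch only at τ = 0, where the curve is the given one,
so the sum defining the differential has the single term ±1. -/

/-- The singular chain complex of a space, with integer coefficients. -/
abbrev chains (X : Type) [TopologicalSpace X] : ChainComplex (ModuleCat.{0} ℤ) ℕ :=
  (TopCat.toSSet.obj (TopCat.of X)).chainComplex (ModuleCat.of ℤ ℤ)

/-- Singular `1`-chains modulo boundaries. -/
abbrev Chains1 (X : Type) [TopologicalSpace X] : ModuleCat.{0} ℤ := (chains X).opcycles 1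

variable {X Y Z : Type} [TopologicalSpace X] [TopologicalSpace Y] [TopologicalSpace Z]

/-- A singular simplex, as a simplex of the singular simplicial set. -/
def toSimplex {n : ℕ} (τ : C(stdSimplex ℝ (Fin (n + 1)), X)) :
    (TopCat.toSSet.obj (TopCat.of X)) _⦋n⦌ :=
  (TopCat.toSSetObjEquiv (TopCat.of X) (.op ⦋n⦌)).symm τ

lemma toSimplex_surjective {n : ℕ} (s : (TopCat.toSSet.obj (TopCat.of X)) _⦋n⦌) :
    ∃ τ : C(stdSimplex ℝ (Fin (n + 1)), X), toSimplex τ = s :=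
  (TopCat.toSSetObjEquiv (TopCat.of X) (.op ⦋n⦌)).symm.surjective s

lemma delta_toSimplex {n : ℕ} (i : Fin (n + 2)) (τ : C(stdSimplex ℝ (Fin (n + 2)), X)) :
    (TopCat.toSSet.obj (TopCat.of X)).δ i (toSimplex (n := n + 1) τ) =
      toSimplex (τ.comp ⟨_, stdSimplex.continuous_map (Fin.succAbove i)⟩) := by
  rfl

/-- The chain consisting of one simplex. -/
def simplexChain {n : ℕ} (τ : C(stdSimplex ℝ (Fin (n + 1)), X)) : (chains X).X n :=
  (SSet.ιChainComplex (R := ModuleCat.of ℤ ℤ) _ (toSimplex τ)).hom (1 : ℤ)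

/-- The simplex given by a path. -/
def pathSimplex (γ : C(I, X)) : C(stdSimplex ℝ (Fin 2), X) :=
  γ.comp ⟨stdSimplexHomeomorphUnitInterval, stdSimplexHomeomorphUnitInterval.continuous⟩

lemma pathSimplex_surjective (τ : C(stdSimplex ℝ (Fin 2), X)) : ∃ γ, pathSimplex γ = τ := by
  refine ⟨τ.comp ⟨stdSimplexHomeomorphUnitInterval.symm,
    stdSimplexHomeomorphUnitInterval.symm.continuous⟩, ?_⟩
  ext x
  simp [pathSimplex]

/-- The class of a path modulo boundaries. -/
def pathClass (γ : C(I, X)) : Chains1 X :=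
  ((chains X).pOpcycles 1).hom (simplexChain (n := 1) (pathSimplex γ))

/-- The map induced on chains modulo boundaries. -/
def Chains1.map (f : C(X, Y)) : Chains1 X →ₗ[ℤ] Chains1 Y :=
  (HomologicalComplex.opcyclesMap
    (SSet.chainComplexMap (TopCat.toSSet.map (TopCat.ofHom f)) (ModuleCat.of ℤ ℤ)) 1).hom

/-- The inclusion of the first homology. -/
def ofH1 (X : Type) [TopologicalSpace X] : H1.obj (TopCat.of X) →ₗ[ℤ] Chains1 X :=
  ((chains X).homologyι 1).hom

lemma ofH1_injective : Function.Injective (ofH1 X) :=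
  (ModuleCat.mono_iff_injective ((chains X).homologyι 1)).mp inferInstance

lemma ofH1_naturality (f : C(X, Y)) (z : H1.obj (TopCat.of X)) :
    ofH1 Y ((H1.map (TopCat.ofHom f)).hom z) = Chains1.map f (ofH1 X z) :=
  congrArg (fun k => k.hom z) (HomologicalComplex.homologyι_naturality
    (SSet.chainComplexMap (TopCat.toSSet.map (TopCat.ofHom f)) (ModuleCat.of ℤ ℤ)) 1)

lemma map_simplexChain {n : ℕ} (f : C(X, Y)) (τ : C(stdSimplex ℝ (Fin (n + 1)), X)) :
    ((SSet.chainComplexMap (TopCat.toSSet.map (TopCat.ofHom f)) (ModuleCat.of ℤ ℤ)).f n).hom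
      (simplexChain τ) = simplexChain (f.comp τ) :=
  congrArg (fun k => k.hom (1 : ℤ)) (SSet.ι_chainComplexMap_f (R := ModuleCat.of ℤ ℤ)
    (f := TopCat.toSSet.map (TopCat.ofHom f)) (x := toSimplex τ))

lemma map_pathClass (f : C(X, Y)) (γ : C(I, X)) :
    Chains1.map f (pathClass γ) = pathClass (f.comp γ) := by
  have h := congrArg (fun k => k.hom (simplexChain (n := 1) (pathSimplex γ)))
    (HomologicalComplex.p_opcyclesMap (SSet.chainComplexMap (TopCat.toSSet.map (TopCat.ofHom f))
      (ModuleCat.of ℤ ℤ)) 1)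
  refine h.trans ?_
  change ((chains Y).pOpcycles 1).hom (((SSet.chainComplexMap (TopCat.toSSet.map (TopCat.ofHom f))
    (ModuleCat.of ℤ ℤ)).f 1).hom _) = _
  rw [map_simplexChain]
  rfl

lemma d_simplexChain {n : ℕ} (τ : C(stdSimplex ℝ (Fin (n + 2)), X)) :
    ((chains X).d (n + 1) n).hom (simplexChain (n := n + 1) τ) =
      ∑ i : Fin (n + 2), (-1 : ℤ) ^ (i : ℕ) •
        simplexChain (τ.comp ⟨_, stdSimplex.continuous_map (Fin.succAbove i)⟩) := by
  have h := congrArg (fun k => k.hom (1 : ℤ)) (SSet.ιChainComplex_d (R := ModuleCat.of ℤ ℤ)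
    (TopCat.toSSet.obj (TopCat.of X)) (toSimplex (n := n + 1) τ))
  refine h.trans ?_
  simp only [delta_toSimplex]
  rw [ModuleCat.hom_sum, LinearMap.sum_apply]
  rfl

lemma chains_hom_ext {n : ℕ} {A : ModuleCat.{0} ℤ} {f g : (chains X).X n ⟶ A}
    (h : ∀ τ : C(stdSimplex ℝ (Fin (n + 1)), X), f.hom (simplexChain τ) = g.hom (simplexChain τ)) :
    f = g := by
  refine SSet.chainComplex_hom_ext fun x => ?_
  obtain ⟨τ, rfl⟩ := toSimplex_surjective x
  ext
  exact h τ

/-- A homomorphism on chains, given by its values on simplices. -/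
def chainsDesc {n : ℕ} {A : ModuleCat.{0} ℤ} (w : C(stdSimplex ℝ (Fin (n + 1)), X) → A) :
    (chains X).X n ⟶ A :=
  Limits.Cofan.IsColimit.desc (SSet.isColimitChainComplexXCofan _ _ n) fun s =>
    ModuleCat.ofHom (LinearMap.toSpanSingleton ℤ A
      (w (TopCat.toSSetObjEquiv (TopCat.of X) (.op ⦋n⦌) s)))

lemma chainsDesc_simplexChain {n : ℕ} {A : ModuleCat.{0} ℤ}
    (w : C(stdSimplex ℝ (Fin (n + 1)), X) → A) (τ : C(stdSimplex ℝ (Fin (n + 1)), X)) :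
    (chainsDesc w).hom (simplexChain τ) = w τ := by
  have h := congrArg (fun k => k.hom (1 : ℤ)) (Limits.Cofan.IsColimit.fac
    (SSet.isColimitChainComplexXCofan (TopCat.toSSet.obj (TopCat.of X)) (ModuleCat.of ℤ ℤ) n)
    (fun s => ModuleCat.ofHom (LinearMap.toSpanSingleton ℤ A
      (w (TopCat.toSSetObjEquiv (TopCat.of X) (.op ⦋n⦌) s)))) (toSimplex τ))
  refine h.trans ?_
  change (LinearMap.toSpanSingleton ℤ A _) 1 = _
  rw [LinearMap.toSpanSingleton_apply_one]
  rfl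

/-- The path along the side of a triangle from the vertex `i` to the vertex `j`. -/
def triangleSide (i j : Fin 3) : C(I, stdSimplex ℝ (Fin 3)) :=
  (⟨_, stdSimplex.continuous_map ![i, j]⟩ : C(stdSimplex ℝ (Fin 2), stdSimplex ℝ (Fin 3))).comp
    ⟨stdSimplexHomeomorphUnitInterval.symm, stdSimplexHomeomorphUnitInterval.symm.continuous⟩

lemma pathSimplex_triangleSide (h : C(stdSimplex ℝ (Fin 3), X)) (i j : Fin 3) :
    pathSimplex (h.comp (triangleSide i j)) =
      h.comp ⟨_, stdSimplex.continuous_map ![i, j]⟩ := by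
  ext x
  simp [pathSimplex, triangleSide]

lemma d_triangle (h : C(stdSimplex ℝ (Fin 3), X)) :
    ((chains X).d 2 1).hom (simplexChain (n := 2) h) =
      simplexChain (n := 1) (pathSimplex (h.comp (triangleSide 1 2))) -
      simplexChain (n := 1) (pathSimplex (h.comp (triangleSide 0 2))) +
      simplexChain (n := 1) (pathSimplex (h.comp (triangleSide 0 1))) := by
  rw [d_simplexChain, Fin.sum_univ_three]
  have e0 : Fin.succAbove (0 : Fin 3) = ![1, 2] := by decide
  have e1 : Fin.succAbove (1 : Fin 3) = ![0, 2] := by decide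
  have e2 : Fin.succAbove (2 : Fin 3) = ![0, 1] := by decide
  simp only [pathSimplex_triangleSide, e0, e1, e2]
  simp [sub_eq_add_neg]

/-- The alternating sum of the sides is the boundary of the triangle, and it vanishes in `opcycles`.
Additivity and homotopy invariance of path classes all come from this relation. -/
lemma pathClass_triangle (h : C(stdSimplex ℝ (Fin 3), X)) :
    pathClass (h.comp (triangleSide 0 1)) + pathClass (h.comp (triangleSide 1 2)) =
      pathClass (h.comp (triangleSide 0 2)) := by
  have := congrArg (fun k => k.hom (simplexChain (n := 2) h)) ((chains X).d_pOpcycles 2 1)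
  change ((chains X).pOpcycles 1).hom (((chains X).d 2 1).hom (simplexChain (n := 2) h)) = 0 at this
  rw [d_triangle, map_add, map_sub] at this
  change pathClass _ - pathClass _ + pathClass _ = (0 : Chains1 X) at this
  rw [← sub_eq_zero, ← this]
  abel

/-- The class of a point among the `0`-chains. -/
def pointClass (x : X) : (chains X).X 0 := simplexChain (ContinuousMap.const _ x)

/-- The boundary of a `1`-chain modulo boundaries. -/
def boundary (X : Type) [TopologicalSpace X] : Chains1 X →ₗ[ℤ] (chains X).X 0 :=
  ((chains X).fromOpcycles 1 0).hom

lemma d_path (γ : C(I, X)) :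
    ((chains X).d 1 0).hom (simplexChain (n := 1) (pathSimplex γ)) =
      pointClass (γ 1) - pointClass (γ 0) := by
  rw [d_simplexChain, Fin.sum_univ_two]
  have key : ∀ i : Fin 2, ∀ x, stdSimplexHomeomorphUnitInterval
      (stdSimplex.map (S := ℝ) (Fin.succAbove i : Fin 1 → Fin 2) x) = if i = 0 then 1 else 0 := by
    intro i x
    have hx : x = stdSimplex.vertex 0 := Subsingleton.elim _ _
    rw [hx, stdSimplex.map_vertex]
    fin_cases i
    · exact stdSimplexHomeomorphUnitInterval_one
    · exact stdSimplexHomeomorphUnitInterval_zero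
  have e : ∀ i : Fin 2, (pathSimplex γ).comp
      ⟨_, stdSimplex.continuous_map (Fin.succAbove i : Fin 1 → Fin 2)⟩ =
        ContinuousMap.const _ (γ (if i = 0 then 1 else 0)) := by
    intro i
    ext x
    exact congrArg γ (key i x)
  rw [e, e]
  simp [pointClass, sub_eq_add_neg]

lemma boundary_pathClass (γ : C(I, X)) :
    boundary X (pathClass γ) = pointClass (γ 1) - pointClass (γ 0) := by
  rw [← d_path]
  exact congrArg (fun k => k.hom (simplexChain (n := 1) (pathSimplex γ)))
    ((chains X).p_fromOpcycles 1 0)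

/-- Homology is the kernel of `fromOpcycles`; its universal property is applied to the map from `ℤ`
sending `1` to `q`. -/
lemma mem_range_ofH1 {q : Chains1 X} (hq : boundary X q = 0) : q ∈ LinearMap.range (ofH1 X) := by
  let f : ModuleCat.of ℤ ℤ ⟶ Chains1 X := ModuleCat.ofHom (LinearMap.toSpanSingleton ℤ _ q)
  have hf : f ≫ (chains X).fromOpcycles 1 0 = 0 := by
    ext
    change boundary X ((LinearMap.toSpanSingleton ℤ _ q) 1) = 0
    rw [LinearMap.toSpanSingleton_apply_one, hq]
  let k := ((chains X).homologyIsKernel 1 0 (by simp)).lift (Limits.KernelFork.ofι f hf)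
  refine ⟨k.hom (1 : ℤ), ?_⟩
  have := congrArg (fun g => g.hom (1 : ℤ)) (((chains X).homologyIsKernel 1 0 (by simp)).fac
    (Limits.KernelFork.ofι f hf) .zero)
  refine this.trans ?_
  change (LinearMap.toSpanSingleton ℤ _ q) 1 = q
  exact LinearMap.toSpanSingleton_apply_one ..

lemma boundary_ofH1 (z : H1.obj (TopCat.of X)) : boundary X (ofH1 X z) = 0 :=
  congrArg (fun k => k.hom z) ((chains X).homologyι_comp_fromOpcycles 1 0)

/-- A homomorphism on chains modulo boundaries, given by its values on paths. -/
lemma exists_chains1_hom {A : Type} [AddCommGroup A] (w : C(I, X) → A)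
    (hw : ∀ h : C(stdSimplex ℝ (Fin 3), X), w (h.comp (triangleSide 0 1)) +
      w (h.comp (triangleSide 1 2)) = w (h.comp (triangleSide 0 2))) :
    ∃ W : Chains1 X →ₗ[ℤ] A, ∀ γ, W (pathClass γ) = w γ := by
  let v : C(stdSimplex ℝ (Fin 2), X) → ModuleCat.of ℤ A := fun τ =>
    w (τ.comp ⟨stdSimplexHomeomorphUnitInterval.symm,
      stdSimplexHomeomorphUnitInterval.symm.continuous⟩)
  have hv : ∀ γ, v (pathSimplex γ) = w γ := by
    intro γ
    refine congrArg w ?_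
    ext x
    simp [pathSimplex]
  have h0 : (chains X).d 2 1 ≫ chainsDesc (n := 1) v = 0 := by
    refine chains_hom_ext fun h => ?_
    change (chainsDesc (n := 1) v).hom (((chains X).d 2 1).hom (simplexChain (n := 2) h)) = 0
    rw [d_triangle, map_add, map_sub, chainsDesc_simplexChain, chainsDesc_simplexChain,
      chainsDesc_simplexChain, hv, hv, hv, ← hw h]
    exact (fun a b => by abel : ∀ a b : A, b - (a + b) + a = 0) _ _
  refine ⟨((chains X).descOpcycles (chainsDesc (n := 1) v) 2 (by simp) h0).hom, fun γ => ?_⟩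
  refine (congrArg (fun k => k.hom (simplexChain (n := 1) (pathSimplex γ)))
    ((chains X).p_descOpcycles (chainsDesc (n := 1) v) 2 (by simp) h0)).trans ?_
  exact (chainsDesc_simplexChain v _).trans (hv γ)

/-- On paths, hence on all chains, `p` after `f` agrees with a map factoring through the boundary,
and classes from H₁(X) have zero boundary. -/
lemma apply_map_ofH1 (f : C(X, Y)) {A : ModuleCat.{0} ℤ} (p : Chains1 Y →ₗ[ℤ] A) (c : X → A)
    (hc : ∀ γ : C(I, X), p (pathClass (f.comp γ)) = c (γ 1) - c (γ 0))
    (z : H1.obj (TopCat.of X)) : p (Chains1.map f (ofH1 X z)) = 0 := by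
  let e : (chains X).X 0 ⟶ A := chainsDesc fun τ => c (τ (stdSimplex.vertex 0))
  have he : ∀ x, e.hom (pointClass x) = c x := fun x => chainsDesc_simplexChain _ _
  have key : (chains X).pOpcycles 1 ≫ ModuleCat.ofHom (p ∘ₗ Chains1.map f) =
      (chains X).pOpcycles 1 ≫ (chains X).fromOpcycles 1 0 ≫ e := by
    refine chains_hom_ext fun τ => ?_
    obtain ⟨γ, rfl⟩ := pathSimplex_surjective τ
    change p (Chains1.map f (pathClass γ)) = e.hom (boundary X (pathClass γ))
    rw [boundary_pathClass, map_sub, he, he, map_pathClass, hc]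
  replace key := (cancel_epi ((chains X).pOpcycles 1)).mp key
  have := congrArg (fun k => k.hom (ofH1 X z)) key
  change p (Chains1.map f (ofH1 X z)) = e.hom (boundary X (ofH1 X z)) at this
  rw [this, boundary_ofH1, map_zero]

/-- If the paths in `X` are homologous in `Y`, modulo `S`, to differences of a function of their
ends, then the classes from `H₁(X)` lie in `S`. -/
lemma map_ofH1_mem (f : C(X, Y)) (S : Submodule ℤ (Chains1 Y)) (c : X → Chains1 Y)
    (hc : ∀ γ : C(I, X), pathClass (f.comp γ) - (c (γ 1) - c (γ 0)) ∈ S)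
    (z : H1.obj (TopCat.of X)) : Chains1.map f (ofH1 X z) ∈ S := by
  -- Membership in `S` is vanishing in the quotient. The module structure is spelled out to be the
  -- one induced from `Chains1 Y`.
  refine (Submodule.Quotient.mk_eq_zero S).mp (apply_map_ofH1 f
    (A := @ModuleCat.of ℤ _ (Chains1 Y ⧸ S) _ (Submodule.Quotient.module S))
    S.mkQ (fun x => S.mkQ (c x)) (fun γ => ?_) z)
  exact ((Submodule.Quotient.eq S).mpr (hc γ)).trans (map_sub S.mkQ _ _)

end Chains

end KnotSS

end

noncomputable section

namespace KnotSS

/-! ### Segments -/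

section Segments

variable {X Y : Type} [TopologicalSpace X] [TopologicalSpace Y]
variable {E : Type*} [AddCommGroup E] [Module ℝ E]

lemma sum_triangleSide_smul (V : Fin 3 → E) (i j : Fin 3) (u : I) :
    ∑ k, (triangleSide i j u) k • V k = V i + (u : ℝ) • (V j - V i) := by
  have h : ∀ k, (triangleSide i j u) k =
      (if i = k then 1 - (u : ℝ) else 0) + (if j = k then (u : ℝ) else 0) := by
    intro k
    change FunOnFinite.linearMap ℝ ℝ ![i, j] ![1 - (u : ℝ), (u : ℝ)] k = _
    rw [FunOnFinite.linearMap_apply_apply, Finset.sum_filter, Fin.sum_univ_two]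
    rfl
  simp only [h, add_smul, Finset.sum_add_distrib, ite_smul, zero_smul, Finset.sum_ite_eq,
    Finset.mem_univ, if_true]
  module

variable [TopologicalSpace E] [IsTopologicalAddGroup E] [ContinuousSMul ℝ E]

/-- The image of the segment from `A` to `B`. -/
def segPath (h : C(E, X)) (A B : E) : C(I, X) where
  toFun u := h (A + (u : ℝ) • (B - A))

/-- The class of the image of the segment from `A` to `B`. -/
def segClass (h : C(E, X)) (A B : E) : Chains1 X := pathClass (segPath h A B)

/-- The standard triangle is mapped affinely to the triangle `A B C`, then by `h`. Degenerate
triangles are allowed, which gives the class of a constant segment and of a reversed one. -/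
lemma segClass_add (h : C(E, X)) (A B C : E) :
    segClass h A B + segClass h B C = segClass h A C := by
  let V : Fin 3 → E := ![A, B, C]
  let k : C(stdSimplex ℝ (Fin 3), X) := h.comp
    ⟨fun x => ∑ i, x i • V i, by
      have : ∀ i : Fin 3, Continuous fun x : stdSimplex ℝ (Fin 3) => x i := fun i =>
        (continuous_apply i).comp continuous_subtype_val
      exact continuous_finsetSum _ fun i _ => (this i).smul continuous_const⟩
  have e : ∀ i j, k.comp (triangleSide i j) = segPath h (V i) (V j) := by
    intro i j
    ext u
    exact congrArg h (sum_triangleSide_smul V i j u)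
  have := pathClass_triangle k
  simp only [e] at this
  exact this

lemma segClass_self (h : C(E, X)) (A : E) : segClass h A A = 0 := by
  simpa using segClass_add h A A A

lemma segClass_symm (h : C(E, X)) (A B : E) : segClass h B A = -segClass h A B := by
  rw [eq_neg_iff_add_eq_zero, segClass_add, segClass_self]

lemma map_segClass (f : C(X, Y)) (h : C(E, X)) (A B : E) :
    Chains1.map f (segClass h A B) = segClass (f.comp h) A B :=
  map_pathClass f _

lemma boundary_segClass (h : C(E, X)) (A B : E) :
    boundary X (segClass h A B) = pointClass (h B) - pointClass (h A) := by
  simp [segClass, boundary_pathClass, segPath]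

/-- Extension of a path to the line. -/
def extendPath (γ : C(I, X)) : C(ℝ, X) := γ.comp ⟨_, continuous_projIcc (h := zero_le_one)⟩

lemma extendPath_coe (γ : C(I, X)) (u : I) : extendPath γ u = γ u := by
  simp [extendPath]

lemma segClass_extendPath (γ : C(I, X)) : segClass (extendPath γ) 0 1 = pathClass γ := by
  refine congrArg pathClass ?_
  ext u
  simp [segPath, extendPath_coe]

lemma pathClass_const (x : X) : pathClass (ContinuousMap.const I x) = 0 :=
  segClass_self (ContinuousMap.const ℝ x) 0

/-- Both ways around the square are homologous to its diagonal. Clamping the coordinates extends the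
map to the plane, where `segClass_add` applies. -/
lemma pathClass_square (H : C(I × I, X)) (a b c d : C(I, X)) (ha : ∀ u, H (0, u) = a u)
    (hb : ∀ u, H (1, u) = b u) (hc : ∀ u, H (u, 0) = c u) (hd : ∀ u, H (u, 1) = d u) :
    pathClass a + pathClass d = pathClass c + pathClass b := by
  let h : C(ℝ × ℝ, X) := H.comp ⟨fun p => (Set.projIcc 0 1 zero_le_one p.1,
    Set.projIcc 0 1 zero_le_one p.2), by fun_prop⟩
  have e : ∀ (A B : ℝ × ℝ) (γ : C(I, X)), (∀ u : I, h (A + (u : ℝ) • (B - A)) = γ u) →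
      segClass h A B = pathClass γ := by
    intro A B γ hγ
    refine congrArg pathClass ?_
    ext u
    exact hγ u
  rw [← e (0, 0) (0, 1) a (fun u => by simp [h, ha]), ← e (1, 0) (1, 1) b (fun u => by simp [h, hb]),
    ← e (0, 0) (1, 0) c (fun u => by simp [h, hc]), ← e (0, 1) (1, 1) d (fun u => by simp [h, hd]),
    segClass_add, segClass_add]

/-- The track of the base point occurs on both sides of the square and cancels, so the homotopy may
be free. -/
lemma pathClass_eq_of_loop_homotopy (H : C(I × I, X)) (hl : ∀ s, H (s, 0) = H (s, 1))
    (a b : C(I, X)) (ha : ∀ u, H (0, u) = a u) (hb : ∀ u, H (1, u) = b u) :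
    pathClass a = pathClass b := by
  have := pathClass_square H a b (H.comp ⟨fun s => (s, 0), by fun_prop⟩)
    (H.comp ⟨fun s => (s, 0), by fun_prop⟩) ha hb (fun _ => rfl) (fun u => (hl u).symm)
  rw [add_comm] at this
  exact add_left_cancel this

lemma pathClass_eq_of_homotopy (H : C(I × I, X)) (x y : X) (hx : ∀ s, H (s, 0) = x)
    (hy : ∀ s, H (s, 1) = y) (a b : C(I, X)) (ha : ∀ u, H (0, u) = a u)
    (hb : ∀ u, H (1, u) = b u) : pathClass a = pathClass b := by
  simpa [pathClass_const] using
    pathClass_square H a b (ContinuousMap.const _ x) (ContinuousMap.const _ y) ha hb hx hy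

end Segments

/-! ### Arcs of curves -/

section Arcs

variable {X Y : Type} [TopologicalSpace X] [TopologicalSpace Y]

/-- A curve in the angular coordinate. -/
def angular (φ : C(Circle, X)) : C(ℝ, X) := φ.comp Circle.exp

/-- The class of the arc of a curve from the angle `s` to the angle `t`. -/
def arcClass (φ : C(Circle, X)) (s t : ℝ) : Chains1 X := segClass (angular φ) s t

lemma arcClass_add (φ : C(Circle, X)) (r s t : ℝ) :
    arcClass φ r s + arcClass φ s t = arcClass φ r t := segClass_add _ _ _ _

lemma arcClass_symm (φ : C(Circle, X)) (s t : ℝ) : arcClass φ t s = -arcClass φ s t :=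
  segClass_symm _ _ _

lemma arcClass_add_period (φ : C(Circle, X)) (s t : ℝ) (n : ℤ) :
    arcClass φ (s + n * (2 * Real.pi)) (t + n * (2 * Real.pi)) = arcClass φ s t := by
  refine congrArg pathClass ?_
  ext u
  refine congrArg φ (Circle.exp_eq_exp.mpr ⟨n, ?_⟩)
  simp only [smul_eq_mul]
  ring

/-- A full turn has the same class from every starting angle, because moving the start removes an
arc and adds its translate by one period. Then induct on the number of turns. -/
lemma arcClass_period (φ : C(Circle, X)) (s : ℝ) (n : ℤ) :
    arcClass φ s (s + n * (2 * Real.pi)) = n • arcClass φ 0 (2 * Real.pi) := by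
  have h0 : ∀ r, arcClass φ r (r + 2 * Real.pi) = arcClass φ 0 (2 * Real.pi) := by
    intro r
    have h1 := arcClass_add φ 0 r (r + 2 * Real.pi)
    have h2 := arcClass_add φ 0 (2 * Real.pi) (r + 2 * Real.pi)
    have h3 := arcClass_add_period φ 0 r 1
    simp only [Int.cast_one, one_mul, zero_add] at h3
    rw [h3] at h2
    rw [← h2, add_comm] at h1
    exact add_right_cancel h1
  induction n using Int.induction_on with
  | zero => simpa [arcClass] using segClass_self _ _
  | succ n ih =>
    rw [← arcClass_add φ s (s + (n : ℤ) * (2 * Real.pi)), ih, add_zsmul, one_zsmul,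
      ← h0 (s + (n : ℤ) * (2 * Real.pi))]
    congr 2
    push_cast
    ring
  | pred n ih =>
    rw [← arcClass_add φ s (s + (-(n : ℤ) : ℤ) * (2 * Real.pi)), ih, sub_zsmul, one_zsmul,
      sub_eq_add_neg, ← h0 (s + (-(n : ℤ) - 1 : ℤ) * (2 * Real.pi)), ← arcClass_symm]
    congr 2
    push_cast
    ring

lemma exists_angle (u : Circle) : ∃ t : ℝ, Circle.exp t = u := ⟨_, Circle.exp_arg u⟩

/-- The span of the classes of the whole curve and of its arcs bounded by the pairs. -/
def cycleSpan {i : ℕ} (x : (Fin i → Circle × Circle) × C(Circle, X)) : Submodule ℤ (Chains1 X) :=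
  Submodule.span ℤ {q | ∃ s t, (Circle.exp s = Circle.exp t ∨
    ∃ k, Circle.exp s = (x.1 k).1 ∧ Circle.exp t = (x.1 k).2) ∧ arcClass x.2 s t = q}

lemma arcClass_mem_cycleSpan {i : ℕ} (x : (Fin i → Circle × Circle) × C(Circle, X)) {s t : ℝ}
    (h : Circle.exp s = Circle.exp t ∨
      ∃ k, s(Circle.exp s, Circle.exp t) = s((x.1 k).1, (x.1 k).2)) :
    arcClass x.2 s t ∈ cycleSpan x := by
  rcases h with h | ⟨k, hk⟩
  · exact Submodule.subset_span ⟨s, t, .inl h, rfl⟩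
  · rcases Sym2.eq_iff.mp hk with ⟨h1, h2⟩ | ⟨h1, h2⟩
    · exact Submodule.subset_span ⟨s, t, .inr ⟨k, h1, h2⟩, rfl⟩
    · rw [arcClass_symm]
      exact Submodule.neg_mem _ (Submodule.subset_span ⟨t, s, .inr ⟨k, h2, h1⟩, rfl⟩)

/-- Two angles of one point differ by full turns, so the full turn and one arc per chord, in either
direction, generate everything. -/
lemma cycleSpan_eq_span {i : ℕ} (x : (Fin i → Circle × Circle) × C(Circle, X)) (a b : Fin i → ℝ)
    (h : ∀ k, s(Circle.exp (a k), Circle.exp (b k)) = s((x.1 k).1, (x.1 k).2)) :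
    cycleSpan x = Submodule.span ℤ (insert (arcClass x.2 0 (2 * Real.pi))
      (Set.range fun k => arcClass x.2 (a k) (b k))) := by
  set S := Submodule.span ℤ (insert (arcClass x.2 0 (2 * Real.pi))
      (Set.range fun k => arcClass x.2 (a k) (b k))) with hS
  have hfull : ∀ s t, Circle.exp s = Circle.exp t → arcClass x.2 s t ∈ S := by
    intro s t hst
    obtain ⟨n, rfl⟩ := Circle.exp_eq_exp.mp hst.symm
    rw [arcClass_period]
    exact zsmul_mem (Submodule.subset_span (Set.mem_insert _ _)) n
  have harc : ∀ k, arcClass x.2 (a k) (b k) ∈ S := fun k =>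
    Submodule.subset_span (Set.mem_insert_of_mem _ ⟨k, rfl⟩)
  apply le_antisymm
  · refine Submodule.span_le.mpr ?_
    rintro _ ⟨s, t, hst, rfl⟩
    rcases hst with hst | ⟨k, hs, ht⟩
    · exact hfull s t hst
    · have hk := h k
      rw [← hs, ← ht] at hk
      rcases Sym2.eq_iff.mp hk with ⟨h1, h2⟩ | ⟨h1, h2⟩
      · rw [← arcClass_add _ s (a k), ← arcClass_add _ (a k) (b k)]
        exact S.add_mem (hfull _ _ h1.symm) (S.add_mem (harc k) (hfull _ _ h2))
      · rw [← arcClass_add _ s (b k), ← arcClass_add _ (b k) (a k), arcClass_symm _ (a k)]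
        exact S.add_mem (hfull _ _ h2.symm) (S.add_mem (S.neg_mem (harc k)) (hfull _ _ h1))
  · refine Submodule.span_le.mpr ?_
    rintro _ (rfl | ⟨k, rfl⟩)
    · exact arcClass_mem_cycleSpan x (.inl (by simp))
    · exact arcClass_mem_cycleSpan x (.inr ⟨k, h k⟩)

lemma cycleSpan_congr {i j : ℕ} (x : (Fin i → Circle × Circle) × C(Circle, X))
    (y : (Fin j → Circle × Circle) × C(Circle, X)) (h : x.2 = y.2)
    (hxy : ∀ k, ∃ l, s((x.1 k).1, (x.1 k).2) = s((y.1 l).1, (y.1 l).2)) :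
    cycleSpan x ≤ cycleSpan y := by
  refine Submodule.span_le.mpr ?_
  rintro _ ⟨s, t, hst, rfl⟩
  rw [h]
  refine arcClass_mem_cycleSpan y (hst.imp_right ?_)
  rintro ⟨k, hs, ht⟩
  rw [hs, ht]
  exact hxy k

/-- A lift of a path in the circle to the line. -/
lemma exists_lift_circle (c : C(I, Circle)) : ∃ a : C(I, ℝ), ∀ u, Circle.exp (a u) = c u := by
  obtain ⟨t, ht⟩ := exists_angle (c 0)
  refine ⟨Circle.isCoveringMap_exp.liftPath c t ht.symm, fun u => ?_⟩
  exact congrFun (Circle.isCoveringMap_exp.liftPath_lifts c t ht.symm) u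

/-- The condition on the ends keeps the arc closed at all times, so it undergoes a free homotopy of
loops. -/
lemma arcClass_homotopy (φ : C(I, C(Circle, X))) (a b : C(I, ℝ))
    (h : ∀ u, φ u (Circle.exp (a u)) = φ u (Circle.exp (b u))) :
    arcClass (φ 0) (a 0) (b 0) = arcClass (φ 1) (a 1) (b 1) := by
  refine pathClass_eq_of_loop_homotopy
    ⟨fun p : I × I => φ p.1 (Circle.exp (a p.1 + (p.2 : ℝ) • (b p.1 - a p.1))), ?_⟩ ?_ _ _
    (fun _ => rfl) (fun _ => rfl)
  · exact Continuous.eval (by fun_prop) (by fun_prop)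
  · intro s
    simpa using h s

/-- Only the coincidence of the values at the two ends of each chord matters, not the distinctness
of the points. The path may therefore start at a degenerate configuration, such as the chords PQ and
PR at a triple point. -/
lemma cycleSpan_path {i : ℕ} (p : C(I, (Fin i → Circle × Circle) × C(Circle, X)))
    (hp : ∀ u k, (p u).2 ((p u).1 k).1 = (p u).2 ((p u).1 k).2) :
    cycleSpan (p 0) = cycleSpan (p 1) := by
  choose a ha using fun k => exists_lift_circle ⟨fun u => ((p u).1 k).1, by fun_prop⟩
  choose b hb using fun k => exists_lift_circle ⟨fun u => ((p u).1 k).2, by fun_prop⟩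
  simp only [ContinuousMap.coe_mk] at ha hb
  rw [cycleSpan_eq_span (p 0) (fun k => a k 0) (fun k => b k 0) (fun k => by rw [ha, hb]),
    cycleSpan_eq_span (p 1) (fun k => a k 1) (fun k => b k 1) (fun k => by rw [ha, hb])]
  let φ : C(I, C(Circle, X)) := ⟨fun u => (p u).2, by fun_prop⟩
  have e1 := arcClass_homotopy φ (ContinuousMap.const _ 0)
    (ContinuousMap.const _ (2 * Real.pi)) (fun u => by simp)
  have e2 : ∀ k, arcClass (p 0).2 (a k 0) (b k 0) = arcClass (p 1).2 (a k 1) (b k 1) := fun k =>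
    arcClass_homotopy φ (a k) (b k) (fun u => by rw [ha, hb]; exact hp u k)
  simp only [e2]
  rw [show arcClass (p 0).2 0 (2 * Real.pi) = arcClass (p 1).2 0 (2 * Real.pi) from e1]

end Arcs

end KnotSS

end

noncomputable section

namespace KnotSS

/-! ### Crossing of chords -/

/-- The numerator of the cross-ratio of two chords; it is negative iff they cross. -/
def chordSign (x : Pre 2) : ℝ :=
  ((((x.1 0).1 : ℂ) - (x.1 1).1) * (((x.1 0).2 : ℂ) - (x.1 1).2) *
    (starRingEnd ℂ) ((((x.1 0).1 : ℂ) - (x.1 1).2) * (((x.1 0).2 : ℂ) - (x.1 1).1))).re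

/-- A difference of two unit numbers is `2i` times the sine of half the difference of the angles,
times the unit number at half their sum. The two products have the same phase, which the conjugation
cancels. -/
lemma chordSign_eq (x : Pre 2) {a b c d : ℝ} (ha : Circle.exp a = (x.1 0).1)
    (hb : Circle.exp b = (x.1 0).2) (hc : Circle.exp c = (x.1 1).1)
    (hd : Circle.exp d = (x.1 1).2) :
    chordSign x = 16 * (Real.sin ((a - c) / 2) * Real.sin ((b - d) / 2) *
      (Real.sin ((a - d) / 2) * Real.sin ((b - c) / 2))) := by
  have hconj : ∀ t : ℝ, (starRingEnd ℂ) (Complex.exp (t * Complex.I)) =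
      (Complex.exp (t / 2 * Complex.I))⁻¹ ^ 2 := by
    intro t
    rw [← Complex.exp_conj, ← Complex.exp_neg, ← Complex.exp_nat_mul]
    congr 1
    simp
    ring
  have hsq : ∀ t : ℝ, Complex.exp (t * Complex.I) = Complex.exp (t / 2 * Complex.I) ^ 2 := by
    intro t
    rw [← Complex.exp_nat_mul]
    congr 1
    push_cast
    ring
  have hsin : ∀ s t : ℝ, ((Real.sin ((s - t) / 2) : ℝ) : ℂ) =
      (Complex.exp (t / 2 * Complex.I) * (Complex.exp (s / 2 * Complex.I))⁻¹ -
        Complex.exp (s / 2 * Complex.I) * (Complex.exp (t / 2 * Complex.I))⁻¹) * Complex.I / 2 := by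
    intro s t
    rw [Complex.ofReal_sin, Complex.sin, ← Complex.exp_neg, ← Complex.exp_neg, ← Complex.exp_add,
      ← Complex.exp_add]
    push_cast
    ring_nf
  rw [chordSign, ← ha, ← hb, ← hc, ← hd, ← Complex.ofReal_re (16 * _)]
  congr 1
  simp only [map_mul, map_sub, Circle.coe_exp, hconj]
  simp only [hsq, Complex.ofReal_mul, Complex.ofReal_ofNat, hsin]
  have := Complex.exp_ne_zero (a / 2 * Complex.I)
  have := Complex.exp_ne_zero (b / 2 * Complex.I)
  have := Complex.exp_ne_zero (c / 2 * Complex.I)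
  have := Complex.exp_ne_zero (d / 2 * Complex.I)
  generalize Complex.exp (a / 2 * Complex.I) = p at *
  generalize Complex.exp (b / 2 * Complex.I) = q at *
  generalize Complex.exp (c / 2 * Complex.I) = r at *
  generalize Complex.exp (d / 2 * Complex.I) = s at *
  have hI : Complex.I ^ 4 = 1 := Complex.I_pow_four
  field_simp
  rw [hI]
  ring

lemma exists_angle_Ioo (t : ℝ) {u : Circle} (hu : u ≠ Circle.exp t) :
    ∃ s, t < s ∧ s < t + 2 * Real.pi ∧ Circle.exp s = u := by
  obtain ⟨r, rfl⟩ := exists_angle u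
  have h1 := toIcoMod_mem_Ico Real.two_pi_pos t r
  have h2 : Circle.exp (toIcoMod Real.two_pi_pos t r) = Circle.exp r :=
    Circle.exp_eq_exp.mpr ⟨-toIcoDiv Real.two_pi_pos t r, by
      rw [toIcoMod]
      push_cast
      rw [zsmul_eq_mul]
      ring⟩
  refine ⟨_, lt_of_le_of_ne h1.1 fun h => hu ?_, h1.2, h2⟩
  rw [← h2, ← h]

/-- Each sine is taken at half the difference of the angles of two distinct points. Thus the sign
cannot change along a path of configurations. -/
lemma chordSign_ne_zero {x : Pre 2} (hx : Respects x) : chordSign x ≠ 0 := by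
  obtain ⟨a, ha⟩ := exists_angle (x.1 0).1
  obtain ⟨b, hb⟩ := exists_angle (x.1 0).2
  obtain ⟨c, hc⟩ := exists_angle (x.1 1).1
  obtain ⟨d, hd⟩ := exists_angle (x.1 1).2
  have key : ∀ s t : ℝ, Circle.exp s ≠ Circle.exp t → Real.sin ((s - t) / 2) ≠ 0 := by
    intro s t hst h0
    obtain ⟨n, hn⟩ := Real.sin_eq_zero_iff.mp h0
    exact hst (Circle.exp_eq_exp.mpr ⟨n, by linarith⟩)
  rw [chordSign_eq x ha hb hc hd]
  have h1 := key a c (by rw [ha, hc]; exact fun h => by simpa using hx.1 (a₁ := .inl 0) (a₂ := .inl 1) h)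
  have h2 := key b d (by rw [hb, hd]; exact fun h => by simpa using hx.1 (a₁ := .inr 0) (a₂ := .inr 1) h)
  have h3 := key a d (by rw [ha, hd]; exact fun h => by simpa using hx.1 (a₁ := .inl 0) (a₂ := .inr 1) h)
  have h4 := key b c (by rw [hb, hc]; exact fun h => by simpa using hx.1 (a₁ := .inr 0) (a₂ := .inl 1) h)
  positivity

/-- With the other angles placed in the period following the first end of the first chord, the two
sines involving that end are negative. The product of the other two is negative exactly when the
second end separates the ends of the second chord. -/
lemma crossing_iff (x : Realization 2) : Crossing x ↔ chordSign x.1 < 0 := by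
  constructor
  · rintro ⟨t₀, t₁, t₂, t₃, h01, h12, h23, h30, e0, e1⟩
    have s1 : Real.sin ((t₀ - t₁) / 2) < 0 := Real.sin_neg_of_neg_of_neg_pi_lt (by linarith) (by linarith)
    have s2 : Real.sin ((t₂ - t₃) / 2) < 0 := Real.sin_neg_of_neg_of_neg_pi_lt (by linarith) (by linarith)
    have s3 : Real.sin ((t₀ - t₃) / 2) < 0 := Real.sin_neg_of_neg_of_neg_pi_lt (by linarith) (by linarith)
    have s4 : 0 < Real.sin ((t₂ - t₁) / 2) := Real.sin_pos_of_pos_of_lt_pi (by linarith) (by linarith)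
    have key := mul_neg_of_pos_of_neg (mul_pos_of_neg_of_neg s1 s2) (mul_neg_of_neg_of_pos s3 s4)
    rcases e1 with e1 | e1
    · rw [chordSign_eq x.1 (a := t₀) (b := t₂) (c := t₁) (d := t₃) (by rw [e0]) (by rw [e0])
        (by rw [e1]) (by rw [e1])]
      linarith
    · rw [chordSign_eq x.1 (a := t₀) (b := t₂) (c := t₃) (d := t₁) (by rw [e0]) (by rw [e0])
        (by rw [e1]) (by rw [e1])]
      linarith
  · intro hx
    obtain ⟨a, ha⟩ := exists_angle (x.1.1 0).1
    have inj := x.2.1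
    obtain ⟨b, hb1, hb2, hb⟩ := exists_angle_Ioo a (u := (x.1.1 0).2)
      (by rw [ha]; exact fun h => by simpa using inj (a₁ := .inr 0) (a₂ := .inl 0) h)
    obtain ⟨c, hc1, hc2, hc⟩ := exists_angle_Ioo a (u := (x.1.1 1).1)
      (by rw [ha]; exact fun h => by simpa using inj (a₁ := .inl 1) (a₂ := .inl 0) h)
    obtain ⟨d, hd1, hd2, hd⟩ := exists_angle_Ioo a (u := (x.1.1 1).2)
      (by rw [ha]; exact fun h => by simpa using inj (a₁ := .inr 1) (a₂ := .inl 0) h)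
    rw [chordSign_eq x.1 ha hb hc hd] at hx
    have s1 : Real.sin ((a - c) / 2) < 0 := Real.sin_neg_of_neg_of_neg_pi_lt (by linarith) (by linarith)
    have s2 : Real.sin ((a - d) / 2) < 0 := Real.sin_neg_of_neg_of_neg_pi_lt (by linarith) (by linarith)
    have s3 : Real.sin ((b - d) / 2) * Real.sin ((b - c) / 2) < 0 := by
      have := mul_pos_of_neg_of_neg s1 s2
      by_contra! h
      nlinarith [mul_nonneg this.le h]
    have pos : ∀ s t : ℝ, a < s → t < a + 2 * Real.pi → t ≤ s → s < a + 2 * Real.pi → a < t →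
        0 ≤ Real.sin ((s - t) / 2) := fun s t _ _ _ _ _ =>
      Real.sin_nonneg_of_nonneg_of_le_pi (by linarith) (by linarith)
    have neg : ∀ s t : ℝ, a < s → t < a + 2 * Real.pi → s ≤ t → s < a + 2 * Real.pi → a < t →
        Real.sin ((s - t) / 2) ≤ 0 := fun s t _ _ _ _ _ =>
      Real.sin_nonpos_of_nonpos_of_neg_pi_le (by linarith) (by linarith)
    have e0 : x.1.1 0 = (Circle.exp a, Circle.exp b) := Prod.ext ha.symm hb.symm
    rcases le_total b c with hbc | hbc <;> rcases le_total b d with hbd | hbd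
    · exact absurd s3 (not_lt.mpr (mul_nonneg_of_nonpos_of_nonpos
        (neg b d hb1 hd2 hbd hb2 hd1) (neg b c hb1 hc2 hbc hb2 hc1)))
    · have n1 : d ≠ b := by rintro rfl; simp at s3
      have n2 : b ≠ c := by rintro rfl; simp at s3
      exact ⟨a, d, b, c, hd1, lt_of_le_of_ne hbd n1, lt_of_le_of_ne hbc n2, hc2, e0,
        .inr (Prod.ext hc.symm hd.symm)⟩
    · have n1 : c ≠ b := by rintro rfl; simp at s3
      have n2 : b ≠ d := by rintro rfl; simp at s3
      exact ⟨a, c, b, d, hc1, lt_of_le_of_ne hbc n1, lt_of_le_of_ne hbd n2, hd2, e0,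
        .inl (Prod.ext hc.symm hd.symm)⟩
    · exact absurd s3 (not_lt.mpr (mul_nonneg
        (pos b d hb1 hd2 hbd hb2 hd1) (pos b c hb1 hc2 hbc hb2 hc1)))

lemma chordSign_swap_pairs (P Q R S : Circle) (φ : C(Circle, M)) :
    chordSign (![(P, Q), (R, S)], φ) = chordSign (![(R, S), (P, Q)], φ) := by
  simp [chordSign]
  ring

lemma chordSign_swap_first (P Q R S : Circle) (φ : C(Circle, M)) :
    chordSign (![(P, Q), (R, S)], φ) = chordSign (![(Q, P), (R, S)], φ) := by
  simp [chordSign]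
  ring

lemma chordSign_swap_second (P Q R S : Circle) (φ : C(Circle, M)) :
    chordSign (![(P, Q), (R, S)], φ) = chordSign (![(P, Q), (S, R)], φ) := by
  rw [chordSign_swap_pairs, chordSign_swap_first, chordSign_swap_pairs]

lemma chordSign_relabelled {x y : Realization 2} (h : Relabelled x y) :
    chordSign x.1 = chordSign y.1 := by
  obtain ⟨hφ, e, he⟩ := h
  have hx : ∀ z : Realization 2, z.1 = (![((z.1.1 0).1, (z.1.1 0).2), ((z.1.1 1).1, (z.1.1 1).2)],
      z.1.2) := by
    intro z
    refine Prod.ext ?_ rfl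
    funext k
    fin_cases k <;> rfl
  have hsw : ∀ p q : Circle × Circle, p = q.swap → p.1 = q.2 ∧ p.2 = q.1 := by
    rintro p q rfl
    simp
  rw [hx x, hx y, hφ]
  have h0 := he 0
  have h1 := he 1
  have h01 : e 0 ≠ e 1 := fun h => by simpa using e.injective h
  have cases2 : ∀ i : Fin 2, i = 0 ∨ i = 1 := by decide
  rcases cases2 (e 0) with i0 | i0 <;> rcases cases2 (e 1) with i1 | i1
  · exact absurd (i0.trans i1.symm) h01
  · rw [i0] at h0
    rw [i1] at h1
    rcases h0 with h0 | h0 <;> rcases h1 with h1 | h1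
    · rw [h0, h1]
    · rw [h0, (hsw _ _ h1).1, (hsw _ _ h1).2, chordSign_swap_second]
    · rw [h1, (hsw _ _ h0).1, (hsw _ _ h0).2, chordSign_swap_first]
    · rw [(hsw _ _ h1).1, (hsw _ _ h1).2, (hsw _ _ h0).1, (hsw _ _ h0).2, chordSign_swap_first,
        chordSign_swap_second]
  · rw [i0] at h0
    rw [i1] at h1
    rw [chordSign_swap_pairs]
    rcases h0 with h0 | h0 <;> rcases h1 with h1 | h1
    · rw [h0, h1]
    · rw [h0, (hsw _ _ h1).1, (hsw _ _ h1).2, chordSign_swap_first]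
    · rw [h1, (hsw _ _ h0).1, (hsw _ _ h0).2, chordSign_swap_second]
    · rw [(hsw _ _ h1).1, (hsw _ _ h1).2, (hsw _ _ h0).1, (hsw _ _ h0).2, chordSign_swap_first,
        chordSign_swap_second]
  · exact absurd (i0.trans i1.symm) h01

lemma crossing_relabelled {x y : Realization 2} (h : Relabelled x y) : Crossing x ↔ Crossing y := by
  rw [crossing_iff, crossing_iff, chordSign_relabelled h]

lemma continuous_chordSign : Continuous chordSign := by
  unfold chordSign
  fun_prop

/-- Intermediate value theorem for the continuous function `chordSign`, which has no zeros on
configurations. -/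
lemma crossing_joined {x y : Realization 2} (h : Joined x y) : Crossing x → Crossing y := by
  obtain ⟨p⟩ := h
  rw [crossing_iff, crossing_iff]
  intro hx
  by_contra! hy
  have hc : Continuous fun u : I => chordSign (p u).1 :=
    continuous_chordSign.comp (continuous_subtype_val.comp p.continuous)
  obtain ⟨u, hu⟩ := mem_range_of_exists_le_of_exists_ge hc
    ⟨0, by simpa using hx.le⟩ ⟨1, by simpa using hy⟩
  exact chordSign_ne_zero (p u).2 hu

/-- The crossing of the chords as a property of a route. -/
def RouteCrossing : Route 2 → Prop :=
  Quot.lift Crossing fun _ _ h => propext <| h.elim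
    (fun h => ⟨crossing_joined h, crossing_joined h.symm⟩) crossing_relabelled

/-! ### The span of the cycles of a route -/

lemma cycleSpan_joined {i : ℕ} {x y : Realization i} (h : Joined x y) :
    cycleSpan x.1 = cycleSpan y.1 := by
  obtain ⟨p⟩ := h
  have := cycleSpan_path (⟨fun u => (p u).1, by fun_prop⟩ : C(I, Pre i))
    (fun u k => (p u).2.2 k)
  simpa using this

lemma cycleSpan_relabelled {i : ℕ} {x y : Realization i} (h : Relabelled x y) :
    cycleSpan x.1 = cycleSpan y.1 := by
  obtain ⟨hφ, e, he⟩ := h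
  apply le_antisymm
  · refine cycleSpan_congr _ _ hφ fun k => ⟨e k, ?_⟩
    rcases he k with h | h <;> simp [h, Sym2.eq_swap]
  · refine cycleSpan_congr _ _ hφ.symm fun k => ⟨e.symm k, ?_⟩
    rcases he (e.symm k) with h | h <;> simp [h, Sym2.eq_swap]

/-- The span of the classes of the whole curve and of its arcs bounded by the pairs, as a function
of a route. -/
def routeSpan {i : ℕ} : Route i → Submodule ℤ (Chains1 M) :=
  Quot.lift (fun x => cycleSpan x.1) fun _ _ h => h.elim cycleSpan_joined cycleSpan_relabelled

lemma routeSpan_route {i : ℕ} (x : Realization i) : routeSpan (route x) = cycleSpan x.1 := rfl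

/-- The splitting path starts outside the space of configurations, since `P` occurs twice, but the
coincidences needed in `cycleSpan_path` hold there too. -/
lemma cycleSpan_splits {φ : C(Circle, M)} {P Q R : Circle} {x : Realization 2} (h : Splits φ P Q R x)
    (hPQ : φ P = φ Q) (hPR : φ P = φ R) :
    cycleSpan x.1 = cycleSpan (X := M) (![(P, Q), (P, R)], φ) := by
  obtain ⟨p, h0, hs, h1⟩ := h
  rw [← h1, ← h0]
  refine (cycleSpan_path p fun u k => ?_).symm
  by_cases hu : u = 0
  · rw [hu, h0]
    fin_cases k
    · exact hPQ
    · exact hPR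
  · exact (hs u hu).2 k

/-- The arc from `P` to `R` is the sum of the arcs from `P` to `Q` and from `Q` to `R`. -/
lemma cycleSpan_triple_le (φ : C(Circle, M)) (P Q R : Circle) :
    cycleSpan (X := M) (![(P, Q), (P, R)], φ) ≤ cycleSpan (X := M) (![(Q, R), (Q, P)], φ) := by
  obtain ⟨p, rfl⟩ := exists_angle P
  obtain ⟨q, rfl⟩ := exists_angle Q
  obtain ⟨r, rfl⟩ := exists_angle R
  rw [cycleSpan_eq_span _ ![p, p] ![q, r] (by intro k; fin_cases k <;> rfl)]
  set S := cycleSpan (X := M) (![(Circle.exp q, Circle.exp r), (Circle.exp q, Circle.exp p)], φ)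
  have hqr : arcClass φ q r ∈ S := arcClass_mem_cycleSpan (X := M)
    (![(Circle.exp q, Circle.exp r), (Circle.exp q, Circle.exp p)], φ) (.inr ⟨0, rfl⟩)
  have hqp : arcClass φ q p ∈ S := arcClass_mem_cycleSpan (X := M)
    (![(Circle.exp q, Circle.exp r), (Circle.exp q, Circle.exp p)], φ) (.inr ⟨1, rfl⟩)
  have hpq : arcClass φ p q ∈ S := by
    rw [arcClass_symm]
    exact S.neg_mem hqp
  refine Submodule.span_le.mpr ?_
  rintro _ (rfl | ⟨k, rfl⟩)
  · exact arcClass_mem_cycleSpan (X := M)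
      (![(Circle.exp q, Circle.exp r), (Circle.exp q, Circle.exp p)], φ) (.inl (by simp))
  · fin_cases k
    · exact hpq
    · change arcClass φ p r ∈ S
      rw [← arcClass_add φ p q r]
      exact S.add_mem hpq hqr

lemma cycleSpan_swap_pairs (φ : C(Circle, M)) (P Q R S : Circle) :
    cycleSpan (X := M) (![(P, Q), (R, S)], φ) ≤ cycleSpan (X := M) (![(R, S), (P, Q)], φ) :=
  cycleSpan_congr _ _ rfl fun k => ⟨1 - k, by fin_cases k <;> rfl⟩

lemma routeSpan_neighbor {r r' : Route 2} (h : Neighbor r r') : routeSpan r = routeSpan r' := by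
  obtain ⟨φ, P, Q, R, x, y, ht, hx, hy, -, -, rfl, rfl⟩ := h
  obtain ⟨-, -, -, -, hPQ, hQR, -⟩ := ht
  rw [routeSpan_route, routeSpan_route, cycleSpan_splits hx hPQ (hPQ.trans hQR),
    cycleSpan_splits hy hQR hPQ.symm]
  refine le_antisymm (cycleSpan_triple_le φ P Q R) ?_
  -- The reverse inclusion is the same lemma with `P` and `Q` exchanged, up to the order of the
  -- chords on both sides.
  exact (cycleSpan_swap_pairs _ _ _ _ _).trans
    ((cycleSpan_triple_le φ Q P R).trans (cycleSpan_swap_pairs _ _ _ _ _))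

lemma routeSpan_related {r r' : Route 2} (h : Related r r') : routeSpan r = routeSpan r' := by
  induction h with
  | refl => rfl
  | tail _ h ih => exact ih.trans (routeSpan_neighbor h)

lemma arcClass_eq_zero {φ : C(Circle, M)} {s e : ℝ} (h : ArcContractible φ s e) :
    arcClass φ s e = 0 := by
  obtain ⟨H, h0, hl, p, h1⟩ := h
  rw [← pathClass_const p]
  exact pathClass_eq_of_loop_homotopy H hl _ _ h0 h1

/-- The rank of a submodule, with the module structure that it inherits. -/
def submoduleRank {R A : Type*} [CommRing R] [AddCommGroup A] [Module R A] (S : Submodule R A) :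
    Cardinal := Module.rank R S

/-- The rank may be read with the inherited module structure or with that of an abelian group. They
agree, because an abelian group has only one structure of a `ℤ`-module. -/
lemma submoduleRank_eq {A : Type*} [AddCommGroup A] {m : Module ℤ A} (S : Submodule ℤ A) :
    submoduleRank S = Module.rank ℤ S := by
  unfold submoduleRank
  congr 1
  exact Subsingleton.elim _ _

lemma submoduleRank_mono {R A : Type*} [CommRing R] [AddCommGroup A] [Module R A]
    {S T : Submodule R A} (h : S ≤ T) : submoduleRank S ≤ submoduleRank T :=
  Submodule.rank_mono h

lemma submoduleRank_span_pair_le {R A : Type*} [CommRing R] [Nontrivial R] [AddCommGroup A]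
    [Module R A] (a b : A) : submoduleRank (Submodule.span R ({a, b} : Set A)) ≤ 2 := by
  refine (rank_span_le (R := R) (M := A) _).trans ?_
  refine (Cardinal.mk_insert_le).trans ?_
  rw [Cardinal.mk_singleton]
  norm_num

/-- Of the three generators, the arc of the contractible loop has class zero; the whole curve and
the arc of the other chord remain. -/
lemma rank_routeSpan_marginal {r : Route 2} (h : Marginal r) :
    submoduleRank (routeSpan r) ≤ 2 := by
  obtain ⟨x, rfl, s, e, ⟨-, -, ⟨k, hk⟩, -⟩, hc⟩ := h
  -- In `Fin 2`, the index other than `k` is `1 - k`.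
  obtain ⟨a, ha⟩ := exists_angle (x.1.1 (1 - k)).1
  obtain ⟨b, hb⟩ := exists_angle (x.1.1 (1 - k)).2
  have hne : ∀ k : Fin 2, 1 - k ≠ k := by decide
  have hcases : ∀ k l : Fin 2, l = k ∨ l = 1 - k := by decide
  have h0 := arcClass_eq_zero hc
  rw [routeSpan_route, cycleSpan_eq_span x.1 (fun l => if l = k then s else a)
    (fun l => if l = k then e else b) (fun l => by
      rcases hcases k l with rfl | rfl
      · simpa using hk
      · simp [hne k, ha, hb])]
  have hle : Submodule.span ℤ (insert (arcClass x.1.2 0 (2 * Real.pi)) (Set.range fun l =>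
      arcClass x.1.2 (if l = k then s else a) (if l = k then e else b))) ≤
      Submodule.span ℤ {arcClass x.1.2 0 (2 * Real.pi), arcClass x.1.2 a b} := by
    refine Submodule.span_le.mpr ?_
    rintro _ (rfl | ⟨l, rfl⟩)
    · exact Submodule.subset_span (Set.mem_insert _ _)
    · rcases hcases k l with rfl | rfl
      · simp only [if_true, h0]
        exact Submodule.zero_mem _
      · simp only [hne k, if_false]
        exact Submodule.subset_span (Set.mem_insert_of_mem _ rfl)
  exact (submoduleRank_mono hle).trans (submoduleRank_span_pair_le _ _)

/-! ### Neighbors and crossing -/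

lemma not_crossing_related {r r' : Route 2} (h : Related r r') (hr : ¬ RouteCrossing r) :
    ¬ RouteCrossing r' := by
  induction h with
  | refl => exact hr
  | tail _ h _ =>
    obtain ⟨φ, P, Q, R, x, y, -, -, -, -, hy, -, rfl⟩ := h
    exact hy

/-- The realization with the two chords exchanged. -/
def swapChords (x : Realization 2) : Realization 2 :=
  ⟨(x.1.1 ∘ Equiv.swap 0 1, x.1.2), by
    refine ⟨?_, fun k => x.2.2 _⟩
    have : Sum.elim (fun k => ((x.1.1 ∘ Equiv.swap 0 1) k).1)
        (fun k => ((x.1.1 ∘ Equiv.swap 0 1) k).2) =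
        Sum.elim (fun k => (x.1.1 k).1) (fun k => (x.1.1 k).2) ∘
          Sum.map (Equiv.swap (0 : Fin 2) 1) (Equiv.swap (0 : Fin 2) 1) := by
      funext k
      rcases k with k | k <;> rfl
    exact this ▸ x.2.1.comp
      (Sum.map_injective.mpr ⟨(Equiv.swap 0 1).injective, (Equiv.swap 0 1).injective⟩)⟩

lemma swapChords_relabelled (x : Realization 2) : Relabelled (swapChords x) x :=
  ⟨rfl, Equiv.swap 0 1, fun _ => .inl rfl⟩

lemma route_swapChords (x : Realization 2) : route (swapChords x) = route x :=
  Quot.sound (.inr (swapChords_relabelled x))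

lemma splits_swapChords {φ : C(Circle, M)} {P Q R : Circle} {x : Realization 2}
    (h : Splits φ P Q R x) : Splits φ P R Q (swapChords x) := by
  obtain ⟨p, h0, hs, h1⟩ := h
  refine ⟨⟨fun u => ((p u).1 ∘ Equiv.swap 0 1, (p u).2), by fun_prop⟩, ?_, fun u hu => ?_, ?_⟩
  · change ((p 0).1 ∘ Equiv.swap 0 1, (p 0).2) = _
    rw [h0]
    refine Prod.ext ?_ rfl
    funext k
    fin_cases k <;> rfl
  · exact (swapChords ⟨p u, hs u hu⟩).2
  · simp [h1, swapChords]

lemma isGenericTriple_swap {φ : C(Circle, M)} {P Q R : Circle} (h : IsGenericTriple φ P Q R) :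
    IsGenericTriple φ Q P R := by
  obtain ⟨h1, h2, h3, h4, h5, h6, h7, h8⟩ := h
  refine ⟨h1, h2.symm, h4, h3, h5.symm, h5.trans h6, fun s t hst => (h7 s t hst).imp_right ?_, ?_⟩
  · rw [Set.insert_comm]
    exact id
  · intro u v w hu hv hw
    have := (h8 v u w hv hu hw).comp _ (Equiv.swap (0 : Fin 3) 1).injective
    convert this using 1
    funext k
    fin_cases k <;> rfl

/-- The definition splits `P` and `Q` in the cyclic orders P Q R and Q R P. Exchanging the roles
leads to the orders Q P R and P R Q, in which each splitting lists its two chords the other way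
round. -/
lemma neighbor_symm {r r' : Route 2} (h : Neighbor r r') : Neighbor r' r := by
  obtain ⟨φ, P, Q, R, x, y, ht, hx, hy, cx, cy, rfl, rfl⟩ := h
  exact ⟨φ, Q, P, R, swapChords y, swapChords x, isGenericTriple_swap ht, splits_swapChords hy,
    splits_swapChords hx, by rwa [crossing_relabelled (swapChords_relabelled y)],
    by rwa [crossing_relabelled (swapChords_relabelled x)], route_swapChords y, route_swapChords x⟩

/-- Routes with crossing chords are not relatives of a route without crossing, so both crossing
values are `0`. The two non-crossing splittings are neighbors, so their values agree. -/
lemma gammaFig_mem_E1 (hm : ∀ r, Related (route fig) r → ¬ Marginal r) (hc : ¬ Crossing fig) :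
    gammaFig ∈ E1 := by
  refine ⟨fun r hr => ?_, ?_⟩
  · exact if_neg fun h => hm r h hr
  · intro φ P Q R ht x x' y y' hx hx' hy hy' cx cx' cy cy'
    have n : Neighbor (route x') (route y') := ⟨φ, P, Q, R, x', y', ht, hx', hy', cx', cy', rfl, rfl⟩
    have zero : ∀ z, Crossing z → gammaFig (route z) = 0 := fun z hz =>
      if_neg fun h => not_crossing_related h (r := route fig) hc (r' := route z) hz
    have e : gammaFig (route x') = gammaFig (route y') := by
      unfold gammaFig
      congr 1
      exact propext ⟨fun h => h.tail n, fun h => h.tail (neighbor_symm n)⟩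
    rw [zero x cx, zero y cy, e]

end KnotSS

end

noncomputable section

namespace KnotSS

open Topology Filter

/-! ### Local retractions onto the hypersurface -/

section Retraction

variable {E : Type*} [NormedAddCommGroup E] [NormedSpace ℝ E] [CompleteSpace E]

/-- A hypersurface is locally a retract of the ambient space at its regular points. -/
lemma exists_local_retraction {f : E → ℝ} {f' : E →L[ℝ] ℝ} {a : E} (hf : HasStrictFDerivAt f f' a)
    (hf' : f'.range = ⊤) (ha : f a = 0) :
    ∃ U ∈ 𝓝 a, ∃ r : E → E, ContinuousOn r U ∧ ∀ x ∈ U, f (r x) = 0 ∧ (f x = 0 → r x = x) := by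
  -- A chart with first coordinate `f`. The retraction sets this coordinate to `0`, on the set `U`
  -- where the result stays in the target.
  set Φ := hf.implicitToOpenPartialHomeomorph f f' hf' with hΦ
  have hs : a ∈ Φ.source := hf.mem_implicitToOpenPartialHomeomorph_source hf'
  have ht : ((0 : ℝ), (Φ a).2) ∈ Φ.target := by
    have h1 : Φ a = (0, (Φ a).2) := Prod.ext ha rfl
    rw [← h1]
    exact Φ.map_source hs
  have hfst : ∀ x, (Φ x).1 = f x := fun x => rfl
  let U := Φ.source ∩ Φ ⁻¹' ((fun q : ℝ × f'.ker => ((0 : ℝ), q.2)) ⁻¹' Φ.target)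
  have hU : IsOpen U := Φ.isOpen_inter_preimage (Φ.open_target.preimage (by fun_prop))
  refine ⟨U, hU.mem_nhds ⟨hs, ht⟩, fun x => Φ.symm (0, (Φ x).2), ?_, fun x hx => ⟨?_, fun h0 => ?_⟩⟩
  · refine Φ.continuousOn_symm.comp (t := Φ.target) ?_ fun x hx => hx.2
    exact continuousOn_const.prodMk
      (continuous_snd.comp_continuousOn (Φ.continuousOn.mono Set.inter_subset_left))
  · rw [← hfst, Φ.right_inv hx.2]
  · have h1 : ((0 : ℝ), (Φ x).2) = Φ x := Prod.ext (by rw [hfst, h0]) rfl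
    simp only [h1, Φ.left_inv hx.1]

end Retraction

lemma contDiff_defFun : ContDiff ℝ ∞ defFun := by
  unfold defFun outline
  fun_prop

/-- The four boundary circles are disjoint, so only one factor vanishes at a boundary point. It has
non-zero derivative in the radial direction from the center of its circle. -/
lemma outline_hasDerivAt_ne_zero {x y : ℝ} (h : outline x y = 0) :
    ∃ v w d : ℝ, HasDerivAt (fun t : ℝ => outline (x + t * v) (y + t * w)) d 0 ∧ d ≠ 0 := by
  have hq : ∀ c, HasDerivAt (fun t : ℝ => (x + t * (x - c) - c) ^ 2 + (y + t * y) ^ 2)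
      (2 * ((x - c) ^ 2 + y ^ 2)) 0 := by
    intro c
    have h1 : HasDerivAt (fun t : ℝ => x + t * (x - c) - c) (x - c) 0 := by
      simpa using (((hasDerivAt_id (0 : ℝ)).mul_const (x - c)).const_add x).sub_const c
    have h2 : HasDerivAt (fun t : ℝ => y + t * y) y 0 := by
      simpa using ((hasDerivAt_id (0 : ℝ)).mul_const y).const_add y
    refine ((h1.fun_pow 2).fun_add (h2.fun_pow 2)).congr_deriv ?_
    simp
    ring
  -- The vanishing factor belongs to the circle of center `(c, 0)` and squared radius `b`; `e` is
  -- its sign, `-1` for the outer circle, and `G` is the product of the other three factors.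
  have key : ∀ (c b e : ℝ) (G : ℝ → ℝ), DifferentiableAt ℝ G 0 → G 0 ≠ 0 →
      (x - c) ^ 2 + y ^ 2 = b → b ≠ 0 → e ≠ 0 →
      (∀ t, outline (x + t * (x - c)) (y + t * y) =
        e * ((x + t * (x - c) - c) ^ 2 + (y + t * y) ^ 2 - b) * G t) →
      ∃ v w d : ℝ, HasDerivAt (fun t : ℝ => outline (x + t * v) (y + t * w)) d 0 ∧ d ≠ 0 := by
    intro c b e G hG hG0 hb hb0 he hF
    refine ⟨x - c, y, e * (2 * b) * G 0, ?_, by positivity⟩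
    have h3 := ((((hq c).sub_const b).const_mul e).mul hG.hasDerivAt)
    simp only [zero_mul, add_zero] at h3
    rw [hb, sub_self, mul_zero, zero_mul, add_zero] at h3
    exact h3.congr_of_eventuallyEq (Eventually.of_forall hF)
  unfold outline at h
  rcases mul_eq_zero.mp h with h | h4
  rcases mul_eq_zero.mp h with h | h3
  rcases mul_eq_zero.mp h with h1 | h2
  · have e : x ^ 2 + y ^ 2 = 144 := by linarith
    have hx : x ^ 2 ≤ 144 := by nlinarith [sq_nonneg y]
    have hx1 : x ≤ 12 := by nlinarith
    have hx2 : -12 ≤ x := by nlinarith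
    refine key 0 144 (-1) (fun t => ((x + t * x) ^ 2 + (y + t * y) ^ 2 - 1) *
      ((x + t * x - 4) ^ 2 + (y + t * y) ^ 2 - 1) * ((x + t * x + 4) ^ 2 + (y + t * y) ^ 2 - 1))
      (by fun_prop) ?_ (by linarith) (by norm_num) (by norm_num) fun t => by
        simp only [outline, sub_zero]
        ring
    simp only [zero_mul, add_zero]
    have a1 : x ^ 2 + y ^ 2 - 1 ≠ 0 := by linarith
    have a2 : (x - 4) ^ 2 + y ^ 2 - 1 ≠ 0 := by nlinarith
    have a3 : (x + 4) ^ 2 + y ^ 2 - 1 ≠ 0 := by nlinarith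
    exact mul_ne_zero (mul_ne_zero a1 a2) a3
  · have e : x ^ 2 + y ^ 2 = 1 := by linarith
    have hx : x ^ 2 ≤ 1 := by nlinarith [sq_nonneg y]
    have hx1 : x ≤ 1 := by nlinarith
    have hx2 : -1 ≤ x := by nlinarith
    refine key 0 1 1 (fun t => (144 - ((x + t * x) ^ 2 + (y + t * y) ^ 2)) *
      ((x + t * x - 4) ^ 2 + (y + t * y) ^ 2 - 1) * ((x + t * x + 4) ^ 2 + (y + t * y) ^ 2 - 1))
      (by fun_prop) ?_ (by linarith) (by norm_num) (by norm_num) fun t => by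
        simp only [outline, sub_zero]
        ring
    simp only [zero_mul, add_zero]
    have a1 : 144 - (x ^ 2 + y ^ 2) ≠ 0 := by linarith
    have a2 : (x - 4) ^ 2 + y ^ 2 - 1 ≠ 0 := by nlinarith
    have a3 : (x + 4) ^ 2 + y ^ 2 - 1 ≠ 0 := by nlinarith
    exact mul_ne_zero (mul_ne_zero a1 a2) a3
  · have e : (x - 4) ^ 2 + y ^ 2 = 1 := by linarith
    have hx : (x - 4) ^ 2 ≤ 1 := by nlinarith [sq_nonneg y]
    have hx1 : x - 4 ≤ 1 := by nlinarith
    have hx2 : -1 ≤ x - 4 := by nlinarith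
    refine key 4 1 1 (fun t => (144 - ((x + t * (x - 4)) ^ 2 + (y + t * y) ^ 2)) *
      ((x + t * (x - 4)) ^ 2 + (y + t * y) ^ 2 - 1) *
        ((x + t * (x - 4) + 4) ^ 2 + (y + t * y) ^ 2 - 1))
      (by fun_prop) ?_ (by linarith) (by norm_num) (by norm_num) fun t => by
        simp only [outline]
        ring
    simp only [zero_mul, add_zero]
    have a1 : 144 - (x ^ 2 + y ^ 2) ≠ 0 := by nlinarith
    have a2 : x ^ 2 + y ^ 2 - 1 ≠ 0 := by nlinarith
    have a3 : (x + 4) ^ 2 + y ^ 2 - 1 ≠ 0 := by nlinarith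
    exact mul_ne_zero (mul_ne_zero a1 a2) a3
  · have e : (x + 4) ^ 2 + y ^ 2 = 1 := by linarith
    have hx : (x + 4) ^ 2 ≤ 1 := by nlinarith [sq_nonneg y]
    have hx1 : x + 4 ≤ 1 := by nlinarith
    have hx2 : -1 ≤ x + 4 := by nlinarith
    refine key (-4) 1 1 (fun t => (144 - ((x + t * (x - -4)) ^ 2 + (y + t * y) ^ 2)) *
      ((x + t * (x - -4)) ^ 2 + (y + t * y) ^ 2 - 1) *
        ((x + t * (x - -4) - 4) ^ 2 + (y + t * y) ^ 2 - 1))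
      (by fun_prop) ?_ (by linarith) (by norm_num) (by norm_num) fun t => by
        simp only [outline]
        ring
    simp only [zero_mul, add_zero]
    have a1 : 144 - (x ^ 2 + y ^ 2) ≠ 0 := by nlinarith
    have a2 : x ^ 2 + y ^ 2 - 1 ≠ 0 := by nlinarith
    have a3 : (x - 4) ^ 2 + y ^ 2 - 1 ≠ 0 := by nlinarith
    exact mul_ne_zero (mul_ne_zero a1 a2) a3

/-- `0` is a regular value of `defFun`. -/
lemma fderiv_defFun_ne_zero (p : M) : fderiv ℝ defFun (p : E4) ≠ 0 := by
  intro h0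
  have hd : HasFDerivAt defFun (0 : E4 →L[ℝ] ℝ) (p : E4) := by
    rw [← h0]
    exact (contDiff_defFun.differentiable (by simp) _).hasFDerivAt
  have hline : ∀ (v : E4), HasDerivAt (fun t : ℝ => defFun ((p : E4) + t • v)) 0 0 := by
    intro v
    have h1 : HasDerivAt (fun t : ℝ => (p : E4) + t • v) v 0 := by
      simpa using ((hasDerivAt_id (0 : ℝ)).smul_const v).const_add (p : E4)
    have h2 : HasFDerivAt defFun (0 : E4 →L[ℝ] ℝ) ((p : E4) + (0 : ℝ) • v) := by simpa using hd
    simpa [Function.comp_def] using h2.comp_hasDerivAt (0 : ℝ) h1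
  obtain ⟨p, hp⟩ := p
  simp only at hline
  have hsq : ∀ a : ℝ, HasDerivAt (fun t : ℝ => (a + t) ^ 2) (2 * a) 0 := by
    intro a
    simpa using ((hasDerivAt_id (0 : ℝ)).const_add a).fun_pow 2
  -- At a critical point the derivatives `2z` and `2w` vanish, so the point lies over the boundary
  -- of the planar domain, where `outline` has a non-zero derivative.
  have e2 : p 2 = 0 := by
    have h1 := hline !₂[0, 0, 1, 0]
    have h2 : HasDerivAt (fun t : ℝ => defFun (p + t • !₂[0, 0, 1, 0])) (2 * p 2) 0 := by
      have := ((hsq (p 2)).add_const (p 3 ^ 2)).sub_const (outline (p 0) (p 1))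
      simpa [defFun] using this
    linarith [h1.unique h2]
  have e3 : p 3 = 0 := by
    have h1 := hline !₂[0, 0, 0, 1]
    have h2 : HasDerivAt (fun t : ℝ => defFun (p + t • !₂[0, 0, 0, 1])) (2 * p 3) 0 := by
      have := ((hsq (p 3)).const_add (p 2 ^ 2)).sub_const (outline (p 0) (p 1))
      simpa [defFun] using this
    linarith [h1.unique h2]
  have ho : outline (p 0) (p 1) = 0 := by
    have := hp
    rw [defFun, e2, e3] at this
    linarith
  obtain ⟨v, w, d, hvw, hd0⟩ := outline_hasDerivAt_ne_zero ho
  have h1 := hline !₂[v, w, 0, 0]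
  have h2 : HasDerivAt (fun t : ℝ => defFun (p + t • !₂[v, w, 0, 0])) (-d) 0 := by
    have := hvw.const_sub (p 2 ^ 2 + p 3 ^ 2)
    simpa [defFun] using this
  exact hd0 (by linarith [h1.unique h2])

/-- `M` is locally simply connected, in terms of classes of paths. -/
lemma exists_nhds_pathClass_eq (p : M) : ∃ V ∈ 𝓝 p, ∀ γ δ : C(I, M), (∀ u, γ u ∈ V) →
    (∀ u, δ u ∈ V) → γ 0 = δ 0 → γ 1 = δ 1 → pathClass γ = pathClass δ := by
  have hs : HasStrictFDerivAt defFun (fderiv ℝ defFun (p : E4)) (p : E4) :=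
    contDiff_defFun.contDiffAt.hasStrictFDerivAt (by simp)
  have hr : (fderiv ℝ defFun (p : E4)).range = ⊤ :=
    LinearMap.range_eq_top.mpr
      (LinearMap.surjective fun h => fderiv_defFun_ne_zero p (ContinuousLinearMap.coe_injective h))
  obtain ⟨U, hU, r, hrc, hrU⟩ := exists_local_retraction hs hr p.2
  obtain ⟨ε, hε, hball⟩ := Metric.mem_nhds_iff.mp hU
  refine ⟨Subtype.val ⁻¹' Metric.ball (p : E4) ε,
    continuous_subtype_val.continuousAt.preimage_mem_nhds (Metric.ball_mem_nhds _ hε), ?_⟩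
  intro γ δ hγ hδ h0 h1
  -- The straight-line homotopy in a ball of the ambient space, pushed to `M` by the local
  -- retraction, which fixes the points of `M`.
  let k : I × I → E4 := fun q => (γ q.2 : E4) + (q.1 : ℝ) • ((δ q.2 : E4) - γ q.2)
  have hk : ∀ q, k q ∈ Metric.ball (p : E4) ε := fun q =>
    (convex_ball (p : E4) ε).add_smul_sub_mem (hγ q.2) (hδ q.2) q.1.2
  have hkc : Continuous k := by fun_prop
  let H : C(I × I, M) := ⟨fun q => ⟨r (k q), (hrU _ (hball (hk q))).1⟩,
    (hrc.comp_continuous hkc fun q => hball (hk q)).subtype_mk _⟩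
  have hfix : ∀ (q : I × I) (m : M), k q = m → H q = m := fun q m hm =>
    Subtype.ext (by
      change r (k q) = m
      rw [hm]
      exact (hrU _ (hm ▸ hball (hk q))).2 m.2)
  refine pathClass_eq_of_homotopy H (γ 0) (γ 1) (fun s => hfix _ _ ?_) (fun s => hfix _ _ ?_) γ δ
    (fun u => hfix _ _ ?_) (fun u => hfix _ _ ?_)
  · simp [k, h0]
  · simp [k, h1]
  · simp [k]
  · simp [k]

/-! ### The cycles on a curve -/

section Cycles

/-- The path `g` runs in the image of `φ`, and `τ` is an arbitrary, possibly discontinuous, choice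
of parameters. Near `u₀` the path is homologous to an arc of the curve starting at some preimage of
`g u₀`. Passing to the chosen parameters costs only arcs with equal end values, which lie in the
submodule. -/
lemma segClass_local (φ : C(Circle, M)) (hfin : Submodule ℤ (Chains1 M))
    (hS : ∀ s t, φ (Circle.exp s) = φ (Circle.exp t) → arcClass φ s t ∈ hfin)
    (g : C(ℝ, M)) (τ : ℝ → ℝ) (hτ : ∀ u, φ (Circle.exp (τ u)) = g u) (u₀ : ℝ) :
    ∀ᶠ a in 𝓝 u₀, segClass g u₀ a - (arcClass φ 0 (τ a) - arcClass φ 0 (τ u₀)) ∈ hfin := by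
  obtain ⟨V, hV, hpath⟩ := exists_nhds_pathClass_eq (g u₀)
  -- The points reached from a preimage of `g u₀` by an arc whose image stays in `V`.
  let N : Set Circle := {v | ∃ t t' : ℝ, Circle.exp t' = v ∧ φ (Circle.exp t) = g u₀ ∧
    ∀ θ : I, φ (Circle.exp (t + (θ : ℝ) • (t' - t))) ∈ V}
  have hN : ∀ v, φ v = g u₀ → N ∈ 𝓝 v := by
    intro v hv
    obtain ⟨t, rfl⟩ := exists_angle v
    have hc : (fun r => φ (Circle.exp r)) ⁻¹' V ∈ 𝓝 t :=
      (φ.continuous.comp Circle.exp.continuous).continuousAt.preimage_mem_nhds (by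
        simpa [hv] using hV)
    obtain ⟨ε, hε, hball⟩ := Metric.mem_nhds_iff.mp hc
    have ho := Circle.isCoveringMap_exp.isOpenMap.image_mem_nhds (Metric.ball_mem_nhds t hε)
    refine Filter.mem_of_superset ho ?_
    rintro _ ⟨t', ht', rfl⟩
    exact ⟨t, t', rfl, hv, fun θ => hball
      ((convex_ball t ε).add_smul_sub_mem (Metric.mem_ball_self hε) ht' θ.2)⟩
  -- Compactness of the circle: points of the curve close to `g u₀` have all their preimages in `N`.
  have hK : IsClosed (φ '' (interior N)ᶜ) :=
    ((isOpen_interior.isClosed_compl.isCompact).image φ.continuous).isClosed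
  have hKy : (φ '' (interior N)ᶜ)ᶜ ∈ 𝓝 (g u₀) := by
    refine hK.isOpen_compl.mem_nhds ?_
    rintro ⟨v, hv, hvy⟩
    exact hv (mem_interior_iff_mem_nhds.mpr (hN v hvy))
  have hgc := g.continuous.continuousAt (x := u₀)
  obtain ⟨ε, hε, hball⟩ := Metric.mem_nhds_iff.mp
    (Filter.inter_mem (hgc.preimage_mem_nhds hKy) (hgc.preimage_mem_nhds hV))
  filter_upwards [Metric.ball_mem_nhds u₀ hε] with a ha
  have hvN : Circle.exp (τ a) ∈ N := by
    by_contra hn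
    exact (hball ha).1 ⟨_, fun h => hn (interior_subset h), hτ a⟩
  obtain ⟨t, t', ht', hty, hV'⟩ := hvN
  have e : segClass g u₀ a = arcClass φ t t' := by
    refine hpath _ _ (fun θ => ?_) hV' ?_ ?_
    · exact (hball ((convex_ball u₀ ε).add_smul_sub_mem (Metric.mem_ball_self hε) ha θ.2)).2
    · simp [segPath, angular, hty]
    · simp [segPath, angular, ht', hτ]
  have h1 := hS (τ u₀) t (by rw [hty, hτ])
  have h2 := hS t' (τ a) (by rw [ht'])
  have h3 : segClass g u₀ a - (arcClass φ 0 (τ a) - arcClass φ 0 (τ u₀)) =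
      -(arcClass φ (τ u₀) t + arcClass φ t' (τ a)) := by
    rw [e, ← arcClass_add φ 0 (τ u₀) (τ a), ← arcClass_add φ (τ u₀) t (τ a),
      ← arcClass_add φ t t' (τ a)]
    abel
  rw [h3]
  exact hfin.neg_mem (hfin.add_mem h1 h2)

/-- By the local statement, the set of those `b` for which the claim holds is open and closed in the
line, and it contains `a`. -/
lemma pathClass_sub_mem (φ : C(Circle, M)) (S : Submodule ℤ (Chains1 M))
    (hS : ∀ s t, φ (Circle.exp s) = φ (Circle.exp t) → arcClass φ s t ∈ S)
    (g : C(ℝ, M)) (τ : ℝ → ℝ) (hτ : ∀ u, φ (Circle.exp (τ u)) = g u) (a b : ℝ) :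
    segClass g a b - (arcClass φ 0 (τ b) - arcClass φ 0 (τ a)) ∈ S := by
  let G : Set ℝ := {b | segClass g a b - (arcClass φ 0 (τ b) - arcClass φ 0 (τ a)) ∈ S}
  have hloc : ∀ b, ∀ᶠ c in 𝓝 b, (c ∈ G ↔ b ∈ G) := by
    intro b
    filter_upwards [segClass_local φ S hS g τ hτ b] with c hc
    have e : segClass g a c - (arcClass φ 0 (τ c) - arcClass φ 0 (τ a)) =
        (segClass g a b - (arcClass φ 0 (τ b) - arcClass φ 0 (τ a))) +
        (segClass g b c - (arcClass φ 0 (τ c) - arcClass φ 0 (τ b))) := by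
      rw [← segClass_add g a b c]
      abel
    simp only [G, Set.mem_ofPred_eq]
    rw [e]
    exact S.add_mem_iff_left hc
  have hclopen : IsClopen G := by
    refine ⟨⟨?_⟩, ?_⟩
    · exact isOpen_iff_mem_nhds.mpr fun b hb => (hloc b).mono fun c hc h => hb (hc.mp h)
    · exact isOpen_iff_mem_nhds.mpr fun b hb => (hloc b).mono fun c hc => hc.mpr hb
  have hne : G.Nonempty := ⟨a, by simp [G, segClass_self]⟩
  have h : b ∈ G := by
    rw [hclopen.eq_univ hne]
    trivial
  exact h

/-- The subgroup generated by the cycles on a curve whose only self-intersections are the given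
ones, in terms of arcs. -/
theorem map_cycleSubgroup {i : ℕ} (x : Realization i)
    (hx : ∀ s t : Circle, x.1.2 s = x.1.2 t →
      s = t ∨ ∃ k, s(s, t) = s((x.1.1 k).1, (x.1.1 k).2)) :
    Submodule.map (ofH1 M) (cycleSubgroup x.1.2) = cycleSpan x.1 := by
  obtain ⟨⟨c, φ⟩, hr⟩ := x
  simp only at hx ⊢
  have hS : ∀ s t, φ (Circle.exp s) = φ (Circle.exp t) → arcClass φ s t ∈ cycleSpan (X := M) (c, φ) :=
    fun s t h => arcClass_mem_cycleSpan (X := M) (c, φ) (hx _ _ h)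
  let j : C(Set.range φ, M) := ⟨Subtype.val, continuous_subtype_val⟩
  apply le_antisymm
  · rintro _ ⟨_, ⟨z, rfl⟩, rfl⟩
    change ofH1 M ((H1.map (TopCat.ofHom j)).hom z) ∈ _
    rw [ofH1_naturality]
    -- A preimage and an angle for every point of the curve, with no continuity. The arc from angle
    -- `0` to it is the function of end points required by `map_ofH1_mem`.
    choose v hv using fun y : Set.range φ => y.2
    choose θ hθ using exists_angle
    refine map_ofH1_mem j _ (fun y => arcClass φ 0 (θ (v y))) (fun γ => ?_) z
    have h := pathClass_sub_mem φ _ hS (j.comp (extendPath γ)) (fun u => θ (v (extendPath γ u)))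
      (fun u => by rw [hθ, hv]; rfl) 0 1
    rw [← map_segClass, segClass_extendPath, map_pathClass] at h
    have e0 := extendPath_coe γ 0
    have e1 := extendPath_coe γ 1
    rw [Set.Icc.coe_zero] at e0
    rw [Set.Icc.coe_one] at e1
    rwa [e0, e1] at h
  · refine Submodule.span_le.mpr ?_
    rintro _ ⟨s, t, hst, rfl⟩
    have hst' : φ (Circle.exp s) = φ (Circle.exp t) := by
      rcases hst with h | ⟨k, h1, h2⟩
      · rw [h]
      · rw [h1, h2]
        exact hr.2 k
    -- Regarded as a curve in its own image, the closed arc is a cycle there, and its homology class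
    -- maps to the required arc class.
    let φ' : C(Circle, Set.range φ) := ⟨fun u => ⟨φ u, u, rfl⟩, by fun_prop⟩
    have hb : boundary _ (arcClass φ' s t) = 0 := by
      rw [arcClass, boundary_segClass, sub_eq_zero]
      exact congrArg pointClass (Subtype.ext hst'.symm)
    obtain ⟨z, hz⟩ := mem_range_ofH1 hb
    refine ⟨_, ⟨z, rfl⟩, ?_⟩
    change ofH1 M ((H1.map (TopCat.ofHom j)).hom z) = _
    rw [ofH1_naturality, hz]
    exact map_segClass j _ s t

end Cycles

lemma cycleSubgroup_eq_of_related {x y : Realization 2} (hx : IsGeneric x) (hy : IsGeneric y)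
    (h : Related (route x) (route y)) : cycleSubgroup x.1.2 = cycleSubgroup y.1.2 := by
  refine Submodule.map_injective_of_injective ofH1_injective ?_
  rw [map_cycleSubgroup x hx.2.1, map_cycleSubgroup y hy.2.1]
  exact routeSpan_related h

lemma submoduleRank_map {R : Type*} {A B : Type} [CommRing R] [AddCommGroup A] [Module R A] [AddCommGroup B]
    [Module R B] (f : A →ₗ[R] B) (hf : Function.Injective f) (S : Submodule R A) :
    submoduleRank (S.map f) = submoduleRank S :=
  (Submodule.equivMapOfInjective f hf S).rank_eq.symm

lemma rank_cycleSubgroup {x : Realization 2} (hx : IsGeneric x) :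
    Module.rank ℤ (cycleSubgroup x.1.2) = submoduleRank (cycleSpan x.1) := by
  rw [← map_cycleSubgroup x hx.2.1, ← submoduleRank_eq]
  exact (submoduleRank_map (ofH1 M) ofH1_injective _).symm

end KnotSS

end

noncomputable section

namespace KnotSS

/-! ### Variation of the logarithm -/

section LogVariation

/-- The punctured plane. -/
abbrev PuncturedPlane : Type := {z : ℂ // z ≠ 0}

/-- Homotopy lifting along the covering `exp`, starting from a constant logarithm. Applied to a
contraction of `S`, it produces a logarithm on `S`. -/
lemma exists_log_lift {S : Type} [TopologicalSpace S] (H : C(I × S, PuncturedPlane))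
    (w : PuncturedPlane) (h0 : ∀ x, H (0, x) = w) : ∃ L : C(S, ℂ), ∀ x, Complex.exp (L x) = H (1, x) := by
  have hw : ∀ x, H (0, x) = ⟨Complex.exp (Complex.log w), Complex.exp_ne_zero _⟩ := fun x => by
    rw [h0]
    exact Subtype.ext (Complex.exp_log w.2).symm
  let K := Complex.isCoveringMap_exp.liftHomotopy H (ContinuousMap.const S (Complex.log w)) hw
  have hK : ∀ q, Complex.exp (K q) = H q := fun q => congrArg Subtype.val
    (congrFun (Complex.isCoveringMap_exp.liftHomotopy_lifts H _ hw) q)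
  exact ⟨⟨fun x => K (1, x), by fun_prop⟩, fun x => hK (1, x)⟩

lemma exists_log_lift_path (γ : C(I, PuncturedPlane)) :
    ∃ L : C(I, ℂ), ∀ u, Complex.exp (L u) = γ u := by
  obtain ⟨L, hL⟩ := exists_log_lift (S := I) (γ.comp ⟨fun q : I × I => q.1 * q.2, by fun_prop⟩) (γ 0)
    (fun x => by simp)
  exact ⟨L, fun u => by simpa using hL u⟩

lemma exists_log_lift_triangle (h : C(stdSimplex ℝ (Fin 3), PuncturedPlane)) :
    ∃ L : C(stdSimplex ℝ (Fin 3), ℂ), ∀ x, Complex.exp (L x) = h x := by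
  let v : stdSimplex ℝ (Fin 3) := stdSimplex.vertex 0
  let k : C(I × stdSimplex ℝ (Fin 3), stdSimplex ℝ (Fin 3)) :=
    ⟨fun q => ⟨(v : Fin 3 → ℝ) + (q.1 : ℝ) • ((q.2 : Fin 3 → ℝ) - v),
      (convex_stdSimplex ℝ (Fin 3)).add_smul_sub_mem v.2 q.2.2 q.1.2⟩, by fun_prop⟩
  have k0 : ∀ x, k (0, x) = v := fun x => Subtype.ext (by simp only [k]; simp; rfl)
  have k1 : ∀ x, k (1, x) = x := fun x => Subtype.ext (by simp only [k]; simp; rfl)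
  obtain ⟨L, hL⟩ := exists_log_lift (h.comp k) (h v) (fun x => by simp [k0])
  exact ⟨L, fun x => by simpa [k1] using hL x⟩

/-- After a constant shift both functions lift the same path from the same starting value. The
factor `k` makes it possible to rotate the plane before using the principal logarithm. -/
lemma log_variation_unique (γ : C(I, PuncturedPlane)) (k : ℂ) (hk : k ≠ 0) (L L' : C(I, ℂ))
    (hL : ∀ u, Complex.exp (L u) = γ u) (hL' : ∀ u, Complex.exp (L' u) = k * γ u) :
    L' 1 - L' 0 = L 1 - L 0 := by
  let L'' : C(I, ℂ) := ⟨fun u => L' u + (L 0 - L' 0), by fun_prop⟩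
  have e : ∀ u, Complex.exp (L'' u) = γ u := by
    intro u
    have h1 : (γ 0 : ℂ) ≠ 0 := (γ 0).2
    change Complex.exp (L' u + (L 0 - L' 0)) = _
    rw [Complex.exp_add, Complex.exp_sub, hL', hL', hL]
    field_simp
  have h0 : γ 0 = (⟨Complex.exp (L 0), Complex.exp_ne_zero _⟩ : PuncturedPlane) :=
    Subtype.ext (hL 0).symm
  have e1 := (Complex.isCoveringMap_exp.eq_liftPath_iff' (γ := γ) (e := L 0) (γ_0 := h0) (Γ := L)).mpr
    ⟨funext fun u => Subtype.ext (hL u), rfl⟩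
  have e2 := (Complex.isCoveringMap_exp.eq_liftPath_iff' (γ := γ) (e := L 0) (γ_0 := h0) (Γ := L'')).mpr
    ⟨funext fun u => Subtype.ext (e u), by simp [L'']⟩
  have e3 : L'' 1 = L 1 := by rw [e2, ← e1]
  change L' 1 + (L 0 - L' 0) = L 1 at e3
  linear_combination e3

variable {X : Type} [TopologicalSpace X]

/-- The variation of the logarithm of a function, as a homomorphism on chains modulo boundaries. -/
lemma exists_log_variation (f : C(X, PuncturedPlane)) : ∃ W : Chains1 X →ₗ[ℤ] ℂ,
    ∀ (γ : C(I, X)) (L : C(I, ℂ)) (k : ℂ), k ≠ 0 → (∀ u, Complex.exp (L u) = k * f (γ u)) →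
      W (pathClass γ) = L 1 - L 0 := by
  choose ℓ hℓ using exists_log_lift_path
  obtain ⟨W, hW⟩ := exists_chains1_hom (X := X) (A := ℂ)
    (fun γ => ℓ (f.comp γ) 1 - ℓ (f.comp γ) 0) (fun h => by
      obtain ⟨L, hL⟩ := exists_log_lift_triangle (f.comp h)
      -- A logarithm on the whole triangle turns the variation along a side into a difference of
      -- values at the vertices, hence additivity.
      have key : ∀ i j, ℓ (f.comp (h.comp (triangleSide i j))) 1 -
          ℓ (f.comp (h.comp (triangleSide i j))) 0 =
          L (stdSimplex.vertex j) - L (stdSimplex.vertex i) := by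
        intro i j
        have e := log_variation_unique (f.comp (h.comp (triangleSide i j))) 1 one_ne_zero
          (ℓ (f.comp (h.comp (triangleSide i j)))) (L.comp (triangleSide i j)) (hℓ _)
          (fun u => by simpa using hL (triangleSide i j u))
        have t0 : triangleSide i j 0 = stdSimplex.vertex i :=
          (congrArg _ (stdSimplexHomeomorphUnitInterval.symm_apply_eq.mpr
            stdSimplexHomeomorphUnitInterval_zero.symm)).trans (stdSimplex.map_vertex ![i, j] 0)
        have t1 : triangleSide i j 1 = stdSimplex.vertex j :=
          (congrArg _ (stdSimplexHomeomorphUnitInterval.symm_apply_eq.mpr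
            stdSimplexHomeomorphUnitInterval_one.symm)).trans (stdSimplex.map_vertex ![i, j] 1)
        rw [← e]
        simp [t0, t1]
      rw [key, key, key]
      ring)
  exact ⟨W, fun γ L k hk hL => by
    rw [hW]
    exact (log_variation_unique (f.comp γ) k hk _ L (hℓ _) hL).symm⟩

/-- The variation of the logarithm along an arc of a curve. -/
lemma exists_log_variation_arc (f : C(X, PuncturedPlane)) : ∃ W : Chains1 X →ₗ[ℤ] ℂ,
    ∀ (φ : C(Circle, X)) (s t : ℝ) (L : ℝ → ℂ) (k : ℂ), s ≤ t → k ≠ 0 →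
      ContinuousOn L (Set.Icc s t) →
      (∀ r ∈ Set.Icc s t, Complex.exp (L r) = k * f (φ (Circle.exp r))) →
      W (arcClass φ s t) = L t - L s := by
  obtain ⟨W, hW⟩ := exists_log_variation f
  refine ⟨W, fun φ s t L k hst hk hc hL => ?_⟩
  have hmem : ∀ u : I, s + (u : ℝ) * (t - s) ∈ Set.Icc s t := fun u =>
    ⟨by nlinarith [u.2.1], by nlinarith [u.2.2]⟩
  have := hW (segPath (angular φ) s t) ⟨fun u : I => L (s + (u : ℝ) * (t - s)),
    hc.comp_continuous (by fun_prop) hmem⟩ k hk (fun u => hL _ (hmem u))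
  simpa [arcClass, segClass] using this

end LogVariation

/-! ### The rank for the curve -/

/-- The projection of `M` to the plane. -/
def planar (p : M) : ℂ := ⟨(p : E4) 0, (p : E4) 1⟩

lemma continuous_planar : Continuous planar := by
  have e : planar = fun p : M => (((p : E4) 0 : ℝ) : ℂ) + (((p : E4) 1 : ℝ) : ℂ) * Complex.I := by
    funext p
    apply Complex.ext <;> simp [planar]
  rw [e]
  fun_prop

lemma planar_figCurve (u : Circle) : planar (figCurve u) = planeCurve u := by
  apply Complex.ext <;> simp [planar, figCurve]

lemma outline_nonneg (p : M) : 0 ≤ outline ((p : E4) 0) ((p : E4) 1) := by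
  have h := p.2
  unfold defFun at h
  nlinarith [sq_nonneg ((p : E4) 2), sq_nonneg ((p : E4) 3)]

lemma planar_ne {c : ℝ} (hc : outline c 0 < 0) (p : M) : planar p - c ≠ 0 := by
  intro h
  have h1 := congrArg Complex.re h
  have h2 := congrArg Complex.im h
  simp [planar] at h1 h2
  have := outline_nonneg p
  rw [h2, sub_eq_zero.mp h1] at this
  linarith

/-- The angle of the end of the right loop. -/
def loopAngle : ℝ := Real.arcsin (Real.sqrt (3 / 8))

lemma sqrt_three_eighths : 0 < Real.sqrt (3 / 8) ∧ Real.sqrt (3 / 8) < 1 :=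
  ⟨by positivity, by rw [Real.sqrt_lt' one_pos]; norm_num⟩

lemma sin_loopAngle : Real.sin loopAngle = Real.sqrt (3 / 8) :=
  Real.sin_arcsin (by linarith [sqrt_three_eighths.1]) sqrt_three_eighths.2.le

lemma cos_loopAngle : Real.cos loopAngle = Real.sqrt (5 / 8) := by
  rw [loopAngle, Real.cos_arcsin, Real.sq_sqrt (by norm_num)]
  norm_num

lemma loopAngle_pos : 0 < loopAngle := Real.arcsin_pos.mpr sqrt_three_eighths.1

lemma loopAngle_lt : loopAngle < Real.pi / 2 := Real.arcsin_lt_pi_div_two.mpr sqrt_three_eighths.2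

lemma circle_ext {u v : Circle} (h1 : (u : ℂ).re = (v : ℂ).re) (h2 : (u : ℂ).im = (v : ℂ).im) :
    u = v := Circle.ext (Complex.ext h1 h2)

lemma exp_re (t : ℝ) : ((Circle.exp t : Circle) : ℂ).re = Real.cos t := by
  simp [Circle.coe_exp, Complex.exp_ofReal_mul_I_re]

lemma exp_im (t : ℝ) : ((Circle.exp t : Circle) : ℂ).im = Real.sin t := by
  simp [Circle.coe_exp, Complex.exp_ofReal_mul_I_im]

/-- The angles of the first ends of the chords. -/
def chordStart : Fin 2 → ℝ := ![-loopAngle, Real.pi - loopAngle]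

/-- The angles of the second ends of the chords. -/
def chordEnd : Fin 2 → ℝ := ![loopAngle, Real.pi + loopAngle]

lemma exp_chords (k : Fin 2) :
    (Circle.exp (chordStart k), Circle.exp (chordEnd k)) = figChords k := by
  have hd : ∀ t : ℝ, (Circle.exp t : ℂ) = ⟨Real.cos t, Real.sin t⟩ := fun t =>
    Complex.ext (exp_re t) (exp_im t)
  fin_cases k <;> refine Prod.ext (circle_ext ?_ ?_) (circle_ext ?_ ?_) <;>
    simp only [chordStart, chordEnd, figChords, hd, circlePoint, Fin.zero_eta, Fin.mk_one,
      Matrix.cons_val_zero, Matrix.cons_val_one, Real.cos_neg, Real.sin_neg, sin_loopAngle,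
      cos_loopAngle, Real.cos_pi_sub, Real.sin_pi_sub, add_comm Real.pi, Real.cos_add_pi,
      Real.sin_add_pi]

lemma planeCurve_exp_re (t : ℝ) :
    (planeCurve (Circle.exp t)).re = 18 * Real.cos t - 16 * Real.cos t ^ 3 := by
  rw [planeCurve_re, exp_re]

lemma planeCurve_exp_im (t : ℝ) :
    (planeCurve (Circle.exp t)).im = 16 * Real.sin t ^ 3 - 6 * Real.sin t := by
  rw [planeCurve_im, exp_im]

lemma sin_sq_le_of_abs_le {t : ℝ} (h1 : -loopAngle ≤ t) (h2 : t ≤ loopAngle) :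
    Real.sin t ^ 2 ≤ 3 / 8 ∧ 0 < Real.cos t := by
  have hl := loopAngle_lt
  have s1 : Real.sin t ≤ Real.sin loopAngle :=
    Real.sin_le_sin_of_le_of_le_pi_div_two (by linarith) (by linarith) h2
  have s2 : Real.sin (-loopAngle) ≤ Real.sin t :=
    Real.sin_le_sin_of_le_of_le_pi_div_two (by linarith) (by linarith) h1
  rw [Real.sin_neg] at s2
  rw [sin_loopAngle] at s1 s2
  have hq : Real.sqrt (3 / 8) ^ 2 = 3 / 8 := Real.sq_sqrt (by norm_num)
  exact ⟨by rw [← hq]; exact sq_le_sq' s2 s1,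
    Real.cos_pos_of_mem_Ioo ⟨by linarith, by linarith⟩⟩

/-- The polynomial `6u - 4u³` is odd; this symmetry carries the right loop to the left one. -/
lemma planeCurve_exp_add_pi (t : ℝ) :
    planeCurve (Circle.exp (Real.pi + t)) = -planeCurve (Circle.exp t) := by
  apply Complex.ext
  · rw [Complex.neg_re, planeCurve_exp_re, planeCurve_exp_re, Real.cos_add]
    simp
    ring
  · rw [Complex.neg_im, planeCurve_exp_im, planeCurve_exp_im, Real.sin_add]
    simp
    ring

lemma continuous_planeCurve_exp : Continuous fun t : ℝ => planeCurve (Circle.exp t) := by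
  unfold planeCurve
  fun_prop

/-- Multiplication by `-i` takes the closed upper half-plane without `0` into the slit plane, so one
principal branch serves for the whole half turn. -/
lemma log_half_turn {z : ℝ → ℂ} {s t : ℝ} (hz : Continuous z)
    (hne : ∀ r ∈ Set.Icc s t, z r ≠ 0) (him : ∀ r ∈ Set.Icc s t, 0 ≤ (z r).im) {a b : ℝ}
    (ha : 0 < a) (hb : 0 < b) (hs : z s = a) (ht : z t = -b) :
    ContinuousOn (fun r => Complex.log (-Complex.I * z r)) (Set.Icc s t) ∧
      (∀ r ∈ Set.Icc s t, Complex.exp (Complex.log (-Complex.I * z r)) = -Complex.I * z r) ∧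
      Complex.log (-Complex.I * z t) - Complex.log (-Complex.I * z s) =
        Real.log b - Real.log a + Real.pi * Complex.I := by
  refine ⟨fun r hr => ?_, fun r hr => Complex.exp_log (by simpa using hne r hr), ?_⟩
  · refine ContinuousAt.continuousWithinAt (ContinuousAt.clog (by fun_prop) ?_)
    rw [Complex.mem_slitPlane_iff]
    by_cases h0 : (z r).im = 0
    · right
      simp only [neg_mul, Complex.neg_im, Complex.mul_im, Complex.I_re, Complex.I_im, zero_mul,
        one_mul, zero_add]
      exact neg_ne_zero.mpr fun h => hne r hr (Complex.ext h h0)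
    · left
      simp only [neg_mul, Complex.neg_re, Complex.mul_re, Complex.I_re, Complex.I_im, zero_mul,
        one_mul, zero_sub, neg_neg]
      exact lt_of_le_of_ne (him r hr) (Ne.symm h0)
  · rw [hs, ht, mul_comm (-Complex.I), mul_comm (-Complex.I), neg_mul_neg,
      Complex.log_ofReal_mul hb Complex.I_ne_zero,
      Complex.log_ofReal_mul ha (neg_ne_zero.mpr Complex.I_ne_zero), Complex.log_I,
      Complex.log_neg_I]
    ring

lemma log_half_plane {z : ℝ → ℂ} {s t : ℝ} (hz : Continuous z)
    (hre : ∀ r ∈ Set.Icc s t, 0 < (z r).re) :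
    ContinuousOn (fun r => Complex.log (z r)) (Set.Icc s t) ∧
      ∀ r ∈ Set.Icc s t, Complex.exp (Complex.log (z r)) = z r := by
  refine ⟨fun r hr => ?_, fun r hr => Complex.exp_log fun h => ?_⟩
  · exact ContinuousAt.continuousWithinAt (ContinuousAt.clog (by fun_prop) (.inl (hre r hr)))
  · have := hre r hr
    rw [h] at this
    exact lt_irrefl _ this

/-- The function `planar - c`, with values in the punctured plane. -/
def planarFrom (c : ℝ) (hc : outline c 0 < 0) : C(M, PuncturedPlane) :=
  ⟨fun p => ⟨planar p - c, planar_ne hc p⟩, (continuous_planar.sub continuous_const).subtype_mk _⟩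

lemma planarFrom_figCurve (c : ℝ) (hc : outline c 0 < 0) (t : ℝ) :
    ((planarFrom c hc (figCurve (Circle.exp t)) : PuncturedPlane) : ℂ) =
      planeCurve (Circle.exp t) - c := by
  simp [planarFrom, planar_figCurve]

lemma planeCurve_exp_loopAngle :
    planeCurve (Circle.exp loopAngle) = (8 * Real.sqrt (5 / 8) : ℝ) ∧
    planeCurve (Circle.exp (-loopAngle)) = (8 * Real.sqrt (5 / 8) : ℝ) := by
  have q5 : Real.sqrt (5 / 8) ^ 2 = 5 / 8 := Real.sq_sqrt (by norm_num)
  have q3 : Real.sqrt (3 / 8) ^ 2 = 3 / 8 := Real.sq_sqrt (by norm_num)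
  constructor <;> apply Complex.ext
  · rw [planeCurve_exp_re, cos_loopAngle, Complex.ofReal_re]
    linear_combination (-16 * Real.sqrt (5 / 8)) * q5
  · rw [planeCurve_exp_im, sin_loopAngle, Complex.ofReal_im]
    linear_combination (16 * Real.sqrt (3 / 8)) * q3
  · rw [planeCurve_exp_re, Real.cos_neg, cos_loopAngle, Complex.ofReal_re]
    linear_combination (-16 * Real.sqrt (5 / 8)) * q5
  · rw [planeCurve_exp_im, Real.sin_neg, sin_loopAngle, Complex.ofReal_im]
    linear_combination (-16 * Real.sqrt (3 / 8)) * q3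

lemma planeCurve_exp_zero : planeCurve (Circle.exp 0) = 2 := by
  simp [planeCurve]
  norm_num

lemma half_lt_sqrt : 1 / 2 < Real.sqrt (5 / 8) :=
  Real.lt_sqrt_of_sq_lt (by norm_num)

/-- The variations of logarithms along the loop around a hole: about the center of this hole, and
about a center separated from the loop by the vertical axis. -/
lemma log_variation_loops : ∀ (c : ℝ) (hc : outline c 0 < 0) (W : Chains1 M →ₗ[ℤ] ℂ),
    (∀ (φ : C(Circle, M)) (s t : ℝ) (L : ℝ → ℂ) (k : ℂ), s ≤ t → k ≠ 0 →
      ContinuousOn L (Set.Icc s t) →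
      (∀ r ∈ Set.Icc s t, Complex.exp (L r) = k * planarFrom c hc (φ (Circle.exp r))) →
      W (arcClass φ s t) = L t - L s) → ∀ (o e : ℝ), (∀ t, planeCurve (Circle.exp (o + t)) =
        e * planeCurve (Circle.exp t)) → e * e = 1 →
      (e * c ≤ 0 → W (arcClass figCurve (o - loopAngle) (o + loopAngle)) = 0) ∧
      (e * c = 4 → W (arcClass figCurve (o - loopAngle) (o + loopAngle)) =
        2 * Real.pi * Complex.I) := by
  intro c hc W hW o e ho he
  have hl := loopAngle_pos
  -- The ordinate is `2 sin t (8 sin² t - 3)`, opposite in sign to `sin t` as long as `sin² t ≤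
  -- 3/8`.
  have hy : ∀ t, -loopAngle ≤ t → t ≤ loopAngle →
      0 ≤ -(Real.sin t) * (planeCurve (Circle.exp t)).im := by
    intro t h1 h2
    rw [planeCurve_exp_im]
    nlinarith [sq_nonneg (Real.sin t), (sin_sq_le_of_abs_le h1 h2).1,
      mul_nonneg (sq_nonneg (Real.sin t)) (sub_nonneg.mpr (sin_sq_le_of_abs_le h1 h2).1)]
  have heC : (e : ℂ) * e = 1 := by exact_mod_cast he
  have he0 : (e : ℂ) ≠ 0 := fun h => by simp [h] at heC
  -- Multiplication by `e = ±1` carries the loop based at `o` to the right loop and the center `c`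
  -- to `e c`, so both loops are treated at once.
  have hval : ∀ r, (e : ℂ) * (planarFrom c hc (figCurve (Circle.exp r)) : PuncturedPlane) =
      planeCurve (Circle.exp (r - o)) - (e * c : ℝ) := by
    intro r
    rw [planarFrom_figCurve, show r = o + (r - o) by ring, ho]
    push_cast
    rw [add_sub_cancel_left]
    linear_combination planeCurve (Circle.exp (r - o)) * heC
  have hz : Continuous fun r : ℝ => planeCurve (Circle.exp (r - o)) - (e * c : ℝ) :=
    (continuous_planeCurve_exp.comp (continuous_id.sub continuous_const)).sub continuous_const
  have hne : ∀ r, planeCurve (Circle.exp (r - o)) - (e * c : ℝ) ≠ 0 := fun r => by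
    rw [← hval]
    exact mul_ne_zero he0 (planarFrom c hc (figCurve (Circle.exp r))).2
  constructor
  · intro hec
    -- The abscissa `cos t (18 - 16 cos² t)` is positive on the right loop, so one branch of the
    -- logarithm suffices; its end values agree as the loop is closed.
    have hre : ∀ r ∈ Set.Icc (o - loopAngle) (o + loopAngle),
        0 < (planeCurve (Circle.exp (r - o)) - (e * c : ℝ)).re := by
      intro r hr
      have h := sin_sq_le_of_abs_le (t := r - o) (by linarith [hr.1]) (by linarith [hr.2])
      rw [Complex.sub_re, Complex.ofReal_re, planeCurve_exp_re]
      have h2 := Real.sin_sq_add_cos_sq (r - o)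
      nlinarith [mul_pos h.2 (by nlinarith : 0 < 18 - 16 * Real.cos (r - o) ^ 2)]
    obtain ⟨h1, h2⟩ := log_half_plane hz hre
    rw [hW figCurve _ _ _ e (by linarith) he0 h1 (fun r hr => by rw [hval]; exact h2 r hr)]
    rw [add_sub_cancel_left, show o - loopAngle - o = -loopAngle by ring,
      planeCurve_exp_loopAngle.1, planeCurve_exp_loopAngle.2, sub_self]
  · intro hec
    have h5 := half_lt_sqrt
    have ends1 : planeCurve (Circle.exp (o - loopAngle - o)) - (e * c : ℝ) =
        (8 * Real.sqrt (5 / 8) - 4 : ℝ) := by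
      rw [show o - loopAngle - o = -loopAngle by ring, planeCurve_exp_loopAngle.2, hec]
      push_cast
      ring
    have ends2 : planeCurve (Circle.exp (o + loopAngle - o)) - (e * c : ℝ) =
        (8 * Real.sqrt (5 / 8) - 4 : ℝ) := by
      rw [add_sub_cancel_left, planeCurve_exp_loopAngle.1, hec]
      push_cast
      ring
    have mid : planeCurve (Circle.exp (o - o)) - (e * c : ℝ) = -(2 : ℝ) := by
      rw [sub_self, planeCurve_exp_zero, hec]
      push_cast
      ring
    -- Relative to the center `4`, the loop goes from `8√(5/8) - 4 > 0` through the upper half-plane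
    -- to `-2`, and back through the lower one. The second half is negated to apply the same lemma;
    -- the real parts cancel and the total is `2πi`.
    obtain ⟨a1, a2, a3⟩ := log_half_turn (s := o - loopAngle) (t := o) hz
      (fun r _ => hne r) (fun r hr => by
        have h := hy (r - o) (by linarith [hr.1]) (by linarith [hr.2])
        have hs : Real.sin (r - o) ≤ 0 := Real.sin_nonpos_of_nonpos_of_neg_pi_le
          (by linarith [hr.2]) (by linarith [hr.1, loopAngle_lt, Real.pi_pos])
        rw [Complex.sub_im, Complex.ofReal_im, sub_zero]
        rcases hs.lt_or_eq with hs | hs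
        · exact nonneg_of_mul_nonneg_right h (by linarith)
        · rw [planeCurve_exp_im, hs]
          norm_num) (by linarith) two_pos ends1 mid
    obtain ⟨b1, b2, b3⟩ := log_half_turn (z := fun r => -(planeCurve (Circle.exp (r - o)) -
        (e * c : ℝ))) (s := o) (t := o + loopAngle) hz.neg
      (fun r _ => neg_ne_zero.mpr (hne r)) (fun r hr => by
        have h := hy (r - o) (by linarith [hr.1]) (by linarith [hr.2])
        have hs : 0 ≤ Real.sin (r - o) := Real.sin_nonneg_of_nonneg_of_le_pi
          (by linarith [hr.1]) (by linarith [hr.2, loopAngle_lt, Real.pi_pos])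
        rw [Complex.neg_im, Complex.sub_im, Complex.ofReal_im, sub_zero]
        rcases hs.lt_or_eq with hs | hs
        · nlinarith
        · rw [planeCurve_exp_im, ← hs]
          norm_num) two_pos (b := 8 * Real.sqrt (5 / 8) - 4) (by linarith)
      (by simp only [mid, neg_neg]) (by simp only [ends2])
    have w1 := hW figCurve _ _ _ (-Complex.I * e) (by linarith)
      (mul_ne_zero (neg_ne_zero.mpr Complex.I_ne_zero) he0) a1
      (fun r hr => by rw [mul_assoc, hval]; exact a2 r hr)
    have w2 := hW figCurve _ _ _ (Complex.I * e) (by linarith)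
      (mul_ne_zero Complex.I_ne_zero he0) b1
      (fun r hr => by rw [mul_assoc, hval]; exact (b2 r hr).trans (neg_mul_neg _ _))
    rw [a3] at w1
    rw [b3] at w2
    rw [← arcClass_add figCurve _ o, map_add, w1, w2]
    ring

lemma planeCurve_exp_pi_add (t : ℝ) :
    planeCurve (Circle.exp (Real.pi + t)) = ((-1 : ℝ) : ℂ) * planeCurve (Circle.exp t) := by
  rw [planeCurve_exp_add_pi]
  simp

/-- The winding number about `0` is `1` for the whole curve and `0` for the small loops; the winding
number about each outer center detects exactly one of the two loops. The resulting system is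
triangular. -/
lemma linearIndependent_arcs : LinearIndependent ℤ ![arcClass figCurve 0 (2 * Real.pi),
    arcClass figCurve (chordStart 0) (chordEnd 0), arcClass figCurve (chordStart 1) (chordEnd 1)] := by
  have c0 : outline 0 0 < 0 := by norm_num [outline]
  have c4 : outline 4 0 < 0 := by norm_num [outline]
  have c4' : outline (-4) 0 < 0 := by norm_num [outline]
  obtain ⟨W0, hW0⟩ := exists_log_variation_arc (planarFrom 0 c0)
  obtain ⟨W4, hW4⟩ := exists_log_variation_arc (planarFrom 4 c4)
  obtain ⟨W4', hW4'⟩ := exists_log_variation_arc (planarFrom (-4) c4')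
  have hid : ∀ t, planeCurve (Circle.exp (0 + t)) = ((1 : ℝ) : ℂ) * planeCurve (Circle.exp t) := by
    intro t
    simp
  have r0 := (log_variation_loops 0 c0 W0 hW0 0 1 hid (by norm_num)).1 (by norm_num)
  have r4 := (log_variation_loops 4 c4 W4 hW4 0 1 hid (by norm_num)).2 (by norm_num)
  have r4' := (log_variation_loops (-4) c4' W4' hW4' 0 1 hid (by norm_num)).1 (by norm_num)
  have l0 := (log_variation_loops 0 c0 W0 hW0 _ _ planeCurve_exp_pi_add (by norm_num)).1
    (by norm_num)
  have l4 := (log_variation_loops 4 c4 W4 hW4 _ _ planeCurve_exp_pi_add (by norm_num)).1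
    (by norm_num)
  have l4' := (log_variation_loops (-4) c4' W4' hW4' _ _ planeCurve_exp_pi_add (by norm_num)).2
    (by norm_num)
  rw [zero_sub, zero_add] at r0 r4 r4'
  change W0 (arcClass figCurve (chordStart 0) (chordEnd 0)) = 0 at r0
  change W4 (arcClass figCurve (chordStart 0) (chordEnd 0)) = 2 * Real.pi * Complex.I at r4
  change W4' (arcClass figCurve (chordStart 0) (chordEnd 0)) = 0 at r4'
  change W0 (arcClass figCurve (chordStart 1) (chordEnd 1)) = 0 at l0
  change W4 (arcClass figCurve (chordStart 1) (chordEnd 1)) = 0 at l4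
  change W4' (arcClass figCurve (chordStart 1) (chordEnd 1)) = 2 * Real.pi * Complex.I at l4'
  -- Factor `6u - 4u³ = u (6 - 4u²)`. The second factor stays in the right half-plane, so all the
  -- variation comes from `u`.
  have t0 : W0 (arcClass figCurve 0 (2 * Real.pi)) = 2 * Real.pi * Complex.I := by
    have hre : ∀ r ∈ Set.Icc (0 : ℝ) (2 * Real.pi),
        0 < (6 - 4 * ((Circle.exp r : Circle) : ℂ) ^ 2).re := by
      intro r _
      have e : (6 - 4 * ((Circle.exp r : Circle) : ℂ) ^ 2).re =
          6 - 4 * (Real.cos r ^ 2 - Real.sin r ^ 2) := by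
        simp [pow_two, Complex.exp_ofReal_mul_I_re, Complex.exp_ofReal_mul_I_im]
      rw [e]
      nlinarith [Real.sin_sq_add_cos_sq r, sq_nonneg (Real.sin r)]
    obtain ⟨h1, h2⟩ := log_half_plane (by fun_prop) hre
    have := hW0 figCurve 0 (2 * Real.pi)
      (fun r => r * Complex.I + Complex.log (6 - 4 * ((Circle.exp r : Circle) : ℂ) ^ 2)) 1
      (by positivity) one_ne_zero (ContinuousOn.add (by fun_prop) h1) (fun r hr => by
        rw [Complex.exp_add, h2 r hr, planarFrom_figCurve, ← Circle.coe_exp, planeCurve]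
        push_cast
        ring)
    rw [this]
    simp
  have hpi : (2 * Real.pi * Complex.I : ℂ) ≠ 0 := Complex.two_pi_I_ne_zero
  rw [Fintype.linearIndependent_iff]
  intro g hg
  rw [Fin.sum_univ_three] at hg
  have g0 := congrArg W0 hg
  have g4 := congrArg W4 hg
  have g4' := congrArg W4' hg
  simp only [map_add, map_smul, map_zero, Matrix.cons_val, t0, r0, r4, r4', l0, l4, l4', smul_zero,
    add_zero] at g0 g4 g4'
  have h0 : g 0 = 0 := by simpa [hpi] using g0
  -- The coefficient of the whole curve is already zero, so its winding about the outer centers need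
  -- not be computed.
  rw [h0] at g4 g4'
  have h1 : g 1 = 0 := by simpa [hpi] using g4
  have h2 : g 2 = 0 := by simpa [hpi] using g4'
  intro i
  fin_cases i <;> assumption

lemma submoduleRank_fig : submoduleRank (cycleSpan fig.1) = 3 := by
  rw [cycleSpan_eq_span fig.1 chordStart chordEnd (fun k => by
    change _ = s((figChords k).1, (figChords k).2)
    rw [← exp_chords])]
  have e : insert (arcClass fig.1.2 0 (2 * Real.pi))
      (Set.range fun k => arcClass fig.1.2 (chordStart k) (chordEnd k)) =
      Set.range ![arcClass figCurve 0 (2 * Real.pi),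
        arcClass figCurve (chordStart 0) (chordEnd 0),
        arcClass figCurve (chordStart 1) (chordEnd 1)] := by
    ext q
    simp [Fin.exists_fin_two, eq_comm, fig]
    tauto
  rw [e, submoduleRank, rank_span linearIndependent_arcs,
    Cardinal.mk_range_eq _ linearIndependent_arcs.injective]
  simp

end KnotSS

end

noncomputable section

namespace KnotSS

/-! ### A loop of curves -/

section Family

/-- The abscissa of `planeCurve`. -/
def xPlane (c : ℝ) : ℝ := 18 * c - 16 * c ^ 3

/-- The ordinate of `planeCurve`. -/
def yPlane (s : ℝ) : ℝ := 16 * s ^ 3 - 6 * s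

/-- The power of the points of `planeCurve` with respect to the left hole. -/
def leftPower (c : ℝ) : ℝ := -128 * c ^ 3 - 96 * c ^ 2 + 144 * c + 115

/-- A cutoff function: the inner end of the deformed arc. -/
def cutL (c : ℝ) : ℝ := Real.smoothTransition (20 * (c + 9 / 10))

/-- A cutoff function: the outer end of the deformed arc. -/
def cutR (c : ℝ) : ℝ := Real.smoothTransition (20 * (-7 / 10 - c))

/-- A cutoff function, selecting one of the two branches. -/
def gate (s : ℝ) : ℝ := Real.smoothTransition (5 / 2 * s)

/-- The depth of the dent towards the left hole. -/
def dentL (τ c s : ℝ) : ℝ :=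
  2 * (cutL c * (1 - cutL c)) * gate s * (1 - Real.cos (2 * Real.pi * τ))

/-- The depth of the dent towards the outer boundary. -/
def dentR (τ c s : ℝ) : ℝ :=
  2 * (cutR c * (1 - cutR c)) * gate s * (1 - Real.cos (2 * Real.pi * τ))

/-- The multiplier of `z + i w`, real part. -/
def turnRe (τ c s : ℝ) : ℝ := 1 + cutL c * cutR c * gate s * (Real.cos (2 * Real.pi * τ) - 1)

/-- The multiplier of `z + i w`, imaginary part. -/
def turnIm (τ c s : ℝ) : ℝ := cutL c * cutR c * gate s * Real.sin (2 * Real.pi * τ)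

/-- The factor of the homothety towards the center of the left hole. -/
def scaleL (τ c s : ℝ) : ℝ :=
  Real.sqrt ((1 + (1 - dentL τ c s) * leftPower c) / (1 + leftPower c))

/-- The abscissa after the deformation towards the left hole. -/
def xMid (τ c s : ℝ) : ℝ := scaleL τ c s * (xPlane c + 4) - 4

/-- The ordinate after the deformation towards the left hole. -/
def yMid (τ c s : ℝ) : ℝ := scaleL τ c s * yPlane s

/-- The square of the distance from the origin after the deformation towards the left hole. -/
def normMid (τ c s : ℝ) : ℝ := xMid τ c s ^ 2 + yMid τ c s ^ 2

/-- The factor of the homothety towards the outer boundary. -/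
def scaleR (τ c s : ℝ) : ℝ :=
  Real.sqrt ((144 - (1 - dentR τ c s) * (144 - normMid τ c s)) / normMid τ c s)

/-- The first coordinate of the family. -/
def xFam (τ c s : ℝ) : ℝ := scaleR τ c s * xMid τ c s

/-- The second coordinate of the family. -/
def yFam (τ c s : ℝ) : ℝ := scaleR τ c s * yMid τ c s

/-- The power with respect to the left hole, up to the factor due to the dent towards this hole. -/
def powerFam (τ c s : ℝ) : ℝ :=
  leftPower c + (scaleR τ c s ^ 2 - 1) * normMid τ c s + 8 * (scaleR τ c s - 1) * xMid τ c s

/-- The product of the powers with respect to the two other holes. -/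
def holesFam (τ c s : ℝ) : ℝ :=
  (xFam τ c s ^ 2 + yFam τ c s ^ 2 - 1) * ((xFam τ c s - 4) ^ 2 + yFam τ c s ^ 2 - 1)

/-- The length of the vector `(z, w)`, up to the multiplier. -/
def ampSq (τ c s : ℝ) : ℝ := (144 - normMid τ c s) * powerFam τ c s * holesFam τ c s

/-- The third coordinate of the family. -/
def zFam (τ c s : ℝ) : ℝ := turnRe τ c s * Real.sqrt (ampSq τ c s)

/-- The fourth coordinate of the family. -/
def wFam (τ c s : ℝ) : ℝ := turnIm τ c s * Real.sqrt (ampSq τ c s)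

variable {τ c s : ℝ}

lemma cutL_eq_one (h : -17 / 20 ≤ c) : cutL c = 1 := Real.smoothTransition.one_of_one_le (by linarith)

lemma cutL_eq_zero (h : c ≤ -9 / 10) : cutL c = 0 :=
  Real.smoothTransition.zero_of_nonpos (by linarith)

lemma cutR_eq_one (h : c ≤ -3 / 4) : cutR c = 1 := Real.smoothTransition.one_of_one_le (by linarith)

lemma cutR_eq_zero (h : -7 / 10 ≤ c) : cutR c = 0 :=
  Real.smoothTransition.zero_of_nonpos (by linarith)

lemma gate_eq_one (h : 2 / 5 ≤ s) : gate s = 1 := Real.smoothTransition.one_of_one_le (by linarith)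

lemma gate_eq_zero (h : s ≤ 0) : gate s = 0 := Real.smoothTransition.zero_of_nonpos (by linarith)

lemma dent_bound {a b d : ℝ} (ha : 0 ≤ a) (ha' : a ≤ 1) (hb : 0 ≤ b) (hb' : b ≤ 1) (hd : |d| ≤ 1) :
    0 ≤ 2 * (a * (1 - a)) * b * (1 - d) ∧ 2 * (a * (1 - a)) * b * (1 - d) ≤ 1 := by
  obtain ⟨h1, h2⟩ := abs_le.mp hd
  have h3 : 0 ≤ a * (1 - a) := mul_nonneg ha (by linarith)
  have h4 : a * (1 - a) ≤ 1 / 4 := by nlinarith [sq_nonneg (a - 1 / 2)]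
  have h5 : 0 ≤ b * (1 - d) := mul_nonneg hb (by linarith)
  have h6 : b * (1 - d) ≤ 2 := by nlinarith
  constructor
  · have := mul_nonneg h3 h5
    linarith
  · have := mul_le_mul h4 h6 h5 (by norm_num)
    linarith

lemma dentL_mem : 0 ≤ dentL τ c s ∧ dentL τ c s ≤ 1 :=
  dent_bound (Real.smoothTransition.nonneg _) (Real.smoothTransition.le_one _)
    (Real.smoothTransition.nonneg _) (Real.smoothTransition.le_one _) (Real.abs_cos_le_one _)

lemma dentR_mem : 0 ≤ dentR τ c s ∧ dentR τ c s ≤ 1 :=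
  dent_bound (Real.smoothTransition.nonneg _) (Real.smoothTransition.le_one _)
    (Real.smoothTransition.nonneg _) (Real.smoothTransition.le_one _) (Real.abs_cos_le_one _)

lemma dentL_eq_zero (h : -17 / 20 ≤ c) : dentL τ c s = 0 := by
  rw [dentL, cutL_eq_one h]
  ring

lemma dentR_eq_zero (h : c ≤ -3 / 4) : dentR τ c s = 0 := by
  rw [dentR, cutR_eq_one h]
  ring

lemma dentR_eq_zero' (h : -7 / 10 ≤ c) : dentR τ c s = 0 := by
  rw [dentR, cutR_eq_zero h]
  ring

lemma dentR_eq_zero_of_nonpos (h : s ≤ 0) : dentR τ c s = 0 := by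
  rw [dentR, gate_eq_zero h]
  ring

lemma mem_of_circle (h : c ^ 2 + s ^ 2 = 1) : -1 ≤ c ∧ c ≤ 1 :=
  ⟨by nlinarith [sq_nonneg s], by nlinarith [sq_nonneg s]⟩

/-- In this range `s² ≥ 19/100 > (2/5)²`, so the smooth gate merely selects the upper or the lower
branch. -/
lemma gate_cases (h : c ^ 2 + s ^ 2 = 1) (h1 : -9 / 10 ≤ c) (h2 : c ≤ 0) :
    gate s = 0 ∨ gate s = 1 := by
  rcases le_total s 0 with hs | hs
  · exact .inl (gate_eq_zero hs)
  · exact .inr (gate_eq_one (by nlinarith [h1]))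

/-- With `κ` the product of the cutoffs and the gate, the multiplier is `1 + κ (exp (2πiτ) - 1)`, of
squared modulus `1 - 2κ(1 - κ)(1 - cos 2πτ)`. The dents are defined to match this. The transition
zones of the two cutoffs are disjoint, so at least one dent is zero. -/
lemma turn_sq (h : c ^ 2 + s ^ 2 = 1) :
    turnRe τ c s ^ 2 + turnIm τ c s ^ 2 = (1 - dentL τ c s) * (1 - dentR τ c s) := by
  have ht := Real.sin_sq_add_cos_sq (2 * Real.pi * τ)
  unfold turnRe turnIm dentL dentR
  rcases le_total c (-9 / 10) with h1 | h1
  · rw [cutL_eq_zero h1, cutR_eq_one (by linarith)]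
    ring
  rcases le_total (-7 / 10) c with h2 | h2
  · rw [cutR_eq_zero h2, cutL_eq_one (by linarith)]
    ring
  rcases le_total c (-4 / 5) with h3 | h3
  · rw [cutR_eq_one (by linarith)]
    rcases gate_cases h h1 (by linarith) with hg | hg <;> rw [hg]
    · ring
    · linear_combination (cutL c ^ 2) * ht
  · rw [cutL_eq_one (by linarith)]
    rcases gate_cases h h1 (by linarith) with hg | hg <;> rw [hg]
    · ring
    · linear_combination (cutR c ^ 2) * ht

lemma leftPower_pos (h1 : -1 ≤ c) (h2 : c ≤ 1) : 0 < leftPower c := by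
  unfold leftPower
  -- The cubic has its minimum on `[-1, 1]` near `-0.9115`.
  nlinarith [mul_nonneg (by linarith : (0 : ℝ) ≤ 1 - c) (sq_nonneg (c + 0.9115))]

lemma plane_norm_left (h : c ^ 2 + s ^ 2 = 1) :
    (xPlane c + 4) ^ 2 + yPlane s ^ 2 = 1 + leftPower c := by
  have hs : s ^ 2 = 1 - c ^ 2 := by linarith
  have hy : yPlane s ^ 2 = s ^ 2 * (16 * s ^ 2 - 6) ^ 2 := by
    unfold yPlane
    ring
  rw [hy, hs]
  unfold xPlane leftPower
  ring

/-- The squared modulus of `6 - 4u²` is `52 - 48 cos 2t`. -/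
lemma plane_norm (h : c ^ 2 + s ^ 2 = 1) : xPlane c ^ 2 + yPlane s ^ 2 = 100 - 96 * c ^ 2 := by
  have := plane_norm_left h
  have e : xPlane c ^ 2 + yPlane s ^ 2 = 1 + leftPower c - 8 * xPlane c - 16 := by linarith
  rw [e]
  unfold xPlane leftPower
  ring

lemma scaleL_pos (h : c ^ 2 + s ^ 2 = 1) : 0 < scaleL τ c s := by
  have hp := leftPower_pos (mem_of_circle h).1 (mem_of_circle h).2
  have := mul_nonneg (sub_nonneg.mpr (dentL_mem (τ := τ) (c := c) (s := s)).2) hp.le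
  exact Real.sqrt_pos.mpr (by positivity)

lemma scaleL_sq (h : c ^ 2 + s ^ 2 = 1) :
    scaleL τ c s ^ 2 * (1 + leftPower c) = 1 + (1 - dentL τ c s) * leftPower c := by
  have hp := leftPower_pos (mem_of_circle h).1 (mem_of_circle h).2
  have := mul_nonneg (sub_nonneg.mpr (dentL_mem (τ := τ) (c := c) (s := s)).2) hp.le
  rw [scaleL, Real.sq_sqrt (by positivity)]
  field_simp

lemma scaleL_eq_one (h : c ^ 2 + s ^ 2 = 1) (hd : dentL τ c s = 0) : scaleL τ c s = 1 := by
  have hp := leftPower_pos (mem_of_circle h).1 (mem_of_circle h).2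
  rw [scaleL, hd, sub_zero, one_mul, div_self (by positivity), Real.sqrt_one]

/-- The homothety about `(-4, 0)` is chosen to multiply the power with respect to the left hole by
exactly `1 - dentL`. -/
lemma mid_norm_left (h : c ^ 2 + s ^ 2 = 1) :
    (xMid τ c s + 4) ^ 2 + yMid τ c s ^ 2 = 1 + (1 - dentL τ c s) * leftPower c := by
  rw [← scaleL_sq h, ← plane_norm_left h]
  unfold xMid yMid
  ring

lemma xMid_eq (h : c ^ 2 + s ^ 2 = 1) (hd : dentL τ c s = 0) : xMid τ c s = xPlane c := by
  rw [xMid, scaleL_eq_one h hd]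
  ring

lemma yMid_eq (h : c ^ 2 + s ^ 2 = 1) (hd : dentL τ c s = 0) : yMid τ c s = yPlane s := by
  rw [yMid, scaleL_eq_one h hd]
  ring

lemma normMid_eq (h : c ^ 2 + s ^ 2 = 1) (hd : dentL τ c s = 0) :
    normMid τ c s = 100 - 96 * c ^ 2 := by
  rw [normMid, xMid_eq h hd, yMid_eq h hd, plane_norm h]

lemma leftPower_le (h1 : -1 ≤ c) (h2 : c ≤ -3 / 4) : leftPower c ≤ 7 := by
  unfold leftPower
  nlinarith [mul_nonneg (by linarith : (0 : ℝ) ≤ 1 + c) (by linarith : (0 : ℝ) ≤ -3 / 4 - c),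
    mul_nonneg (mul_nonneg (by linarith : (0 : ℝ) ≤ 1 + c) (by linarith : (0 : ℝ) ≤ -3 / 4 - c))
      (by linarith : (0 : ℝ) ≤ -c)]

/-- The power is at most `7` before the homothety, which does not increase it, so the point stays
within distance `√8` of `(-4, 0)`. -/
lemma xMid_bounds (h : c ^ 2 + s ^ 2 = 1) (hc : c ≤ -3 / 4) :
    -7 < xMid τ c s ∧ xMid τ c s < -11 / 10 ∧ normMid τ c s < 144 := by
  have e := mid_norm_left (τ := τ) h
  have hp := leftPower_pos (mem_of_circle h).1 (mem_of_circle h).2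
  have hp' := leftPower_le (mem_of_circle h).1 hc
  have hd := dentL_mem (τ := τ) (c := c) (s := s)
  have hb : (xMid τ c s + 4) ^ 2 + yMid τ c s ^ 2 ≤ 8 := by nlinarith
  have hx1 : -7 < xMid τ c s := by nlinarith [sq_nonneg (yMid τ c s)]
  refine ⟨hx1, by nlinarith [sq_nonneg (yMid τ c s)], ?_⟩
  unfold normMid
  nlinarith

lemma normMid_pos (h : c ^ 2 + s ^ 2 = 1) : 1 < normMid τ c s ∧ normMid τ c s < 144 := by
  rcases le_total c (-3 / 4) with hc | hc
  · obtain ⟨h1, h2, h3⟩ := xMid_bounds (τ := τ) h hc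
    refine ⟨?_, h3⟩
    unfold normMid
    nlinarith [sq_nonneg (yMid τ c s)]
  · rw [normMid_eq h (dentL_eq_zero (by linarith))]
    constructor <;> nlinarith [sq_nonneg s, sq_nonneg c]

/-- The homothety about the origin is chosen to multiply the power with respect to the outer circle
by exactly `1 - dentR`. -/
lemma scaleR_sq (h : c ^ 2 + s ^ 2 = 1) :
    scaleR τ c s ^ 2 * normMid τ c s = 144 - (1 - dentR τ c s) * (144 - normMid τ c s) := by
  obtain ⟨h1, h2⟩ := normMid_pos (τ := τ) h
  have := dentR_mem (τ := τ) (c := c) (s := s)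
  rw [scaleR, Real.sq_sqrt (div_nonneg (by nlinarith) (by linarith))]
  field_simp

lemma scaleR_arg_pos (h : c ^ 2 + s ^ 2 = 1) :
    0 < (144 - (1 - dentR τ c s) * (144 - normMid τ c s)) / normMid τ c s := by
  obtain ⟨h1, h2⟩ := normMid_pos (τ := τ) h
  have := dentR_mem (τ := τ) (c := c) (s := s)
  exact div_pos (by nlinarith) (by linarith)

lemma one_le_scaleR (h : c ^ 2 + s ^ 2 = 1) : 1 ≤ scaleR τ c s := by
  obtain ⟨h1, h2⟩ := normMid_pos (τ := τ) h
  have := dentR_mem (τ := τ) (c := c) (s := s)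
  rw [scaleR, Real.one_le_sqrt, le_div_iff₀ (by linarith)]
  nlinarith

lemma scaleR_eq_one (h : c ^ 2 + s ^ 2 = 1) (hd : dentR τ c s = 0) : scaleR τ c s = 1 := by
  obtain ⟨h1, h2⟩ := normMid_pos (τ := τ) h
  rw [scaleR, hd, sub_zero, one_mul, sub_sub_cancel, div_self (by linarith), Real.sqrt_one]

/-- Where the curve is moved towards the outer boundary. -/
lemma moved_cases (τ : ℝ) (h : c ^ 2 + s ^ 2 = 1) :
    scaleR τ c s = 1 ∨ (-3 / 4 < c ∧ c < -7 / 10 ∧ 0 < s) := by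
  by_contra! hn
  obtain ⟨h1, h2⟩ := hn
  refine h1 (scaleR_eq_one h ?_)
  rcases le_or_gt c (-3 / 4) with hc | hc
  · exact dentR_eq_zero hc
  rcases le_or_gt (-7 / 10) c with hc' | hc'
  · exact dentR_eq_zero' hc'
  · exact dentR_eq_zero_of_nonpos (h2 hc hc')

lemma fam_norm_left : (xFam τ c s + 4) ^ 2 + yFam τ c s ^ 2 =
    (xMid τ c s + 4) ^ 2 + yMid τ c s ^ 2 + (scaleR τ c s ^ 2 - 1) * normMid τ c s +
      8 * (scaleR τ c s - 1) * xMid τ c s := by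
  unfold xFam yFam normMid
  ring

/-- The two homotheties never act at the same point. Thus `powerFam` is the power with the factor `1
- dentL` removed without a division, and it remains meaningful where this factor vanishes. -/
lemma fam_power (h : c ^ 2 + s ^ 2 = 1) : (xFam τ c s + 4) ^ 2 + yFam τ c s ^ 2 - 1 =
    (1 - dentL τ c s) * powerFam τ c s := by
  rw [fam_norm_left, mid_norm_left h, powerFam]
  rcases moved_cases τ h with h1 | ⟨h1, -, -⟩
  · rw [h1]
    ring
  · rw [dentL_eq_zero (by linarith)]
    ring

/-- Where the curve is pushed away from the origin, the push also increases the distance from the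
left hole. -/
lemma powerFam_ge (τ : ℝ) (h : c ^ 2 + s ^ 2 = 1) : leftPower c ≤ powerFam τ c s := by
  rcases moved_cases τ h with h1 | ⟨h1, h2, -⟩
  · rw [powerFam, h1]
    linarith
  · have hr := one_le_scaleR (τ := τ) h
    rw [powerFam, normMid_eq h (dentL_eq_zero (by linarith)), xMid_eq h (dentL_eq_zero (by linarith))]
    have e : (scaleR τ c s ^ 2 - 1) * (100 - 96 * c ^ 2) + 8 * (scaleR τ c s - 1) * xPlane c =
        (scaleR τ c s - 1) * ((scaleR τ c s - 1) * (100 - 96 * c ^ 2) +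
          (2 * (100 - 96 * c ^ 2) + 8 * xPlane c)) := by ring
    have hc : 0 ≤ 100 - 96 * c ^ 2 := by nlinarith
    have hx : 0 ≤ 2 * (100 - 96 * c ^ 2) + 8 * xPlane c := by
      unfold xPlane
      nlinarith [mul_nonneg (sq_nonneg c) (by linarith : (0 : ℝ) ≤ -c)]
    have := mul_nonneg (sub_nonneg.mpr hr) (add_nonneg (mul_nonneg (sub_nonneg.mpr hr) hc) hx)
    linarith

lemma fam_eq_of_scaleR (h : scaleR τ c s = 1) : xFam τ c s = xMid τ c s ∧ yFam τ c s = yMid τ c s := by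
  rw [xFam, yFam, h, one_mul, one_mul]
  exact ⟨rfl, rfl⟩

lemma xPlane_neg (h1 : -1 ≤ c) (h2 : c < 0) : xPlane c < 0 := by
  unfold xPlane
  nlinarith [mul_pos_of_neg_of_neg h2 h2]

/-- The deformed pieces keep a negative abscissa and a distance greater than `1` from the origin.
For the undeformed part, the right hole is handled by the reflection `c ↦ -c`. -/
lemma holesFam_pos (h : c ^ 2 + s ^ 2 = 1) : 0 < holesFam τ c s := by
  have hm := mem_of_circle h
  rcases moved_cases τ h with h1 | ⟨h1, h2, -⟩
  · obtain ⟨ex, ey⟩ := fam_eq_of_scaleR h1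
    rw [holesFam, ex, ey]
    have hn := (normMid_pos (τ := τ) h).1
    refine mul_pos (by unfold normMid at hn; linarith) ?_
    rcases le_total c (-3 / 4) with hc | hc
    · have := (xMid_bounds (τ := τ) h hc).2.1
      nlinarith [sq_nonneg (yMid τ c s)]
    · have hp := leftPower_pos (c := -c) (by linarith) (by linarith)
      rw [xMid_eq h (dentL_eq_zero (by linarith)), yMid_eq h (dentL_eq_zero (by linarith))]
      have e := plane_norm h
      unfold leftPower at hp
      unfold xPlane at e ⊢
      nlinarith
  · have hr := one_le_scaleR (τ := τ) h
    have hn := (normMid_pos (τ := τ) h).1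
    have hx := xPlane_neg hm.1 (by linarith : c < 0)
    have ex : xFam τ c s = scaleR τ c s * xPlane c := by
      rw [xFam, xMid_eq h (dentL_eq_zero (by linarith))]
    have hX : xFam τ c s < 0 := by
      rw [ex]
      exact mul_neg_of_pos_of_neg (by linarith) hx
    have hN : 1 < xFam τ c s ^ 2 + yFam τ c s ^ 2 := by
      have e : xFam τ c s ^ 2 + yFam τ c s ^ 2 = scaleR τ c s ^ 2 * normMid τ c s := by
        unfold xFam yFam normMid
        ring
      rw [e]
      have : 1 ≤ scaleR τ c s ^ 2 := one_le_pow₀ hr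
      nlinarith
    rw [holesFam]
    exact mul_pos (by linarith) (by nlinarith)

lemma powerFam_pos (τ : ℝ) (h : c ^ 2 + s ^ 2 = 1) : 0 < powerFam τ c s :=
  (leftPower_pos (mem_of_circle h).1 (mem_of_circle h).2).trans_le (powerFam_ge τ h)

lemma ampSq_pos (h : c ^ 2 + s ^ 2 = 1) : 0 < ampSq τ c s :=
  mul_pos (mul_pos (by linarith [(normMid_pos (τ := τ) h).2]) (powerFam_pos τ h)) (holesFam_pos h)

/-- Each dent rescales one of the four factors of `outline`. The resulting factor is the squared
modulus of the multiplier by `turn_sq`, which places the family on `M`. -/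
lemma outline_fam (h : c ^ 2 + s ^ 2 = 1) : outline (xFam τ c s) (yFam τ c s) =
    (1 - dentL τ c s) * (1 - dentR τ c s) * ampSq τ c s := by
  have e1 := fam_power (τ := τ) h
  have e2 : 144 - (xFam τ c s ^ 2 + yFam τ c s ^ 2) =
      (1 - dentR τ c s) * (144 - normMid τ c s) := by
    have e : xFam τ c s ^ 2 + yFam τ c s ^ 2 = scaleR τ c s ^ 2 * normMid τ c s := by
      unfold xFam yFam normMid
      ring
    rw [e, scaleR_sq h]
    ring
  rw [outline, e1, e2, ampSq, holesFam]
  ring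

lemma fam_mem (h : c ^ 2 + s ^ 2 = 1) :
    defFun !₂[xFam τ c s, yFam τ c s, zFam τ c s, wFam τ c s] = 0 := by
  have e : zFam τ c s ^ 2 + wFam τ c s ^ 2 =
      (turnRe τ c s ^ 2 + turnIm τ c s ^ 2) * Real.sqrt (ampSq τ c s) ^ 2 := by
    unfold zFam wFam
    ring
  rw [turn_sq h, Real.sq_sqrt (ampSq_pos h).le, ← outline_fam h] at e
  simp only [defFun]
  simpa [sub_eq_zero] using e

end Family

end KnotSS

end

noncomputable section

namespace KnotSS

/-! ### Smoothness and periodicity of the family, and its initial curve -/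

section Smoothness

variable {W : Type*} [NormedAddCommGroup W] [NormedSpace ℝ W] {τ c s : W → ℝ}

lemma contDiff_xPlane (hc : ContDiff ℝ ∞ c) : ContDiff ℝ ∞ fun p => xPlane (c p) := by
  unfold xPlane
  fun_prop

lemma contDiff_yPlane (hs : ContDiff ℝ ∞ s) : ContDiff ℝ ∞ fun p => yPlane (s p) := by
  unfold yPlane
  fun_prop

lemma contDiff_leftPower (hc : ContDiff ℝ ∞ c) : ContDiff ℝ ∞ fun p => leftPower (c p) := by
  unfold leftPower
  fun_prop

lemma contDiff_cutL (hc : ContDiff ℝ ∞ c) : ContDiff ℝ ∞ fun p => cutL (c p) :=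
  Real.smoothTransition.contDiff.comp (by fun_prop)

lemma contDiff_cutR (hc : ContDiff ℝ ∞ c) : ContDiff ℝ ∞ fun p => cutR (c p) :=
  Real.smoothTransition.contDiff.comp (by fun_prop)

lemma contDiff_gate (hs : ContDiff ℝ ∞ s) : ContDiff ℝ ∞ fun p => gate (s p) :=
  Real.smoothTransition.contDiff.comp (by fun_prop)

lemma contDiff_dentL (hτ : ContDiff ℝ ∞ τ) (hc : ContDiff ℝ ∞ c) (hs : ContDiff ℝ ∞ s) :
    ContDiff ℝ ∞ fun p => dentL (τ p) (c p) (s p) := by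
  have h1 := contDiff_cutL hc
  have h2 := contDiff_gate hs
  have h3 : ContDiff ℝ ∞ fun p => Real.cos (2 * Real.pi * τ p) := by fun_prop
  exact ((contDiff_const.mul (h1.mul (contDiff_const.sub h1))).mul h2).mul (contDiff_const.sub h3)

lemma contDiff_dentR (hτ : ContDiff ℝ ∞ τ) (hc : ContDiff ℝ ∞ c) (hs : ContDiff ℝ ∞ s) :
    ContDiff ℝ ∞ fun p => dentR (τ p) (c p) (s p) := by
  have h1 := contDiff_cutR hc
  have h2 := contDiff_gate hs
  have h3 : ContDiff ℝ ∞ fun p => Real.cos (2 * Real.pi * τ p) := by fun_prop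
  exact ((contDiff_const.mul (h1.mul (contDiff_const.sub h1))).mul h2).mul (contDiff_const.sub h3)

lemma contDiff_turnRe (hτ : ContDiff ℝ ∞ τ) (hc : ContDiff ℝ ∞ c) (hs : ContDiff ℝ ∞ s) :
    ContDiff ℝ ∞ fun p => turnRe (τ p) (c p) (s p) := by
  have h3 : ContDiff ℝ ∞ fun p => Real.cos (2 * Real.pi * τ p) := by fun_prop
  exact contDiff_const.add ((((contDiff_cutL hc).mul (contDiff_cutR hc)).mul
    (contDiff_gate hs)).mul (h3.sub contDiff_const))

lemma contDiff_turnIm (hτ : ContDiff ℝ ∞ τ) (hc : ContDiff ℝ ∞ c) (hs : ContDiff ℝ ∞ s) :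
    ContDiff ℝ ∞ fun p => turnIm (τ p) (c p) (s p) := by
  have h3 : ContDiff ℝ ∞ fun p => Real.sin (2 * Real.pi * τ p) := by fun_prop
  exact (((contDiff_cutL hc).mul (contDiff_cutR hc)).mul (contDiff_gate hs)).mul h3

lemma contDiff_scaleL (hτ : ContDiff ℝ ∞ τ) (hc : ContDiff ℝ ∞ c) (hs : ContDiff ℝ ∞ s)
    (h : ∀ p, c p ^ 2 + s p ^ 2 = 1) : ContDiff ℝ ∞ fun p => scaleL (τ p) (c p) (s p) := by
  have hp := fun p => leftPower_pos (mem_of_circle (h p)).1 (mem_of_circle (h p)).2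
  have h1 := contDiff_leftPower hc
  refine ContDiff.sqrt (((contDiff_const.add ((contDiff_const.sub
    (contDiff_dentL hτ hc hs)).mul h1))).div (contDiff_const.add h1) fun p => ?_) fun p => ?_
  · linarith [hp p]
  · have := mul_nonneg (sub_nonneg.mpr (dentL_mem (τ := τ p) (c := c p) (s := s p)).2) (hp p).le
    have := hp p
    positivity

lemma contDiff_xMid (hτ : ContDiff ℝ ∞ τ) (hc : ContDiff ℝ ∞ c) (hs : ContDiff ℝ ∞ s)
    (h : ∀ p, c p ^ 2 + s p ^ 2 = 1) : ContDiff ℝ ∞ fun p => xMid (τ p) (c p) (s p) :=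
  ((contDiff_scaleL hτ hc hs h).mul ((contDiff_xPlane hc).add contDiff_const)).sub contDiff_const

lemma contDiff_yMid (hτ : ContDiff ℝ ∞ τ) (hc : ContDiff ℝ ∞ c) (hs : ContDiff ℝ ∞ s)
    (h : ∀ p, c p ^ 2 + s p ^ 2 = 1) : ContDiff ℝ ∞ fun p => yMid (τ p) (c p) (s p) :=
  (contDiff_scaleL hτ hc hs h).mul (contDiff_yPlane hs)

lemma contDiff_normMid (hτ : ContDiff ℝ ∞ τ) (hc : ContDiff ℝ ∞ c) (hs : ContDiff ℝ ∞ s)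
    (h : ∀ p, c p ^ 2 + s p ^ 2 = 1) : ContDiff ℝ ∞ fun p => normMid (τ p) (c p) (s p) :=
  ((contDiff_xMid hτ hc hs h).pow 2).add ((contDiff_yMid hτ hc hs h).pow 2)

lemma contDiff_scaleR (hτ : ContDiff ℝ ∞ τ) (hc : ContDiff ℝ ∞ c) (hs : ContDiff ℝ ∞ s)
    (h : ∀ p, c p ^ 2 + s p ^ 2 = 1) : ContDiff ℝ ∞ fun p => scaleR (τ p) (c p) (s p) := by
  have h1 := contDiff_normMid hτ hc hs h
  refine ContDiff.sqrt ((contDiff_const.sub ((contDiff_const.sub (contDiff_dentR hτ hc hs)).mul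
    (contDiff_const.sub h1))).div h1 fun p => ?_) fun p => (scaleR_arg_pos (h p)).ne'
  linarith [(normMid_pos (τ := τ p) (h p)).1]

lemma contDiff_xFam (hτ : ContDiff ℝ ∞ τ) (hc : ContDiff ℝ ∞ c) (hs : ContDiff ℝ ∞ s)
    (h : ∀ p, c p ^ 2 + s p ^ 2 = 1) : ContDiff ℝ ∞ fun p => xFam (τ p) (c p) (s p) :=
  (contDiff_scaleR hτ hc hs h).mul (contDiff_xMid hτ hc hs h)

lemma contDiff_yFam (hτ : ContDiff ℝ ∞ τ) (hc : ContDiff ℝ ∞ c) (hs : ContDiff ℝ ∞ s)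
    (h : ∀ p, c p ^ 2 + s p ^ 2 = 1) : ContDiff ℝ ∞ fun p => yFam (τ p) (c p) (s p) :=
  (contDiff_scaleR hτ hc hs h).mul (contDiff_yMid hτ hc hs h)

/-- The radicand never vanishes, although `outline` does vanish on the family; the vanishing factors
are carried by the smooth multiplier of `z + iw`. -/
lemma contDiff_sqrt_ampSq (hτ : ContDiff ℝ ∞ τ) (hc : ContDiff ℝ ∞ c) (hs : ContDiff ℝ ∞ s)
    (h : ∀ p, c p ^ 2 + s p ^ 2 = 1) :
    ContDiff ℝ ∞ fun p => Real.sqrt (ampSq (τ p) (c p) (s p)) := by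
  have h1 := contDiff_normMid hτ hc hs h
  have h2 := contDiff_scaleR hτ hc hs h
  have h3 := contDiff_xMid hτ hc hs h
  have h4 := contDiff_xFam hτ hc hs h
  have h5 := contDiff_yFam hτ hc hs h
  have h6 := contDiff_leftPower hc
  refine ContDiff.sqrt ?_ fun p => (ampSq_pos (h p)).ne'
  unfold ampSq powerFam holesFam
  fun_prop

/-- The points of the family in `ℝ⁴`. -/
def famVec (τ c s : ℝ) : E4 := !₂[xFam τ c s, yFam τ c s, zFam τ c s, wFam τ c s]

lemma contDiff_famVec (hτ : ContDiff ℝ ∞ τ) (hc : ContDiff ℝ ∞ c) (hs : ContDiff ℝ ∞ s)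
    (h : ∀ p, c p ^ 2 + s p ^ 2 = 1) : ContDiff ℝ ∞ fun p => famVec (τ p) (c p) (s p) := by
  have ha := contDiff_sqrt_ampSq hτ hc hs h
  rw [contDiff_euclidean]
  intro i
  fin_cases i
  · exact contDiff_xFam hτ hc hs h
  · exact contDiff_yFam hτ hc hs h
  · exact (contDiff_turnRe hτ hc hs).mul ha
  · exact (contDiff_turnIm hτ hc hs).mul ha

end Smoothness

/-- The exponential map is open and surjective, hence a quotient map. -/
lemma continuous_of_comp_exp {Y : Type*} [TopologicalSpace Y] {f : Circle → Y}
    (h : Continuous fun t : ℝ => f (Circle.exp t)) : Continuous f := by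
  have hq : Topology.IsQuotientMap (Circle.exp : ℝ → Circle) :=
    (isLocalHomeomorph_circleExp.isOpenMap).isQuotientMap Circle.exp.continuous
      fun u => exists_angle u
  exact hq.continuous_iff.mpr h

/-- The loop of curves: the outer branch of the small loop around the left hole is pushed to both
boundary components next to it and turned about them. -/
def famCurve (τ : ℝ) : C(Circle, M) where
  toFun u := ⟨famVec τ (u : ℂ).re (u : ℂ).im, fam_mem (circle_sq u)⟩
  continuous_toFun := by
    refine Continuous.subtype_mk (continuous_of_comp_exp ?_) _
    simp only [exp_re, exp_im]
    exact (contDiff_famVec contDiff_const Real.contDiff_cos Real.contDiff_sin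
      Real.cos_sq_add_sin_sq).continuous

lemma famCurve_exp (τ t : ℝ) :
    (famCurve τ (Circle.exp t) : E4) = famVec τ (Real.cos t) (Real.sin t) := by
  show famVec τ _ _ = _
  rw [exp_re, exp_im]

lemma contDiff_famCurve :
    ContDiff ℝ ∞ fun p : ℝ × ℝ => (famCurve p.1 (Circle.exp p.2) : E4) := by
  simp only [famCurve_exp]
  exact contDiff_famVec contDiff_fst (Real.contDiff_cos.comp contDiff_snd)
    (Real.contDiff_sin.comp contDiff_snd) fun p => Real.cos_sq_add_sin_sq _

lemma contDiff_lift_famCurve (τ : ℝ) : ContDiff ℝ ∞ (lift (famCurve τ)) := by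
  have := contDiff_famCurve.comp (f := fun t : ℝ => ((τ, t) : ℝ × ℝ)) (by fun_prop)
  exact this

lemma famCurve_add_one (τ : ℝ) : famCurve (τ + 1) = famCurve τ := by
  have h1 : Real.cos (2 * Real.pi * (τ + 1)) = Real.cos (2 * Real.pi * τ) := by
    rw [mul_add, mul_one, Real.cos_add_two_pi]
  have h2 : Real.sin (2 * Real.pi * (τ + 1)) = Real.sin (2 * Real.pi * τ) := by
    rw [mul_add, mul_one, Real.sin_add_two_pi]
  have hL : dentL (τ + 1) = dentL τ := by funext c s; rw [dentL, dentL, h1]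
  have hR : dentR (τ + 1) = dentR τ := by funext c s; rw [dentR, dentR, h1]
  have h3 : turnRe (τ + 1) = turnRe τ := by funext c s; rw [turnRe, turnRe, h1]
  have h4 : turnIm (τ + 1) = turnIm τ := by funext c s; rw [turnIm, turnIm, h2]
  have h5 : scaleL (τ + 1) = scaleL τ := by funext c s; rw [scaleL, scaleL, hL]
  have h6 : xMid (τ + 1) = xMid τ := by funext c s; rw [xMid, xMid, h5]
  have h7 : yMid (τ + 1) = yMid τ := by funext c s; rw [yMid, yMid, h5]
  have h8 : normMid (τ + 1) = normMid τ := by funext c s; rw [normMid, normMid, h6, h7]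
  have h9 : scaleR (τ + 1) = scaleR τ := by funext c s; rw [scaleR, scaleR, hR, h8]
  have hx : xFam (τ + 1) = xFam τ := by funext c s; rw [xFam, xFam, h9, h6]
  have hy : yFam (τ + 1) = yFam τ := by funext c s; rw [yFam, yFam, h9, h7]
  have ha : ampSq (τ + 1) = ampSq τ := by
    funext c s
    rw [ampSq, ampSq, powerFam, powerFam, holesFam, holesFam, h9, h8, h6, hx, hy]
  have hv : famVec (τ + 1) = famVec τ := by
    funext c s
    rw [famVec, famVec, zFam, zFam, wFam, wFam, hx, hy, h3, h4, ha]
  ext u : 2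
  show famVec (τ + 1) _ _ = famVec τ _ _
  rw [hv]

section Start

variable {c s : ℝ}

lemma dentL_zero : dentL 0 c s = 0 := by simp [dentL]

lemma dentR_zero : dentR 0 c s = 0 := by simp [dentR]

lemma xFam_eq {τ : ℝ} (h : c ^ 2 + s ^ 2 = 1) (hL : dentL τ c s = 0) (hR : dentR τ c s = 0) :
    xFam τ c s = xPlane c := by
  rw [xFam, scaleR_eq_one h hR, xMid_eq h hL, one_mul]

lemma yFam_eq {τ : ℝ} (h : c ^ 2 + s ^ 2 = 1) (hL : dentL τ c s = 0) (hR : dentR τ c s = 0) :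
    yFam τ c s = yPlane s := by
  rw [yFam, scaleR_eq_one h hR, yMid_eq h hL, one_mul]

/-- At `τ = 0` there are no dents and the multiplier is `1`, so `ampSq` is `outline` itself. -/
lemma famCurve_zero : famCurve 0 = figCurve := by
  ext u : 2
  have h := circle_sq u
  have hx := xFam_eq h dentL_zero dentR_zero
  have hy := yFam_eq h dentL_zero dentR_zero
  have e := outline_fam (τ := 0) h
  rw [dentL_zero, dentR_zero, sub_zero, one_mul, one_mul] at e
  show famVec 0 _ _ = !₂[_, _, _, _]
  rw [planeCurve_re, planeCurve_im, famVec, zFam, wFam, ← e, hx, hy]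
  simp [turnRe, turnIm, xPlane, yPlane]

end Start

end KnotSS

end

noncomputable section

namespace KnotSS

/-! ### Self-intersections of the curves of the family -/

section SelfIntersections

/-- The numerator of the derivative of `f / g` is the Wronskian, so the slope is strictly monotone
and determines the parameter. -/
lemma cross_inj {f g f' g' : ℝ → ℝ} {a b : ℝ} (hf : ∀ t, HasDerivAt f (f' t) t)
    (hg : ∀ t, HasDerivAt g (g' t) t) (h0 : ∀ t ∈ Set.Ioo a b, g t ≠ 0)
    (hW : ∀ t ∈ Set.Ioo a b, f' t * g t - f t * g' t < 0) {u v : ℝ} (hu : u ∈ Set.Ioo a b)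
    (hv : v ∈ Set.Ioo a b) (h : f u * g v = f v * g u) : u = v := by
  have hd : ∀ t ∈ Set.Ioo a b,
      HasDerivAt (fun t => f t / g t) ((f' t * g t - f t * g' t) / g t ^ 2) t :=
    fun t ht => (hf t).div (hg t) (h0 t ht)
  have ha : StrictAntiOn (fun t => f t / g t) (Set.Ioo a b) := by
    refine strictAntiOn_of_deriv_neg (convex_Ioo a b)
      (fun t ht => (hd t ht).continuousAt.continuousWithinAt) fun t ht => ?_
    rw [interior_Ioo] at ht
    rw [(hd t ht).deriv]
    exact div_neg_of_neg_of_pos (hW t ht) (by have := h0 t ht; positivity)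
  refine ha.injOn hu hv ?_
  show f u / g u = f v / g v
  rw [div_eq_div_iff (h0 u hu) (h0 v hv), h]

/-- The derivative of the abscissa of `planeCurve`. -/
def xDer (t : ℝ) : ℝ := Real.sin t * (48 * Real.cos t ^ 2 - 18)

/-- The derivative of the ordinate of `planeCurve`. -/
def yDer (t : ℝ) : ℝ := Real.cos t * (48 * Real.sin t ^ 2 - 6)

lemma hasDerivAt_xPlane (t : ℝ) : HasDerivAt (fun t => xPlane (Real.cos t)) (xDer t) t := by
  have h := Real.hasDerivAt_cos t
  refine ((h.const_mul 18).sub ((h.pow 3).const_mul 16)).congr_deriv ?_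
  unfold xDer
  push_cast
  ring

lemma hasDerivAt_yPlane (t : ℝ) : HasDerivAt (fun t => yPlane (Real.sin t)) (yDer t) t := by
  have h := Real.hasDerivAt_sin t
  refine (((h.pow 3).const_mul 16).sub (h.const_mul 6)).congr_deriv ?_
  unfold yDer
  push_cast
  ring

/-- This is minus the squared radius times the angular velocity about the origin. A homothety of
variable factor about the origin preserves the direction, so this controls the part pushed outwards.
-/
lemma wronskian (t : ℝ) : xDer t * yPlane (Real.sin t) - xPlane (Real.cos t) * yDer t =
    -(180 - 192 * Real.cos t ^ 2) := by
  have hs : Real.sin t ^ 2 = 1 - Real.cos t ^ 2 := Real.sin_sq t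
  have e : xDer t * yPlane (Real.sin t) - xPlane (Real.cos t) * yDer t =
      Real.sin t ^ 2 * (48 * Real.cos t ^ 2 - 18) * (16 * Real.sin t ^ 2 - 6) -
        Real.cos t ^ 2 * (18 - 16 * Real.cos t ^ 2) * (48 * Real.sin t ^ 2 - 6) := by
    unfold xDer yDer xPlane yPlane
    ring
  rw [e, hs]
  ring

/-- The same about the center of the left hole, for the part pushed towards this hole. -/
lemma wronskian_left (t : ℝ) : xDer t * yPlane (Real.sin t) - (xPlane (Real.cos t) + 4) * yDer t =
    -12 * (15 + 14 * Real.cos t - 16 * Real.cos t ^ 2 - 16 * Real.cos t ^ 3) := by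
  have hs : Real.sin t ^ 2 = 1 - Real.cos t ^ 2 := Real.sin_sq t
  have e := wronskian t
  have e' : yDer t = Real.cos t * (48 * (1 - Real.cos t ^ 2) - 6) := by rw [yDer, hs]
  linear_combination e - 4 * e'

lemma wronskian_left_neg {c : ℝ} (h1 : -1 ≤ c) (h2 : c ≤ -3 / 4) :
    -12 * (15 + 14 * c - 16 * c ^ 2 - 16 * c ^ 3) < 0 := by
  -- The cubic in parentheses has its minimum on this interval near `-0.96`.
  nlinarith [mul_nonneg (by linarith : (0 : ℝ) ≤ -c) (sq_nonneg (c + 0.96)),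
    mul_nonneg (by linarith : (0 : ℝ) ≤ 1 + c) (by linarith : (0 : ℝ) ≤ -3 / 4 - c)]

variable {c s c' s' : ℝ}

lemma exists_arccos (h : c ^ 2 + s ^ 2 = 1) (hs : 0 < s) :
    ∃ t, 0 < t ∧ t < Real.pi ∧ Real.cos t = c ∧ Real.sin t = s := by
  have h1 : -1 < c := by nlinarith
  have h2 : c < 1 := by nlinarith
  refine ⟨Real.arccos c, Real.arccos_pos.mpr h2, Real.arccos_lt_pi.mpr h1,
    Real.cos_arccos h1.le h2.le, ?_⟩
  rw [Real.sin_arccos, ← h, add_sub_cancel_left, Real.sqrt_sq hs.le]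

lemma yPlane_eq (h : c ^ 2 + s ^ 2 = 1) : yPlane s = s * (10 - 16 * c ^ 2) := by
  unfold yPlane
  linear_combination (16 * s) * h

lemma sq_sqrt58 : Real.sqrt (5 / 8) ^ 2 = 5 / 8 := Real.sq_sqrt (by norm_num)

lemma sqrt58_bounds : 79 / 100 < Real.sqrt (5 / 8) ∧ Real.sqrt (5 / 8) < 4 / 5 := by
  constructor
  · exact Real.lt_sqrt_of_sq_lt (by norm_num)
  · rw [Real.sqrt_lt' (by norm_num)]
    norm_num

/-- On the small loop around the left hole, the direction from the center determines the point. -/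
lemma eq_of_left_direction (h : c ^ 2 + s ^ 2 = 1) (h' : c' ^ 2 + s' ^ 2 = 1)
    (hc : c < -Real.sqrt (5 / 8)) (hc' : c' < -Real.sqrt (5 / 8)) (hs : 0 < s) (hs' : 0 < s')
    (he : (xPlane c + 4) * yPlane s' = (xPlane c' + 4) * yPlane s) : c = c' ∧ s = s' := by
  obtain ⟨t, h0, h1, rfl, rfl⟩ := exists_arccos h hs
  obtain ⟨t', h0', h1', rfl, rfl⟩ := exists_arccos h' hs'
  have hk := sqrt58_bounds
  have hcos : Real.cos (Real.pi - loopAngle) = -Real.sqrt (5 / 8) := by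
    rw [Real.cos_pi_sub, cos_loopAngle]
  have ha := loopAngle_pos
  have ha' := loopAngle_lt
  have hpi := Real.pi_pos
  have key : ∀ v, 0 < v → v < Real.pi → (Real.cos v < -Real.sqrt (5 / 8) ↔
      v ∈ Set.Ioo (Real.pi - loopAngle) Real.pi) := by
    intro v hv hv'
    rw [← hcos, Real.strictAntiOn_cos.lt_iff_gt ⟨hv.le, hv'.le⟩ ⟨by linarith, by linarith⟩]
    exact ⟨fun h => ⟨h, hv'⟩, fun h => h.1⟩
  have e : t = t' := by
    refine cross_inj (f := fun t => xPlane (Real.cos t) + 4)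
      (fun t => (hasDerivAt_xPlane t).add_const 4) hasDerivAt_yPlane ?_ ?_
      ((key t h0 h1).mp hc) ((key t' h0' h1').mp hc') he
    · intro v hv
      have hv0 : 0 < v := by linarith [hv.1]
      have := (key v hv0 hv.2).mpr hv
      rw [yPlane_eq (Real.cos_sq_add_sin_sq v)]
      refine mul_ne_zero (Real.sin_pos_of_pos_of_lt_pi hv0 hv.2).ne' ?_
      nlinarith [sq_sqrt58]
    · intro v hv
      have hv0 : 0 < v := by linarith [hv.1]
      have := (key v hv0 hv.2).mpr hv
      rw [wronskian_left]
      exact wronskian_left_neg (Real.neg_one_le_cos v) (by linarith)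
  rw [e]
  exact ⟨rfl, rfl⟩

/-- On the upper arc between the small loops, the direction from the origin determines the
point. -/
lemma eq_of_direction (h : c ^ 2 + s ^ 2 = 1) (h' : c' ^ 2 + s' ^ 2 = 1)
    (hc : c ^ 2 < 5 / 8) (hc' : c' ^ 2 < 5 / 8) (hs : 0 < s) (hs' : 0 < s')
    (he : xPlane c * yPlane s' = xPlane c' * yPlane s) : c = c' ∧ s = s' := by
  obtain ⟨t, h0, h1, rfl, rfl⟩ := exists_arccos h hs
  obtain ⟨t', h0', h1', rfl, rfl⟩ := exists_arccos h' hs'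
  have hcos : Real.cos (Real.pi - loopAngle) = -Real.sqrt (5 / 8) := by
    rw [Real.cos_pi_sub, cos_loopAngle]
  have ha := loopAngle_pos
  have ha' := loopAngle_lt
  have hpi := Real.pi_pos
  have key : ∀ v, 0 < v → v < Real.pi → (Real.cos v ^ 2 < 5 / 8 ↔
      v ∈ Set.Ioo loopAngle (Real.pi - loopAngle)) := by
    intro v hv hv'
    rw [← sq_sqrt58, sq_lt_sq, abs_of_nonneg (Real.sqrt_nonneg _), abs_lt, ← hcos, ← cos_loopAngle,
      Real.strictAntiOn_cos.lt_iff_gt ⟨hv.le, hv'.le⟩ ⟨by linarith, by linarith⟩,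
      Real.strictAntiOn_cos.lt_iff_gt ⟨by linarith, by linarith⟩ ⟨hv.le, hv'.le⟩]
    exact ⟨fun h => ⟨h.2, h.1⟩, fun h => ⟨h.2, h.1⟩⟩
  have e : t = t' := by
    refine cross_inj (f := fun t => xPlane (Real.cos t)) hasDerivAt_xPlane hasDerivAt_yPlane ?_ ?_
      ((key t h0 h1).mp hc) ((key t' h0' h1').mp hc') he
    · intro v hv
      have hv0 : 0 < v := by linarith [hv.1]
      have hv1 : v < Real.pi := by linarith [hv.2]
      have := (key v hv0 hv1).mpr hv
      rw [yPlane_eq (Real.cos_sq_add_sin_sq v)]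
      exact mul_ne_zero (Real.sin_pos_of_pos_of_lt_pi hv0 hv1).ne' (by linarith)
    · intro v hv
      have hv0 : 0 < v := by linarith [hv.1]
      have := (key v hv0 (by linarith [hv.2])).mpr hv
      rw [wronskian]
      linarith
  rw [e]
  exact ⟨rfl, rfl⟩

/-- The second factor of the difference is positive. So the power separates the small left loop from
the rest of the curve, with the self-intersection point at the common level. -/
lemma leftPower_lt_of_lt (h1 : -1 ≤ c) (h2 : c < -Real.sqrt (5 / 8)) :
    leftPower c < leftPower (-Real.sqrt (5 / 8)) := by
  have hk := sqrt58_bounds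
  have e : leftPower c - leftPower (-Real.sqrt (5 / 8)) = (c + Real.sqrt (5 / 8)) *
      (-128 * c ^ 2 + (128 * Real.sqrt (5 / 8) - 96) * c + 64 + 96 * Real.sqrt (5 / 8)) := by
    unfold leftPower
    linear_combination (-128 * c - 128 * Real.sqrt (5 / 8)) * sq_sqrt58
  have := mul_neg_of_neg_of_pos (by linarith : c + Real.sqrt (5 / 8) < 0)
    (by nlinarith : 0 < -128 * c ^ 2 + (128 * Real.sqrt (5 / 8) - 96) * c + 64 +
      96 * Real.sqrt (5 / 8))
  linarith

lemma leftPower_gt_of_gt (h1 : -Real.sqrt (5 / 8) < c) (h2 : c ≤ 1) :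
    leftPower (-Real.sqrt (5 / 8)) < leftPower c := by
  have hk := sqrt58_bounds
  have e : leftPower c - leftPower (-Real.sqrt (5 / 8)) = (c + Real.sqrt (5 / 8)) *
      (-128 * c ^ 2 + (128 * Real.sqrt (5 / 8) - 96) * c + 64 + 96 * Real.sqrt (5 / 8)) := by
    unfold leftPower
    linear_combination (-128 * c - 128 * Real.sqrt (5 / 8)) * sq_sqrt58
  have := mul_pos (by linarith : 0 < c + Real.sqrt (5 / 8))
    (by nlinarith : 0 < -128 * c ^ 2 + (128 * Real.sqrt (5 / 8) - 96) * c + 64 +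
      96 * Real.sqrt (5 / 8))
  linarith

variable {τ : ℝ}

lemma scaleR_eq_one_of_le (h : c ^ 2 + s ^ 2 = 1) (hc : c ≤ -3 / 4) : scaleR τ c s = 1 :=
  scaleR_eq_one h (dentR_eq_zero hc)

/-- The power with respect to the left hole, compared with that of the self-intersection point. -/
lemma fam_power_cases (τ : ℝ) (h : c ^ 2 + s ^ 2 = 1) :
    (c < -Real.sqrt (5 / 8) ∧ (xFam τ c s + 4) ^ 2 + yFam τ c s ^ 2 - 1 <
        leftPower (-Real.sqrt (5 / 8))) ∨
      (c = -Real.sqrt (5 / 8) ∧ (xFam τ c s + 4) ^ 2 + yFam τ c s ^ 2 - 1 =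
        leftPower (-Real.sqrt (5 / 8))) ∨
      (-Real.sqrt (5 / 8) < c ∧ leftPower (-Real.sqrt (5 / 8)) <
        (xFam τ c s + 4) ^ 2 + yFam τ c s ^ 2 - 1) := by
  have hk := sqrt58_bounds
  rw [fam_power h]
  rcases lt_trichotomy c (-Real.sqrt (5 / 8)) with hc | hc | hc
  · refine .inl ⟨hc, ?_⟩
    have h1 := leftPower_lt_of_lt (mem_of_circle h).1 hc
    have h2 := leftPower_pos (mem_of_circle h).1 (mem_of_circle h).2
    rw [powerFam, scaleR_eq_one_of_le h (by linarith)]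
    have := dentL_mem (τ := τ) (c := c) (s := s)
    nlinarith
  · refine .inr (.inl ⟨hc, ?_⟩)
    rw [powerFam, scaleR_eq_one_of_le h (by linarith), dentL_eq_zero (by linarith), ← hc]
    ring
  · refine .inr (.inr ⟨hc, ?_⟩)
    rw [dentL_eq_zero (by linarith), sub_zero, one_mul]
    exact (leftPower_gt_of_gt hc (mem_of_circle h).2).trans_le (powerFam_ge τ h)

/-- The homothety preserves directions from `(-4, 0)`, and the sign of the ordinate determines that
of `s`. The upper half is settled by `eq_of_left_direction`, the lower half by reflection, and `s =
0` leaves only `c = -1`. -/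
lemma eq_of_fam_eq_left (h : c ^ 2 + s ^ 2 = 1) (h' : c' ^ 2 + s' ^ 2 = 1)
    (hc : c < -Real.sqrt (5 / 8)) (hc' : c' < -Real.sqrt (5 / 8))
    (hX : xFam τ c s = xFam τ c' s') (hY : yFam τ c s = yFam τ c' s') : c = c' ∧ s = s' := by
  have hk := sqrt58_bounds
  obtain ⟨e1, e2⟩ := fam_eq_of_scaleR (scaleR_eq_one_of_le (τ := τ) h (by linarith))
  obtain ⟨e1', e2'⟩ := fam_eq_of_scaleR (scaleR_eq_one_of_le (τ := τ) h' (by linarith))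
  rw [e1, e1'] at hX
  rw [e2, e2'] at hY
  have hp := scaleL_pos (τ := τ) h
  have hp' := scaleL_pos (τ := τ) h'
  have hX' : scaleL τ c s * (xPlane c + 4) = scaleL τ c' s' * (xPlane c' + 4) := by
    unfold xMid at hX
    linarith
  unfold yMid at hY
  have hcross : (xPlane c + 4) * yPlane s' = (xPlane c' + 4) * yPlane s := by
    refine mul_left_cancel₀ (mul_pos hp hp').ne' ?_
    linear_combination (scaleL τ c' s' * yPlane s') * hX' - scaleL τ c' s' * (xPlane c' + 4) * hY
  rw [yPlane_eq h, yPlane_eq h'] at hY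
  have hq : 10 - 16 * c ^ 2 < 0 := by nlinarith [sq_sqrt58]
  have hq' : 10 - 16 * c' ^ 2 < 0 := by nlinarith [sq_sqrt58]
  have ha := mul_neg_of_pos_of_neg hp hq
  have ha' := mul_neg_of_pos_of_neg hp' hq'
  have hY' : scaleL τ c s * (10 - 16 * c ^ 2) * s = scaleL τ c' s' * (10 - 16 * c' ^ 2) * s' := by
    linarith
  rcases lt_trichotomy s 0 with hs | hs | hs
  · have hs' : s' < 0 := by
      by_contra! hn
      have := mul_pos_of_neg_of_neg ha hs
      have := mul_nonpos_of_nonpos_of_nonneg ha'.le hn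
      linarith
    have hodd : ∀ s, yPlane (-s) = -yPlane s := fun s => by unfold yPlane; ring
    obtain ⟨e, e'⟩ := eq_of_left_direction (s := -s) (s' := -s') (by rwa [neg_sq]) (by rwa [neg_sq])
      hc hc' (by linarith) (by linarith) (by rw [hodd, hodd]; linarith)
    exact ⟨e, neg_injective e'⟩
  · rw [hs, mul_zero] at hY'
    have hs' : s' = 0 := by
      rcases mul_eq_zero.mp hY'.symm with h0 | h0
      · exact absurd h0 ha'.ne
      · exact h0
    subst hs hs'
    exact ⟨by nlinarith, rfl⟩
  · have hs' : 0 < s' := by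
      by_contra! hn
      have := mul_neg_of_neg_of_pos ha hs
      have := mul_nonneg_of_nonpos_of_nonpos ha'.le hn
      linarith
    exact eq_of_left_direction h h' hc hc' hs hs' hcross

/-- The norm `100 - 96 c²` determines `c` up to sign, and the abscissa fixes the sign. The ordinate
`s (10 - 16 c²)` then determines `s`, unless `c² = 5/8`. -/
lemma eq_of_plane_eq (h : c ^ 2 + s ^ 2 = 1) (h' : c' ^ 2 + s' ^ 2 = 1)
    (hc : -Real.sqrt (5 / 8) < c) (hx : xPlane c = xPlane c') (hy : yPlane s = yPlane s') :
    (c = c' ∧ s = s') ∨ (c = Real.sqrt (5 / 8) ∧ c' = Real.sqrt (5 / 8) ∧ s' = -s) := by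
  have e := plane_norm h
  rw [hx, hy, plane_norm h'] at e
  have hcc : c' = c := by
    rcases sq_eq_sq_iff_eq_or_eq_neg.mp (by linarith : c' ^ 2 = c ^ 2) with e1 | e1
    · exact e1
    · have : c * (18 - 16 * c ^ 2) = 0 := by
        rw [e1] at hx
        unfold xPlane at hx
        linarith
      rcases mul_eq_zero.mp this with h0 | h0
      · linarith
      · nlinarith [sq_nonneg s]
  subst hcc
  rcases sq_eq_sq_iff_eq_or_eq_neg.mp (by linarith : s' ^ 2 = s ^ 2) with e1 | e1
  · exact .inl ⟨rfl, e1.symm⟩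
  · rw [yPlane_eq h, yPlane_eq h', e1] at hy
    have : s * (10 - 16 * c' ^ 2) = 0 := by linarith
    rcases mul_eq_zero.mp this with h0 | h0
    · exact .inl ⟨rfl, by rw [e1, h0, neg_zero]⟩
    · have hsq : c' ^ 2 = Real.sqrt (5 / 8) ^ 2 := by
        rw [sq_sqrt58]
        linarith
      rcases sq_eq_sq_iff_eq_or_eq_neg.mp hsq with e2 | e2
      · exact .inr ⟨e2, e2, e1⟩
      · linarith

lemma fam_eq_scaleR_mul (h : c ^ 2 + s ^ 2 = 1) (hc : -17 / 20 ≤ c) :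
    xFam τ c s = scaleR τ c s * xPlane c ∧ yFam τ c s = scaleR τ c s * yPlane s := by
  rw [xFam, yFam, xMid_eq h (dentL_eq_zero hc), yMid_eq h (dentL_eq_zero hc)]
  exact ⟨rfl, rfl⟩

/-- The homothety about the origin preserves directions. The signs of the two coordinates place the
other point on the upper arc between the small loops as well, where `eq_of_direction` applies. -/
lemma eq_of_moved (h : c ^ 2 + s ^ 2 = 1) (h' : c' ^ 2 + s' ^ 2 = 1)
    (hc1 : -3 / 4 < c) (hc2 : c < -7 / 10) (hs : 0 < s) (hc' : -Real.sqrt (5 / 8) < c')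
    (hX : xFam τ c s = xFam τ c' s') (hY : yFam τ c s = yFam τ c' s') : c = c' ∧ s = s' := by
  have hk := sqrt58_bounds
  obtain ⟨e1, e2⟩ := fam_eq_scaleR_mul (τ := τ) h (by linarith)
  obtain ⟨e1', e2'⟩ := fam_eq_scaleR_mul (τ := τ) h' (by linarith)
  rw [e1, e1'] at hX
  rw [e2, e2'] at hY
  have hp : 0 < scaleR τ c s := by linarith [one_le_scaleR (τ := τ) h]
  have hp' : 0 < scaleR τ c' s' := by linarith [one_le_scaleR (τ := τ) h']
  have hcross : xPlane c * yPlane s' = xPlane c' * yPlane s := by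
    refine mul_left_cancel₀ (mul_pos hp hp').ne' ?_
    linear_combination (scaleR τ c' s' * yPlane s') * hX - scaleR τ c' s' * xPlane c' * hY
  have hq : 0 < 10 - 16 * c ^ 2 := by nlinarith
  have hx : scaleR τ c' s' * xPlane c' < 0 := by
    rw [← hX]
    exact mul_neg_of_pos_of_neg hp (xPlane_neg (by linarith) (by linarith))
  have hx' : xPlane c' < 0 := by
    by_contra! hn
    exact absurd (mul_nonneg hp'.le hn) (not_le.mpr hx)
  have hc0 : c' < 0 := by
    by_contra! hn
    have : 0 ≤ c' * (18 - 16 * c' ^ 2) := mul_nonneg hn (by nlinarith [sq_nonneg s'])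
    unfold xPlane at hx'
    linarith
  have hq' : 0 < 10 - 16 * c' ^ 2 := by nlinarith [sq_sqrt58]
  have hy : 0 < scaleR τ c' s' * yPlane s' := by
    rw [← hY, yPlane_eq h]
    positivity
  have hs' : 0 < s' := by
    by_contra! hn
    rw [yPlane_eq h'] at hy
    have := mul_nonneg hp'.le (mul_nonneg (neg_nonneg.mpr hn) hq'.le)
    linarith
  exact eq_of_direction h h' (by linarith) (by linarith) hs hs' hcross

lemma ampSq_sqrt_pos (h : c ^ 2 + s ^ 2 = 1) : 0 < Real.sqrt (ampSq τ c s) :=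
  Real.sqrt_pos.mpr (ampSq_pos h)

lemma turn_of_nonpos (hs : s ≤ 0) : turnRe τ c s = 1 ∧ turnIm τ c s = 0 := by
  rw [turnRe, turnIm, gate_eq_zero hs]
  constructor <;> ring

lemma turn_of_pos (hc1 : -17 / 20 ≤ c) (hc2 : c ≤ -3 / 4) (hs : 2 / 5 ≤ s) :
    turnRe τ c s = Real.cos (2 * Real.pi * τ) ∧ turnIm τ c s = Real.sin (2 * Real.pi * τ) := by
  rw [turnRe, turnIm, gate_eq_one hs, cutL_eq_one hc1, cutR_eq_one hc2]
  constructor <;> ring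

/-- Over the left double point, `(z, w)` is a positive multiple of `(cos 2πτ, sin 2πτ)` on the upper
branch and of `(1, 0)` on the lower one. -/
lemma cos_eq_one_of_opposite (h : (-Real.sqrt (5 / 8)) ^ 2 + s ^ 2 = 1) (hs : 0 < s)
    (hZ : zFam τ (-Real.sqrt (5 / 8)) s = zFam τ (-Real.sqrt (5 / 8)) (-s))
    (hW : wFam τ (-Real.sqrt (5 / 8)) s = wFam τ (-Real.sqrt (5 / 8)) (-s)) :
    Real.cos (2 * Real.pi * τ) = 1 := by
  have hk := sqrt58_bounds
  have hs2 : s ^ 2 = 3 / 8 := by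
    rw [neg_sq, sq_sqrt58] at h
    linarith
  obtain ⟨e1, e2⟩ := turn_of_pos (τ := τ) (c := -Real.sqrt (5 / 8)) (s := s) (by linarith)
    (by linarith) (by nlinarith)
  obtain ⟨e1', e2'⟩ := turn_of_nonpos (τ := τ) (c := -Real.sqrt (5 / 8)) (s := -s) (by linarith)
  rw [zFam, zFam, e1, e1'] at hZ
  rw [wFam, wFam, e2, e2', zero_mul] at hW
  have ha := ampSq_sqrt_pos (τ := τ) h
  have ha' := ampSq_sqrt_pos (τ := τ) (c := -Real.sqrt (5 / 8)) (s := -s) (by rwa [neg_sq (a := s)])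
  have hsin : Real.sin (2 * Real.pi * τ) = 0 := by
    rcases mul_eq_zero.mp hW with h0 | h0
    · exact h0
    · exact absurd h0 ha.ne'
  have hpos : 0 < Real.cos (2 * Real.pi * τ) := by
    by_contra! hn
    have := mul_nonpos_of_nonpos_of_nonneg hn ha.le
    linarith
  have := Real.sin_sq_add_cos_sq (2 * Real.pi * τ)
  rw [hsin] at this
  nlinarith

/-- The self-intersections of the curves of the family. -/
theorem famVec_eq_cases (h : c ^ 2 + s ^ 2 = 1) (h' : c' ^ 2 + s' ^ 2 = 1)
    (he : famVec τ c s = famVec τ c' s') : (c = c' ∧ s = s') ∨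
      (c = Real.sqrt (5 / 8) ∧ c' = Real.sqrt (5 / 8) ∧ s' = -s) ∨
      (c = -Real.sqrt (5 / 8) ∧ c' = -Real.sqrt (5 / 8) ∧ s' = -s ∧
        Real.cos (2 * Real.pi * τ) = 1) := by
  have hX : xFam τ c s = xFam τ c' s' := congrArg (fun p : E4 => p 0) he
  have hY : yFam τ c s = yFam τ c' s' := congrArg (fun p : E4 => p 1) he
  have hZ : zFam τ c s = zFam τ c' s' := congrArg (fun p : E4 => p 2) he
  have hW : wFam τ c s = wFam τ c' s' := congrArg (fun p : E4 => p 3) he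
  have hN := fam_power_cases τ h
  have hN' := fam_power_cases τ h'
  rw [← hX, ← hY] at hN'
  -- Equal points have equal powers, so both parameters lie inside the loop, at its ends, or
  -- outside; the mixed cases are excluded.
  rcases hN with ⟨hc, hn⟩ | ⟨hc, hn⟩ | ⟨hc, hn⟩ <;>
    rcases hN' with ⟨hc', hn'⟩ | ⟨hc', hn'⟩ | ⟨hc', hn'⟩ <;> try (exfalso; linarith)
  · exact .inl (eq_of_fam_eq_left h h' hc hc' hX hY)
  · subst hc hc'
    rcases sq_eq_sq_iff_eq_or_eq_neg.mp (by linarith : s' ^ 2 = s ^ 2) with e1 | e1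
    · exact .inl ⟨rfl, e1.symm⟩
    · refine .inr (.inr ⟨rfl, rfl, e1, ?_⟩)
      subst e1
      rcases lt_trichotomy s 0 with hs | hs | hs
      · refine cos_eq_one_of_opposite (s := -s) h' (by linarith) ?_ ?_
        · rw [neg_neg, hZ]
        · rw [neg_neg, hW]
      · rw [hs, neg_sq, sq_sqrt58] at h
        norm_num at h
      · exact cos_eq_one_of_opposite h hs hZ hW
  · rcases moved_cases τ h with h1 | ⟨h1, h2, h3⟩
    · rcases moved_cases τ h' with h1' | ⟨h1', h2', h3'⟩
      · have hk := sqrt58_bounds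
        obtain ⟨e1, e2⟩ := fam_eq_scaleR_mul (τ := τ) h (by linarith)
        obtain ⟨e1', e2'⟩ := fam_eq_scaleR_mul (τ := τ) h' (by linarith)
        rw [e1, e1', h1, h1', one_mul, one_mul] at hX
        rw [e2, e2', h1, h1', one_mul, one_mul] at hY
        rcases eq_of_plane_eq h h' hc hX hY with e | e
        · exact .inl e
        · exact .inr (.inl e)
      · obtain ⟨e, e'⟩ := eq_of_moved h' h h1' h2' h3' hc hX.symm hY.symm
        exact .inl ⟨e.symm, e'.symm⟩
    · exact .inl (eq_of_moved h h' h1 h2 h3 hc' hX hY)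

end SelfIntersections

end KnotSS

end

noncomputable section

namespace KnotSS

open Topology Filter

/-! ### Immersion and transversality; the given curve is generic -/

section Immersions

lemma lift_famCurve (τ : ℝ) :
    lift (famCurve τ) = fun t => famVec τ (Real.cos t) (Real.sin t) :=
  funext fun t => famCurve_exp τ t

lemma hasDerivAt_coord {f : ℝ → E4} {v : E4} {t : ℝ} (h : HasDerivAt f v t) (i : Fin 4) :
    HasDerivAt (fun t => f t i) (v i) t :=
  (EuclideanSpace.proj (𝕜 := ℝ) i).hasFDerivAt.comp_hasDerivAt t h

lemma hasDerivAt_lift_famCurve (τ t : ℝ) :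
    HasDerivAt (lift (famCurve τ)) (deriv (lift (famCurve τ)) t) t :=
  ((contDiff_lift_famCurve τ).differentiable (by simp) t).hasDerivAt

lemma hasDerivAt_xFam (τ t : ℝ) : HasDerivAt (fun t => xFam τ (Real.cos t) (Real.sin t))
    (deriv (lift (famCurve τ)) t 0) t := by
  have h := hasDerivAt_coord (hasDerivAt_lift_famCurve τ t) 0
  simp only [lift_famCurve] at h ⊢
  exact h

lemma hasDerivAt_yFam (τ t : ℝ) : HasDerivAt (fun t => yFam τ (Real.cos t) (Real.sin t))
    (deriv (lift (famCurve τ)) t 1) t := by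
  have h := hasDerivAt_coord (hasDerivAt_lift_famCurve τ t) 1
  simp only [lift_famCurve] at h ⊢
  exact h

/-- The velocity of the planar projection where the curve is not deformed. -/
lemma deriv_lift_undented {τ t : ℝ} (h : ∀ᶠ v in 𝓝 t,
    dentL τ (Real.cos v) (Real.sin v) = 0 ∧ dentR τ (Real.cos v) (Real.sin v) = 0) :
    deriv (lift (famCurve τ)) t 0 = xDer t ∧ deriv (lift (famCurve τ)) t 1 = yDer t := by
  constructor
  · refine (hasDerivAt_xFam τ t).unique ((hasDerivAt_xPlane t).congr_of_eventuallyEq ?_)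
    filter_upwards [h] with v hv
    exact xFam_eq (Real.cos_sq_add_sin_sq v) hv.1 hv.2
  · refine (hasDerivAt_yFam τ t).unique ((hasDerivAt_yPlane t).congr_of_eventuallyEq ?_)
    filter_upwards [h] with v hv
    exact yFam_eq (Real.cos_sq_add_sin_sq v) hv.1 hv.2

lemma eventually_undented (τ : ℝ) {t : ℝ} (h : -7 / 10 < Real.cos t) : ∀ᶠ v in 𝓝 t,
    dentL τ (Real.cos v) (Real.sin v) = 0 ∧ dentR τ (Real.cos v) (Real.sin v) = 0 := by
  filter_upwards [Real.continuous_cos.continuousAt.eventually (lt_mem_nhds h)] with v hv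
  exact ⟨dentL_eq_zero (by linarith), dentR_eq_zero' hv.le⟩

/-- In the last case `cos² = 3/8` and `sin² = 1/8`, whose sum is not `1`. -/
lemma der_ne_zero {t : ℝ} (hx : xDer t = 0) (hy : yDer t = 0) : False := by
  have hs := Real.sin_sq_add_cos_sq t
  rcases mul_eq_zero.mp hx with h | h <;> rcases mul_eq_zero.mp hy with h' | h'
  · rw [h, h'] at hs
    norm_num at hs
  · rw [h] at h'
    norm_num at h'
  · rw [h'] at h
    norm_num at h
  · linarith

lemma fam_eq_scaleL_mul {τ c s : ℝ} (h : c ^ 2 + s ^ 2 = 1) (hc : c ≤ -3 / 4) :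
    xFam τ c s + 4 = scaleL τ c s * (xPlane c + 4) ∧ yFam τ c s = scaleL τ c s * yPlane s := by
  obtain ⟨e1, e2⟩ := fam_eq_of_scaleR (scaleR_eq_one_of_le (τ := τ) h hc)
  rw [e1, e2, xMid]
  exact ⟨by ring, rfl⟩

/-- A plane curve which is locally a positive multiple of a curve turning about the origin is
immersed. -/
lemma turning_ne_zero {X Y f g ρ : ℝ → ℝ} {f' g' t : ℝ} (hX : HasDerivAt X 0 t)
    (hY : HasDerivAt Y 0 t) (hf : HasDerivAt f f' t) (hg : HasDerivAt g g' t) (hρ : ρ t ≠ 0)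
    (hXf : ∀ᶠ v in 𝓝 t, X v = ρ v * f v ∧ Y v = ρ v * g v) (hW : f' * g t - f t * g' ≠ 0) :
    False := by
  have h1 := (hX.mul hg).sub (hY.mul hf)
  have h2 : HasDerivAt (X * g - Y * f) 0 t := by
    refine (hasDerivAt_const t (0 : ℝ)).congr_of_eventuallyEq ?_
    filter_upwards [hXf] with v hv
    show X v * g v - Y v * f v = 0
    rw [hv.1, hv.2]
    ring
  have e := h1.unique h2
  obtain ⟨e1, e2⟩ := hXf.self_of_nhds
  rw [e1, e2] at e
  refine hW (mul_left_cancel₀ hρ ?_)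
  linear_combination -e

/-- For `cos t < -3/4` the planar curve turns about the left hole, for `-3/4 ≤ cos t ≤ -7/10` it
turns about the origin, and beyond that it is undeformed. -/
lemma isImmersion_famCurve (τ : ℝ) : IsImmersion (famCurve τ) := by
  refine ⟨contDiff_lift_famCurve τ, fun t h0 => ?_⟩
  have hX := hasDerivAt_xFam τ t
  have hY := hasDerivAt_yFam τ t
  have hcs := Real.cos_sq_add_sin_sq t
  have hlt : ∀ b, Real.cos t < b → ∀ᶠ v in 𝓝 t, Real.cos v < b := fun b hb =>
    Real.continuous_cos.continuousAt.eventually (gt_mem_nhds hb)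
  have hgt : ∀ b, b < Real.cos t → ∀ᶠ v in 𝓝 t, b < Real.cos v := fun b hb =>
    Real.continuous_cos.continuousAt.eventually (lt_mem_nhds hb)
  rcases lt_or_ge (Real.cos t) (-3 / 4) with hc | hc
  · rw [h0] at hX hY
    refine turning_ne_zero (hX.add_const 4) hY ((hasDerivAt_xPlane t).add_const 4)
      (hasDerivAt_yPlane t) (ρ := fun t => scaleL τ (Real.cos t) (Real.sin t))
      (scaleL_pos hcs).ne' ?_ ?_
    · filter_upwards [hlt _ hc] with v hv
      exact fam_eq_scaleL_mul (Real.cos_sq_add_sin_sq v) hv.le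
    · rw [wronskian_left]
      exact (wronskian_left_neg (Real.neg_one_le_cos t) hc.le).ne
  rcases lt_or_ge (-7 / 10) (Real.cos t) with hc' | hc'
  · obtain ⟨e1, e2⟩ := deriv_lift_undented (eventually_undented τ hc')
    rw [h0] at e1 e2
    exact der_ne_zero e1.symm e2.symm
  · rw [h0] at hX hY
    refine turning_ne_zero hX hY (hasDerivAt_xPlane t)
      (hasDerivAt_yPlane t) (ρ := fun t => scaleR τ (Real.cos t) (Real.sin t))
      (by linarith [one_le_scaleR (τ := τ) hcs]) ?_ ?_
    · filter_upwards [hgt (-17 / 20) (by linarith)] with v hv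
      exact fam_eq_scaleR_mul (Real.cos_sq_add_sin_sq v) hv.le
    · rw [wronskian]
      nlinarith

lemma linearIndependent_of_cross {a b : E4} (h : a 0 * b 1 - a 1 * b 0 ≠ 0) :
    LinearIndependent ℝ ![a, b] := by
  rw [LinearIndependent.pair_iff]
  intro p q hpq
  have h0 : p * a 0 + q * b 0 = 0 := by simpa using congrArg (fun v : E4 => v 0) hpq
  have h1 : p * a 1 + q * b 1 = 0 := by simpa using congrArg (fun v : E4 => v 1) hpq
  constructor
  · refine (mul_eq_zero.mp ?_).resolve_right h
    linear_combination b 1 * h0 - b 0 * h1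
  · refine (mul_eq_zero.mp ?_).resolve_right h
    linear_combination a 0 * h1 - a 1 * h0

/-- The branches of a planar self-intersection are transverse. -/
lemma cross_der_ne_zero {u v : ℝ} (hu : Real.cos u ^ 2 = 5 / 8) (hc : Real.cos v = Real.cos u)
    (hs : Real.sin v = -Real.sin u) : xDer u * yDer v - yDer u * xDer v ≠ 0 := by
  have hs2 : Real.sin u ^ 2 = 3 / 8 := by
    rw [Real.sin_sq, hu]
    norm_num
  have e : xDer u * yDer v - yDer u * xDer v = 288 * Real.sin u * Real.cos u := by
    unfold xDer yDer
    rw [hc, hs, neg_sq, hs2, hu]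
    ring
  rw [e]
  have h1 : Real.sin u ≠ 0 := by
    intro h
    rw [h] at hs2
    norm_num at hs2
  have h2 : Real.cos u ≠ 0 := by
    intro h
    rw [h] at hu
    norm_num at hu
  positivity

lemma deriv_lift_zero (t : ℝ) :
    deriv (lift (famCurve 0)) t 0 = xDer t ∧ deriv (lift (famCurve 0)) t 1 = yDer t :=
  deriv_lift_undented (Eventually.of_forall fun _ => ⟨dentL_zero, dentR_zero⟩)

lemma transverse_famCurve (τ : ℝ) : LinearIndependent ℝ
    ![deriv (lift (famCurve τ)) (-loopAngle), deriv (lift (famCurve τ)) loopAngle] := by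
  have hk := sqrt58_bounds
  obtain ⟨e1, e2⟩ := deriv_lift_undented
    (eventually_undented τ (t := loopAngle) (by rw [cos_loopAngle]; linarith))
  obtain ⟨e3, e4⟩ := deriv_lift_undented
    (eventually_undented τ (t := -loopAngle) (by rw [Real.cos_neg, cos_loopAngle]; linarith))
  refine linearIndependent_of_cross ?_
  rw [e1, e2, e3, e4]
  exact cross_der_ne_zero (by rw [Real.cos_neg, cos_loopAngle, sq_sqrt58]) (by rw [Real.cos_neg])
    (by rw [Real.sin_neg, neg_neg])

lemma figChords_coords (k : Fin 2) : ((figChords k).1 : ℂ).re ^ 2 = 5 / 8 ∧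
    ((figChords k).2 : ℂ).re = ((figChords k).1 : ℂ).re ∧
    ((figChords k).2 : ℂ).im = -((figChords k).1 : ℂ).im := by
  fin_cases k
  · refine ⟨?_, ?_, ?_⟩
    · exact sq_sqrt58
    · rfl
    · exact (neg_neg _).symm
  · refine ⟨?_, ?_, ?_⟩
    · show (-Real.sqrt (5 / 8)) ^ 2 = _
      rw [neg_sq, sq_sqrt58]
    · rfl
    · rfl

lemma sym2_eq_figChords {k : Fin 2} {u v : Circle} (hu : (u : ℂ).re = ((figChords k).1 : ℂ).re)
    (hv : (v : ℂ).re = ((figChords k).1 : ℂ).re) (hi : (v : ℂ).im = -(u : ℂ).im) :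
    s(u, v) = s((figChords k).1, (figChords k).2) := by
  obtain ⟨-, h2, h3⟩ := figChords_coords k
  have e1 := circle_sq u
  have e2 := circle_sq (figChords k).1
  rw [hu] at e1
  rcases sq_eq_sq_iff_eq_or_eq_neg.mp
    (by linarith : (u : ℂ).im ^ 2 = ((figChords k).1 : ℂ).im ^ 2) with h | h
  · rw [circle_ext hu h, circle_ext (u := v) (v := (figChords k).2) (by rw [hv, h2])
      (by rw [hi, h3, h])]
  · rw [circle_ext (u := u) (v := (figChords k).2) (by rw [hu, h2]) (by rw [h3, h]),
      circle_ext (u := v) (v := (figChords k).1) hv (by rw [hi, h, neg_neg]), Sym2.eq_swap]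

/-- The self-intersections of the curves of the family. -/
lemma famCurve_eq_cases {τ : ℝ} {u v : Circle} (h : famCurve τ u = famCurve τ v) :
    u = v ∨ s(u, v) = s((figChords 0).1, (figChords 0).2) ∨
      (s(u, v) = s((figChords 1).1, (figChords 1).2) ∧ Real.cos (2 * Real.pi * τ) = 1) := by
  rcases famVec_eq_cases (circle_sq u) (circle_sq v) (congrArg Subtype.val h) with
    ⟨h1, h2⟩ | ⟨h1, h2, h3⟩ | ⟨h1, h2, h3, h4⟩
  · exact .inl (circle_ext h1 h2)
  · exact .inr (.inl (sym2_eq_figChords h1 h2 h3))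
  · exact .inr (.inr ⟨sym2_eq_figChords h1 h2 h3, h4⟩)

lemma isGeneric_fig : IsGeneric fig := by
  show IsImmersion figCurve ∧ _ ∧ _
  refine ⟨famCurve_zero ▸ isImmersion_famCurve 0, fun u v h => ?_, fun k u v hu hv => ?_⟩
  · change figCurve u = figCurve v at h
    rw [← famCurve_zero] at h
    rcases famCurve_eq_cases h with h | h | h
    · exact .inl h
    · exact .inr ⟨0, h⟩
    · exact .inr ⟨1, h.1⟩
  · change LinearIndependent ℝ ![deriv (lift figCurve) u, deriv (lift figCurve) v]
    change Circle.exp u = (figChords k).1 at hu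
    change Circle.exp v = (figChords k).2 at hv
    obtain ⟨h1, h2, h3⟩ := figChords_coords k
    rw [← hu, ← hv, exp_re, exp_re] at h2
    rw [← hu, ← hv, exp_im, exp_im] at h3
    rw [← hu, exp_re] at h1
    rw [← famCurve_zero]
    refine linearIndependent_of_cross ?_
    rw [(deriv_lift_zero u).1, (deriv_lift_zero u).2, (deriv_lift_zero v).1, (deriv_lift_zero v).2]
    exact cross_der_ne_zero h1 h2 h3

lemma not_crossing_fig : ¬ Crossing fig := by
  have ha := loopAngle_pos
  have ha' := loopAngle_lt
  have h : ∀ k, Circle.exp (chordStart k) = (fig.1.1 k).1 ∧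
      Circle.exp (chordEnd k) = (fig.1.1 k).2 := fun k => by
    change _ = (figChords k).1 ∧ _ = (figChords k).2
    rw [← exp_chords]
    exact ⟨rfl, rfl⟩
  rw [crossing_iff, chordSign_eq fig.1 (h 0).1 (h 0).2 (h 1).1 (h 1).2, not_lt]
  change 0 ≤ 16 * (Real.sin ((-loopAngle - (Real.pi - loopAngle)) / 2) *
    Real.sin ((loopAngle - (Real.pi + loopAngle)) / 2) *
    (Real.sin ((-loopAngle - (Real.pi + loopAngle)) / 2) *
      Real.sin ((loopAngle - (Real.pi - loopAngle)) / 2)))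
  have s1 : ∀ t, -Real.pi < t → t < 0 → Real.sin t < 0 :=
    fun t h1 h2 => Real.sin_neg_of_neg_of_neg_pi_lt h2 h1
  have hpi := Real.pi_pos
  have h1 := mul_pos_of_neg_of_neg
    (s1 ((-loopAngle - (Real.pi - loopAngle)) / 2) (by linarith) (by linarith))
    (s1 ((loopAngle - (Real.pi + loopAngle)) / 2) (by linarith) (by linarith))
  have h2 := mul_pos_of_neg_of_neg
    (s1 ((-loopAngle - (Real.pi + loopAngle)) / 2) (by linarith) (by linarith))
    (s1 ((loopAngle - (Real.pi - loopAngle)) / 2) (by linarith) (by linarith))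
  positivity

end Immersions

end KnotSS

end

noncomputable section

namespace KnotSS

open Topology Filter

/-! ### The velocity of the family at the additional self-intersection -/

section Jump

lemma wFam_zero (c s : ℝ) : wFam 0 c s = 0 := by simp [wFam, turnIm]

lemma deriv_lift_zero_three (t : ℝ) : deriv (lift (famCurve 0)) t 3 = 0 := by
  have h := hasDerivAt_coord (hasDerivAt_lift_famCurve 0 t) 3
  refine h.unique ((hasDerivAt_const t (0 : ℝ)).congr_of_eventuallyEq (Eventually.of_forall ?_))
  intro v
  show lift (famCurve 0) v 3 = 0
  rw [lift_famCurve]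
  exact wFam_zero _ _

/-- The gradient of the defining function is orthogonal to the curves on `M`. -/
lemma inner_gradient_deriv_lift {φ : C(Circle, M)} (hφ : ContDiff ℝ ∞ (lift φ)) (t : ℝ) :
    inner ℝ (gradient defFun (φ (Circle.exp t) : E4)) (deriv (lift φ) t) = 0 := by
  have hd : DifferentiableAt ℝ defFun (φ (Circle.exp t) : E4) :=
    contDiff_defFun.differentiable (by simp) _
  have h1 : HasDerivAt (lift φ) (deriv (lift φ) t) t :=
    (hφ.differentiable (by simp) t).hasDerivAt
  have h2 := hd.hasFDerivAt.comp_hasDerivAt_of_eq t h1 rfl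
  have h3 : HasDerivAt (defFun ∘ lift φ) 0 t :=
    (hasDerivAt_const t (0 : ℝ)).congr_of_eventuallyEq
      (Eventually.of_forall fun v => (φ (Circle.exp v)).2)
  rw [gradient, InnerProductSpace.toDual_symm_apply]
  exact h2.unique h3

lemma gradient_two (p : E4) : gradient defFun p 2 = 2 * p 2 := by
  have hd : DifferentiableAt ℝ defFun p := contDiff_defFun.differentiable (by simp) _
  have e : gradient defFun p 2 = fderiv ℝ defFun p (EuclideanSpace.single 2 1) := by
    have h : inner ℝ (gradient defFun p) (EuclideanSpace.single 2 1) =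
        fderiv ℝ defFun p (EuclideanSpace.single 2 1) := InnerProductSpace.toDual_symm_apply
    rw [← h, EuclideanSpace.inner_single_right]
    simp
  rw [e]
  have h1 : HasDerivAt (fun t : ℝ => p + t • EuclideanSpace.single (2 : Fin 4) (1 : ℝ))
      (EuclideanSpace.single 2 1) 0 := by
    simpa using ((hasDerivAt_id (0 : ℝ)).smul_const
      (EuclideanSpace.single (2 : Fin 4) (1 : ℝ))).const_add p
  have h2 := hd.hasFDerivAt.comp_hasDerivAt_of_eq (0 : ℝ) h1 (by simp)
  refine h2.unique ?_
  have h3 : (defFun ∘ fun t : ℝ => p + t • EuclideanSpace.single (2 : Fin 4) (1 : ℝ)) =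
      fun t => (p 2 + t) ^ 2 + p 3 ^ 2 - outline (p 0) (p 1) := by
    funext t
    simp [defFun]
  rw [h3]
  have h4 := ((((hasDerivAt_id (0 : ℝ)).const_add (p 2)).fun_pow 2).add_const (p 3 ^ 2)).sub_const
    (outline (p 0) (p 1))
  refine h4.congr_deriv ?_
  simp

/-- Linear algebra behind the transversality of the loop at the moment of the jump. -/
lemma det_ne_zero_of_tangent {G v₁ v₂ v₃ : E4} (h1 : inner ℝ G v₁ = 0) (h2 : inner ℝ G v₂ = 0)
    (e1 : v₁ 3 = 0) (e2 : v₂ 3 = 0) (hG : G 2 ≠ 0) (hv : v₁ 0 * v₂ 1 - v₁ 1 * v₂ 0 ≠ 0)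
    (f0 : v₃ 0 = 0) (f1 : v₃ 1 = 0) (f2 : v₃ 2 = 0) (f3 : v₃ 3 ≠ 0) :
    Matrix.det (Matrix.of fun i j : Fin 4 => (![G, v₁, v₂, v₃] i : E4) j) ≠ 0 := by
  have g1 : G 0 * v₁ 0 + G 1 * v₁ 1 + G 2 * v₁ 2 = 0 := by
    rw [PiLp.inner_apply, Fin.sum_univ_four] at h1
    simp only [RCLike.inner_apply, conj_trivial, e1] at h1
    linarith
  have g2 : G 0 * v₂ 0 + G 1 * v₂ 1 + G 2 * v₂ 2 = 0 := by
    rw [PiLp.inner_apply, Fin.sum_univ_four] at h2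
    simp only [RCLike.inner_apply, conj_trivial, e2] at h2
    linarith
  have hdet : Matrix.det (Matrix.of fun i j : Fin 4 => (![G, v₁, v₂, v₃] i : E4) j) =
      v₃ 3 * (G 0 * (v₁ 1 * v₂ 2 - v₁ 2 * v₂ 1) - G 1 * (v₁ 0 * v₂ 2 - v₁ 2 * v₂ 0) +
        G 2 * (v₁ 0 * v₂ 1 - v₁ 1 * v₂ 0)) := by
    simp [Matrix.det_succ_row_zero, Fin.sum_univ_succ, Fin.succAbove, e1, e2, f0, f1, f2]
    ring
  intro h
  rw [hdet] at h
  have h' := (mul_eq_zero.mp h).resolve_left f3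
  -- In the space of the first three coordinates, `v₁ × v₂` is parallel to `G`. Hence its third
  -- component times `|G|²` equals `G 2` times the triple product, which is assumed to vanish.
  have hn : (v₁ 0 * v₂ 1 - v₁ 1 * v₂ 0) * (G 0 ^ 2 + G 1 ^ 2 + G 2 ^ 2) = 0 := by
    linear_combination (G 2) * h' + (v₂ 1 * G 0 - v₂ 0 * G 1) * g1 -
      (v₁ 1 * G 0 - v₁ 0 * G 1) * g2
  rcases mul_eq_zero.mp hn with h0 | h0
  · exact hv h0
  · have : 0 < G 2 ^ 2 := by positivity
    nlinarith [sq_nonneg (G 0), sq_nonneg (G 1)]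

/-- The abscissas of the self-intersection at the left hole are at the common end of both cutoffs. -/
lemma sqrt58_zone : -17 / 20 ≤ -Real.sqrt (5 / 8) ∧ -Real.sqrt (5 / 8) ≤ -3 / 4 := by
  have hk := sqrt58_bounds
  constructor <;> linarith

/-- Both cutoffs equal `1` at this abscissa, so there are no dents: the planar point and the
amplitude do not depend on `τ`, and only the multiplier does. -/
lemma famVec_turning {s : ℝ} (h : (-Real.sqrt (5 / 8)) ^ 2 + s ^ 2 = 1) (τ : ℝ) :
    famVec τ (-Real.sqrt (5 / 8)) s = !₂[xPlane (-Real.sqrt (5 / 8)), yPlane s,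
      turnRe τ (-Real.sqrt (5 / 8)) s * Real.sqrt (ampSq 0 (-Real.sqrt (5 / 8)) s),
      turnIm τ (-Real.sqrt (5 / 8)) s * Real.sqrt (ampSq 0 (-Real.sqrt (5 / 8)) s)] := by
  obtain ⟨h1, h2⟩ := sqrt58_zone
  have eL : ∀ τ, dentL τ (-Real.sqrt (5 / 8)) s = 0 := fun τ => dentL_eq_zero h1
  have eR : ∀ τ, dentR τ (-Real.sqrt (5 / 8)) s = 0 := fun τ => dentR_eq_zero h2
  have ea : ampSq τ (-Real.sqrt (5 / 8)) s = ampSq 0 (-Real.sqrt (5 / 8)) s := by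
    simp only [ampSq, powerFam, holesFam, normMid_eq h (eL _), scaleR_eq_one h (eR _),
      xMid_eq h (eL _), xFam_eq h (eL _) (eR _), yFam_eq h (eL _) (eR _)]
  rw [famVec, zFam, wFam, xFam_eq h (eL _) (eR _), yFam_eq h (eL _) (eR _), ea]

lemma left_point : (-Real.sqrt (5 / 8)) ^ 2 + Real.sqrt (3 / 8) ^ 2 = 1 := by
  rw [neg_sq]
  exact sq_add_sq_58

lemma left_point_neg : (-Real.sqrt (5 / 8)) ^ 2 + (-Real.sqrt (3 / 8)) ^ 2 = 1 := by
  rw [neg_sq (Real.sqrt (3 / 8))]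
  exact left_point

lemma two_fifths_le : 2 / 5 ≤ Real.sqrt (3 / 8) := Real.le_sqrt_of_sq_le (by norm_num)

lemma famCurve_upper (τ : ℝ) : (famCurve τ (Circle.exp (Real.pi - loopAngle)) : E4) =
    !₂[xPlane (-Real.sqrt (5 / 8)), yPlane (Real.sqrt (3 / 8)),
      Real.cos (2 * Real.pi * τ) *
        Real.sqrt (ampSq 0 (-Real.sqrt (5 / 8)) (Real.sqrt (3 / 8))),
      Real.sin (2 * Real.pi * τ) *
        Real.sqrt (ampSq 0 (-Real.sqrt (5 / 8)) (Real.sqrt (3 / 8)))] := by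
  rw [famCurve_exp, Real.cos_pi_sub, Real.sin_pi_sub, cos_loopAngle, sin_loopAngle,
    famVec_turning left_point, (turn_of_pos sqrt58_zone.1 sqrt58_zone.2 two_fifths_le).1,
    (turn_of_pos sqrt58_zone.1 sqrt58_zone.2 two_fifths_le).2]

lemma famCurve_lower (τ : ℝ) : (famCurve τ (Circle.exp (Real.pi + loopAngle)) : E4) =
    famCurve 0 (Circle.exp (Real.pi + loopAngle)) := by
  have hs : -Real.sqrt (3 / 8) ≤ 0 := by linarith [two_fifths_le]
  have h : ∀ τ, (famCurve τ (Circle.exp (Real.pi + loopAngle)) : E4) =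
      famVec τ (-Real.sqrt (5 / 8)) (-Real.sqrt (3 / 8)) := fun τ => by
    rw [famCurve_exp, add_comm, Real.cos_add_pi, Real.sin_add_pi, cos_loopAngle, sin_loopAngle]
  rw [h, h, famVec_turning left_point_neg, famVec_turning left_point_neg, (turn_of_nonpos hs).1,
    (turn_of_nonpos hs).2, (turn_of_nonpos hs).1, (turn_of_nonpos hs).2]

lemma hasDerivAt_famCurve_upper :
    HasDerivAt (fun τ => (famCurve τ (Circle.exp (Real.pi - loopAngle)) : E4))
      !₂[0, 0, 0, 2 * Real.pi * Real.sqrt (ampSq 0 (-Real.sqrt (5 / 8)) (Real.sqrt (3 / 8)))]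
      0 := by
  simp only [famCurve_upper]
  have hl : HasDerivAt (fun τ : ℝ => 2 * Real.pi * τ) (2 * Real.pi) 0 := by
    simpa using (hasDerivAt_id (0 : ℝ)).const_mul (2 * Real.pi)
  rw [hasDerivAt_iff_hasFDerivAt, ← hasFDerivWithinAt_univ, hasFDerivWithinAt_euclidean]
  intro i
  rw [hasFDerivWithinAt_univ]
  refine HasFDerivAt.congr_fderiv (f' := (ContinuousLinearMap.toSpanSingleton ℝ ((!₂[0, 0, 0,
    2 * Real.pi * Real.sqrt (ampSq 0 (-Real.sqrt (5 / 8)) (Real.sqrt (3 / 8)))] : E4) i))) ?_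
    (by ext; simp)
  refine HasDerivAt.hasFDerivAt ?_
  fin_cases i
  · exact hasDerivAt_const _ _
  · exact hasDerivAt_const _ _
  · simpa using hl.cos.mul_const (Real.sqrt (ampSq 0 (-Real.sqrt (5 / 8)) (Real.sqrt (3 / 8))))
  · simpa using hl.sin.mul_const (Real.sqrt (ampSq 0 (-Real.sqrt (5 / 8)) (Real.sqrt (3 / 8))))

end Jump

end KnotSS

end

noncomputable section

namespace KnotSS

open Topology Filter

/-! ### The generic loop and the value of the differential on it -/

section GenericLoop

/-- At `τ = 0` the curve lies in `{w = 0}` with transverse planar branches, and the relative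
velocity of the branches points along the `w`-axis. The gradient has the non-zero component `2z`. -/
lemma jump_det_ne_zero : frameDet (famCurve 0 (Circle.exp (Real.pi - loopAngle)))
    (deriv (lift (famCurve 0)) (Real.pi - loopAngle))
    (deriv (lift (famCurve 0)) (Real.pi + loopAngle))
    (deriv (fun τ => (famCurve τ (Circle.exp (Real.pi - loopAngle)) : E4)) 0 -
      deriv (fun τ => (famCurve τ (Circle.exp (Real.pi + loopAngle)) : E4)) 0) ≠ 0 := by
  have ha := ampSq_sqrt_pos (τ := 0) left_point
  have hd : deriv (fun τ => (famCurve τ (Circle.exp (Real.pi + loopAngle)) : E4)) 0 = 0 := by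
    rw [show (fun τ => (famCurve τ (Circle.exp (Real.pi + loopAngle)) : E4)) =
      fun _ => (famCurve 0 (Circle.exp (Real.pi + loopAngle)) : E4) from funext famCurve_lower,
      deriv_const]
  have hp : famCurve 0 (Circle.exp (Real.pi - loopAngle)) =
      famCurve 0 (Circle.exp (Real.pi + loopAngle)) := by
    have h := respects_fig.2 1
    change figCurve (figChords 1).1 = figCurve (figChords 1).2 at h
    rw [← exp_chords, ← famCurve_zero] at h
    exact h
  rw [hd, sub_zero, hasDerivAt_famCurve_upper.deriv]
  refine det_ne_zero_of_tangent (inner_gradient_deriv_lift (contDiff_lift_famCurve 0) _) ?_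
    (deriv_lift_zero_three _) (deriv_lift_zero_three _) ?_ ?_ rfl rfl rfl ?_
  · rw [hp]
    exact inner_gradient_deriv_lift (contDiff_lift_famCurve 0) _
  · rw [gradient_two, famCurve_upper]
    have : (0 : ℝ) < 2 * (Real.cos (2 * Real.pi * 0) *
        Real.sqrt (ampSq 0 (-Real.sqrt (5 / 8)) (Real.sqrt (3 / 8)))) := by
      rw [mul_zero, Real.cos_zero]
      positivity
    exact this.ne'
  · rw [(deriv_lift_zero _).1, (deriv_lift_zero _).2, (deriv_lift_zero _).1,
      (deriv_lift_zero _).2]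
    refine cross_der_ne_zero ?_ ?_ ?_
    · rw [Real.cos_pi_sub, cos_loopAngle, neg_sq, sq_sqrt58]
    · rw [Real.cos_pi_sub, add_comm, Real.cos_add_pi]
    · rw [Real.sin_pi_sub, add_comm, Real.sin_add_pi]
  · show 2 * Real.pi * _ ≠ 0
    have := Real.pi_pos
    positivity

lemma exp_injOn_Ico {s t : ℝ} (hs : 0 ≤ s) (hs' : s < 2 * Real.pi) (ht : 0 ≤ t)
    (ht' : t < 2 * Real.pi) (h : Circle.exp s = Circle.exp t) : s = t := by
  obtain ⟨n, hn⟩ := Circle.exp_eq_exp.mp h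
  have hpi := Real.two_pi_pos
  have h1 : (n : ℝ) < 1 := by
    by_contra! hc
    nlinarith
  have h2 : (-1 : ℝ) < n := by
    by_contra! hc
    nlinarith
  have h3 : n = 0 := by
    have h1' : n < 1 := by exact_mod_cast h1
    have h2' : -1 < n := by exact_mod_cast h2
    omega
  rw [hn, h3]
  simp

/-- The loop of curves with the right chord. -/
def famOneLoop : OneLoop where
  curve := famCurve
  a _ := -loopAngle
  b _ := loopAngle
  smooth_curve := contDiff_famCurve
  smooth_a := contDiff_const
  smooth_b := contDiff_const
  periodic_curve := famCurve_add_one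
  periodic_chord _ := rfl
  distinct τ h := by
    have h1 := congrArg (fun z : Circle => (z : ℂ).im) h
    simp only [exp_im, Real.sin_neg, sin_loopAngle] at h1
    linarith [two_fifths_le]
  respects τ := by
    have h := respects_fig.2 0
    change figCurve (figChords 0).1 = figCurve (figChords 0).2 at h
    rw [← exp_chords] at h
    change figCurve (Circle.exp (-loopAngle)) = figCurve (Circle.exp loopAngle) at h
    rw [← famCurve_zero] at h
    have hk := sqrt58_bounds
    -- The deformation is supported in negative abscissas `c`, so the points of the right chord stay
    -- fixed.
    have key : ∀ t : ℝ, Real.cos t = Real.sqrt (5 / 8) → (famCurve τ (Circle.exp t) : E4) =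
        famCurve 0 (Circle.exp t) := by
      intro t ht
      have hc := Real.cos_sq_add_sin_sq t
      rw [ht] at hc
      have eL : ∀ τ, dentL τ (Real.sqrt (5 / 8)) (Real.sin t) = 0 :=
        fun τ => dentL_eq_zero (by linarith)
      have eR : ∀ τ, dentR τ (Real.sqrt (5 / 8)) (Real.sin t) = 0 :=
        fun τ => dentR_eq_zero' (by linarith)
      have e0 : cutR (Real.sqrt (5 / 8)) = 0 := cutR_eq_zero (by linarith)
      simp only [famCurve_exp, ht, famVec, zFam, wFam, ampSq, powerFam, holesFam, turnRe, turnIm,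
        normMid_eq hc (eL _), scaleR_eq_one hc (eR _), xMid_eq hc (eL _), xFam_eq hc (eL _) (eR _),
        yFam_eq hc (eL _) (eR _), e0, mul_zero, zero_mul]
    refine Subtype.ext ?_
    rw [key _ cos_loopAngle, key _ (by rw [Real.cos_neg, cos_loopAngle]), h]

lemma mem_extra_famOneLoop (q : ℝ × ℝ × ℝ) :
    q ∈ famOneLoop.extra ↔ q = (0, Real.pi - loopAngle, Real.pi + loopAngle) := by
  have ha := loopAngle_pos
  have ha' := loopAngle_lt
  have hchord : ∀ k, s((figChords k).1, (figChords k).2) =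
      s(Circle.exp (chordStart k), Circle.exp (chordEnd k)) := fun k => by
    rw [← exp_chords]
  constructor
  · obtain ⟨τ, s, t⟩ := q
    rintro ⟨hτ, hs, hst, ht, he, hne⟩
    change famCurve τ (Circle.exp s) = famCurve τ (Circle.exp t) at he
    change 0 ≤ s at hs
    change s < t at hst
    change t < 2 * Real.pi at ht
    change 0 ≤ τ ∧ τ < 1 at hτ
    rcases famCurve_eq_cases he with h | h | ⟨h, hc⟩
    · exact absurd (exp_injOn_Ico hs (by linarith) (by linarith) ht h) hst.ne
    · exact absurd (h.trans (hchord 0)) hne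
    -- The left self-intersection is present only when `2πτ` is a multiple of `2π`, which in one
    -- period means `τ = 0`.
    · rw [Real.cos_eq_one_iff_of_lt_of_lt (by nlinarith [Real.pi_pos]) (by nlinarith [Real.pi_pos])]
        at hc
      have hτ0 : τ = 0 := (mul_eq_zero.mp hc).resolve_left Real.two_pi_pos.ne'
      rw [hchord 1] at h
      change s(Circle.exp s, Circle.exp t) =
        s(Circle.exp (Real.pi - loopAngle), Circle.exp (Real.pi + loopAngle)) at h
      rcases Sym2.eq_iff.mp h with ⟨h1, h2⟩ | ⟨h1, h2⟩
      · rw [hτ0, exp_injOn_Ico hs (by linarith) (by linarith) (by linarith) h1,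
          exp_injOn_Ico (by linarith) ht (by linarith) (by linarith) h2]
      · have e1 := exp_injOn_Ico hs (by linarith) (by linarith) (by linarith) h1
        have e2 := exp_injOn_Ico (by linarith) ht (by linarith) (by linarith) h2
        linarith
  · rintro rfl
    refine ⟨⟨le_rfl, zero_lt_one⟩, ?_, ?_, ?_, ?_, ?_⟩
    · show 0 ≤ Real.pi - loopAngle
      linarith
    · show Real.pi - loopAngle < Real.pi + loopAngle
      linarith
    · show Real.pi + loopAngle < 2 * Real.pi
      linarith
    · have h := respects_fig.2 1
      change figCurve (figChords 1).1 = figCurve (figChords 1).2 at h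
      rw [← exp_chords, ← famCurve_zero] at h
      exact h
    · intro h
      change s(Circle.exp (Real.pi - loopAngle), Circle.exp (Real.pi + loopAngle)) =
        s(Circle.exp (-loopAngle), Circle.exp loopAngle) at h
      have hk := sqrt58_bounds
      rcases Sym2.eq_iff.mp h with ⟨h2, -⟩ | ⟨h2, -⟩
      all_goals
        have h3 := congrArg (fun z : Circle => (z : ℂ).re) h2
        simp only [exp_re, Real.cos_pi_sub, Real.cos_neg, cos_loopAngle] at h3
        linarith

lemma extra_chords {q : ℝ × ℝ × ℝ} (hq : q ∈ famOneLoop.extra) :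
    ((![(Circle.exp (famOneLoop.a q.1), Circle.exp (famOneLoop.b q.1)),
      (Circle.exp q.2.1, Circle.exp q.2.2)], famOneLoop.curve q.1) : Pre 2) =
      (figChords, figCurve) := by
  rw [(mem_extra_famOneLoop q).mp hq]
  refine Prod.ext (funext fun k => ?_) famCurve_zero
  refine Eq.trans ?_ (exp_chords k)
  fin_cases k <;> rfl

/-- The loop of curves is generic. -/
def famLoop : GenericLoop where
  toOneLoop := famOneLoop
  immersion := isImmersion_famCurve
  transverse := transverse_famCurve
  finite_extra := (Set.finite_singleton (0, Real.pi - loopAngle, Real.pi + loopAngle)).subset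
    fun q hq => (mem_extra_famOneLoop q).mp hq
  one_at_a_time q hq q' hq' _ := by
    rw [(mem_extra_famOneLoop q).mp hq, (mem_extra_famOneLoop q').mp hq']
  jump_ne_zero q hq := by
    rw [(mem_extra_famOneLoop q).mp hq]
    exact jump_det_ne_zero
  double q := by
    rw [extra_chords q.2]
    exact respects_fig

/-- The sum has one term, and the realization there is the given curve with its two chords in the
given order. -/
lemma breveD1_famLoop (γ : E1) : breveD1 γ famLoop =
    (SignType.sign (famOneLoop.jumpDet (0, Real.pi - loopAngle, Real.pi + loopAngle)) : ℤ) *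
      γ.1 (route fig) := by
  show ∑ᶠ q : famOneLoop.extra, _ = _
  rw [finsum_eq_single _ ⟨_, (mem_extra_famOneLoop _).mpr rfl⟩ fun q hq =>
    absurd (Subtype.ext ((mem_extra_famOneLoop q.1).mp q.2)) hq]
  have e : famLoop.realization ⟨_, (mem_extra_famOneLoop _).mpr rfl⟩ = fig :=
    Subtype.ext (extra_chords ((mem_extra_famOneLoop _).mpr rfl))
  rw [← e]
  rfl

/-- The span is shared by all relatives and has rank 3, too large for a marginal route. -/
lemma not_marginal_of_related_fig {r : Route 2} (h : Related (route fig) r) : ¬ Marginal r := by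
  intro hm
  have h1 := rank_routeSpan_marginal hm
  rw [← routeSpan_related h, routeSpan_route, submoduleRank_fig] at h1
  exact absurd h1 (by norm_num)

end GenericLoop

end KnotSS

end

/-! ### Assembly of the three statements -/

theorem mainTheorem11 :
    -- the curve is an immersion with exactly two transverse self-intersections, trivial diagram
    (KnotSS.IsGeneric KnotSS.fig ∧ ¬ KnotSS.Crossing KnotSS.fig) ∧
    -- no relative is marginal
    (∀ r : KnotSS.Route 2, KnotSS.Related (KnotSS.route KnotSS.fig) r → ¬ KnotSS.Marginal r) ∧
    -- the subgroup generated by the cycles on the curve is invariant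
    (∀ x y : KnotSS.Realization 2, KnotSS.IsGeneric x → KnotSS.IsGeneric y →
      KnotSS.Related (KnotSS.route x) (KnotSS.route y) →
      KnotSS.cycleSubgroup x.1.2 = KnotSS.cycleSubgroup y.1.2) ∧
    -- its rank for the curve, and for marginal routes
    Module.rank ℤ (KnotSS.cycleSubgroup KnotSS.fig.1.2) = 3 ∧
    (∀ x : KnotSS.Realization 2, KnotSS.IsGeneric x → KnotSS.Marginal (KnotSS.route x) →
      Module.rank ℤ (KnotSS.cycleSubgroup x.1.2) ≤ 2) ∧
    -- the element of `E₁^{-2,2}` with non-zero `d¹`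
    ∃ h : KnotSS.gammaFig ∈ KnotSS.E1, KnotSS.breveD1 ⟨KnotSS.gammaFig, h⟩ ≠ 0 := by
  refine ⟨⟨KnotSS.isGeneric_fig, KnotSS.not_crossing_fig⟩,
    fun r => KnotSS.not_marginal_of_related_fig,
    fun x y hx hy h => KnotSS.cycleSubgroup_eq_of_related hx hy h, ?_, fun x hx hm => ?_, ?_⟩
  · rw [KnotSS.rank_cycleSubgroup KnotSS.isGeneric_fig, KnotSS.submoduleRank_fig]
  · rw [KnotSS.rank_cycleSubgroup hx]
    exact KnotSS.rank_routeSpan_marginal hm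
  · refine ⟨KnotSS.gammaFig_mem_E1 (fun r => KnotSS.not_marginal_of_related_fig)
      KnotSS.not_crossing_fig, fun h0 => ?_⟩
    have h1 := congrFun h0 KnotSS.famLoop
    rw [KnotSS.breveD1_famLoop] at h1
    have h2 : KnotSS.gammaFig (KnotSS.route KnotSS.fig) = 1 := if_pos Relation.ReflTransGen.refl
    simp only [h2, mul_one, Pi.zero_apply] at h1
    have h3 : KnotSS.famOneLoop.jumpDet
        (0, Real.pi - KnotSS.loopAngle, Real.pi + KnotSS.loopAngle) ≠ 0 := KnotSS.jump_det_ne_zero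
    -- The sign of the jump is left undetermined; for either sign the value on the loop is `±1`.
    rcases lt_or_gt_of_ne h3 with h4 | h4
    · rw [sign_neg h4] at h1
      norm_num at h1
    · rw [sign_pos h4] at h1
      norm_num at h1
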